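/- Let $\omega=e^{2\pi i/3}$, $J=\mathrm{diag}(\omega,\omega^2,1)$, and consider the two-component nonlinear Klein–Gordon system $$u_{tt}-u_{xx}=-e^{2u}+e^{-u}\cosh 3v,\qquad v_{tt}-v_{xx}=-e^{-u}\sinh 3v,$$ with real-valued initial data $u(\cdot,0)=u_0$, $u_t(\cdot,0)=u_1$, $v(\cdot,0)=v_0$, $v_t(\cdot,0)=v_1$, all in the Schwartz class $\mathcal S(\mathbb R)$. For $\lambda\neq 0$ put $\mathfrak L(\lambda)=\tfrac12(\lambda J+\lambda^{-1}J^2)=\mathrm{diag}(l_1,l_2,l_3)$, $l_j=\tfrac12(\omega^j\lambda+(\omega^j\lambda)^{-1})$, and $L_1(x,\lambda)=N(x)+\frac1{6\lambda}M(x)$, where $$N=\frac{u_1+u_0'}{6}\begin{pmatrix}0&\omega-1&\omega^2-1\\ \omega^2-1&0&\omega-1\\ \omega-1&\omega^2-1&0\end{pmatrix}-\frac{v_1+v_0'}{2}\begin{pmatrix}0&\omega^2&\omega\\ \omega&0&\omega^2\\ \omega^2&\omega&0\end{pmatrix},$$ $$M=(a+\omega b+\omega^2c)\begin{pmatrix}0&1&0\\0&0&\omega^2\\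 \omega&0&0\end{pmatrix}+(\omega a+b+\omega^2c)\begin{pmatrix}0&0&1\\ \omega^2&0&0\\0&\omega&0\end{pmatrix}+(a+b+c-3)J^2,$$ with $a=e^{-u_0-3v_0}$, $b=e^{3v_0-u_0}$, $c=e^{2u_0}$. Let $X_+$ and $X_+^A$ be the bounded continuous solutions (taken column by column, for those columns that are used) of the Volterra equations $$X_+(x,\lambda)=I-\int_x^\infty e^{(x-y)\mathfrak L}(L_1X_+)(y,\lambda)e^{-(x-y)\mathfrak L}\,dy,\qquad X_+^A(x,\lambda)=I+\int_x^\infty e^{-(x-y)\mathfrak L}(L_1^TX_+^A)(y,\lambda)e^{(x-y)\mathfrak L}\,dy,$$ and define the scattering matrices entrywise by $$s(\lambda)=I-\int_{\mathbb R}e^{-y\mathfrak L}(L_1X_+)(y,\lambda)e^{y\mathfrak L}\,dy,\qquad s^A(\lambda)=I+\int_{\mathbb R}e^{y\mathfrak L}(L_1^TX_+^A)(y,\lambda)e^{-y\mathfrak L}\,dy.$$ **Theorem.** The reflection coefficients $r_1=s_{12}/s_{11}$ on $(0,\infty)$ and $r_2=s^A_{12}/s^A_{11}$ on $(-\infty,0)$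 are well defined: for every $\lambda>0$ (respectively $\lambda<0$) the first two columns of $X_+$ (respectively $X_+^A$) exist and are unique, the integrals defining $s_{11},s_{12}$ (respectively $s^A_{11},s^A_{12}$) converge absolutely, and $s_{11}(\lambda)\ne0$ (respectively $s_{11}^A(\lambda)\neq0$). Moreover: 1. $r_1\in C^\infty((0,\infty))$ and $r_2\in C^\infty((-\infty,0))$, and for all integers $n,k\ge0$, $\partial_\lambda^n r_1(\lambda)=O(\lambda^{-k})$ as $\lambda\to+\infty$ and $\partial_\lambda^n r_2(\lambda)=O(|\lambda|^{-k})$ as $\lambda\to-\infty$. 2. For all integers $n,k\ge0$, $\partial_\lambda^n r_1(\lambda)=O(\lambda^{k})$ as $\lambda\to0^+$ and $\partial_\lambda^n r_2(\lambda)=O(|\lambda|^{k})$ as $\lambda\to0^-$; in particular $r_1$ and $r_2$ extend continuously to $\lambda=0$ with $r_1(0)=r_2(0)=0$. -/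

import Mathlib

open Filter MeasureTheory
open scoped Asymptotics Topology ContDiff SchwartzMap

noncomputable section

namespace TwoComponentKG

/-- The primitive cube root of unity `ω = exp (2 π i / 3)`. -/
def omega : ℂ := Complex.exp (2 * (Real.pi : ℂ) / 3 * Complex.I)

/-- The diagonal entries `l₁, l₂, l₃` of `𝔏(lam) = (lam J + lam⁻¹ J²) / 2`,
`l_j(lam) = (ω^j lam + (ω^j lam)⁻¹) / 2`; the index `j : Fin 3` stands for `j + 1`. -/
def l (lam : ℂ) (j : Fin 3) : ℂ :=
  (omega ^ ((j : ℕ) + 1) * lam + (omega ^ ((j : ℕ) + 1) * lam)⁻¹) / 2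

/-- Initial data of the two-component nonlinear Klein-Gordon system, a second order system in time:
`u(x,0) = u0 x`, `u_t(x,0) = u1 x`, `v(x,0) = v0 x`, `v_t(x,0) = v1 x`, all Schwartz functions. -/
structure InitialData where
  /-- `u(x,0)` -/
  u0 : 𝓢(ℝ, ℝ)
  /-- `u_t(x,0)` -/
  u1 : 𝓢(ℝ, ℝ)
  /-- `v(x,0)` -/
  v0 : 𝓢(ℝ, ℝ)
  /-- `v_t(x,0)` -/
  v1 : 𝓢(ℝ, ℝ)

/-- The matrix `N(x)` at time `0`. -/
def N (D : InitialData) (x : ℝ) : Matrix (Fin 3) (Fin 3) ℂ :=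
  (((D.u1 x + deriv D.u0 x : ℝ) : ℂ) / 6) •
      !![0, omega - 1, omega ^ 2 - 1;
         omega ^ 2 - 1, 0, omega - 1;
         omega - 1, omega ^ 2 - 1, 0]
    - (((D.v1 x + deriv D.v0 x : ℝ) : ℂ) / 2) •
      !![0, omega ^ 2, omega;
         omega, 0, omega ^ 2;
         omega ^ 2, omega, 0]

/-- The matrix `M(x)` at time `0`. -/
def M (D : InitialData) (x : ℝ) : Matrix (Fin 3) (Fin 3) ℂ :=
  let a : ℂ := (Real.exp (-D.u0 x - 3 * D.v0 x) : ℝ)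
  let b : ℂ := (Real.exp (3 * D.v0 x - D.u0 x) : ℝ)
  let c : ℂ := (Real.exp (2 * D.u0 x) : ℝ)
  (a + omega * b + omega ^ 2 * c) •
      !![0, 1, 0;
         0, 0, omega ^ 2;
         omega, 0, 0]
    + (omega * a + b + omega ^ 2 * c) •
      !![0, 0, 1;
         omega ^ 2, 0, 0;
         0, omega, 0]
    + (a + b + c - 3) • (Matrix.diagonal ![omega, omega ^ 2, 1]) ^ 2

/-- The potential `L₁(x, lam) = N(x) + M(x) / (6 lam)` of the `x`-part of the Lax pair
`X_x - [𝔏, X] = L₁ X` at time `0`. -/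
def L₁ (D : InitialData) (lam : ℂ) (x : ℝ) : Matrix (Fin 3) (Fin 3) ℂ :=
  N D x + (6 * lam)⁻¹ • M D x

/-- `w` is the `j`-th column of the Jost matrix normalised at `+∞` of `X_x - [diag d, X] = Q X`,
that is, `w` is a bounded continuous solution of the `j`-th column of the Volterra equation
`X(x) = I - ∫_x^∞ e^{(x - y) diag d} (Q X)(y) e^{-(x - y) diag d} dy`,
the integrals converging absolutely. -/
def IsJostColumn (d : Fin 3 → ℂ) (Q : ℝ → Matrix (Fin 3) (Fin 3) ℂ) (j : Fin 3)
    (w : ℝ → Fin 3 → ℂ) : Prop :=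
  Continuous w ∧ (∃ C : ℝ, ∀ x, ‖w x‖ ≤ C) ∧
    ∀ (x : ℝ) (i : Fin 3),
      IntegrableOn
        (fun y : ℝ => Complex.exp (((x - y : ℝ) : ℂ) * (d i - d j)) * (Q y).mulVec (w y) i)
        (Set.Ioi x) ∧
      w x i = (1 : Matrix (Fin 3) (Fin 3) ℂ) i j -
        ∫ y in Set.Ioi x,
          Complex.exp (((x - y : ℝ) : ℂ) * (d i - d j)) * (Q y).mulVec (w y) i

/-- The `j`-th Jost column (meaningful where it exists and is unique). -/
def jostColumn (d : Fin 3 → ℂ) (Q : ℝ → Matrix (Fin 3) (Fin 3) ℂ) (j : Fin 3) :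
    ℝ → Fin 3 → ℂ :=
  Classical.epsilon (IsJostColumn d Q j)

/-- The integrand of the `(i, j)` entry of
`∫_ℝ e^{-y diag d} (Q X)(y) e^{y diag d} dy`, `X` the Jost matrix normalised at `+∞`. -/
def scatteringIntegrand (d : Fin 3 → ℂ) (Q : ℝ → Matrix (Fin 3) (Fin 3) ℂ) (i j : Fin 3)
    (y : ℝ) : ℂ :=
  Complex.exp (-(y : ℂ) * (d i - d j)) * (Q y).mulVec (jostColumn d Q j y) i

/-- The `(i, j)` entry of the scattering matrix
`I - ∫_ℝ e^{-y diag d} (Q X)(y) e^{y diag d} dy`. -/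
def scatteringEntry (d : Fin 3 → ℂ) (Q : ℝ → Matrix (Fin 3) (Fin 3) ℂ) (i j : Fin 3) : ℂ :=
  (1 : Matrix (Fin 3) (Fin 3) ℂ) i j - ∫ y : ℝ, scatteringIntegrand d Q i j y

/-- The `(i, j)` entry of the scattering matrix
`s(lam) = I - ∫_ℝ e^{-y 𝔏} (L₁ X₊)(y) e^{y 𝔏} dy`, where
`X₊(x) = I - ∫_x^∞ e^{(x - y) 𝔏} (L₁ X₊)(y) e^{-(x - y) 𝔏} dy`. -/
def s (D : InitialData) (i j : Fin 3) (lam : ℂ) : ℂ :=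
  scatteringEntry (l lam) (L₁ D lam) i j

/-- The exponents `-𝔏` of the cofactor problem `X^A_x + [𝔏, X^A] = -L₁ᵀ X^A`. -/
def lA (lam : ℂ) : Fin 3 → ℂ := -l lam

/-- The potential `-L₁ᵀ` of the cofactor problem `X^A_x + [𝔏, X^A] = -L₁ᵀ X^A`. -/
def L₁A (D : InitialData) (lam : ℂ) (x : ℝ) : Matrix (Fin 3) (Fin 3) ℂ :=
  -(L₁ D lam x).transpose

/-- The `(i, j)` entry of the cofactor scattering matrix
`s^A(lam) = I + ∫_ℝ e^{y 𝔏} (L₁ᵀ X₊^A)(y) e^{-y 𝔏} dy`, where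
`X₊^A(x) = I + ∫_x^∞ e^{-(x - y) 𝔏} (L₁ᵀ X₊^A)(y) e^{(x - y) 𝔏} dy`. -/
def sA (D : InitialData) (i j : Fin 3) (lam : ℂ) : ℂ :=
  scatteringEntry (lA lam) (L₁A D lam) i j

/-- The reflection coefficient `r₁ = s₁₂ / s₁₁`, to be considered on `(0, ∞)`. -/
def r₁ (D : InitialData) (lam : ℝ) : ℂ := s D 0 1 lam / s D 0 0 lam

/-- The reflection coefficient `r₂ = s^A₁₂ / s^A₁₁`, to be considered on `(-∞, 0)`. -/
def r₂ (D : InitialData) (lam : ℝ) : ℂ := sA D 0 1 lam / sA D 0 0 lam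

end TwoComponentKG

end

/-! Both reflection coefficients are instances of one function `TodaData.refl`. The matrix `N` is
circulant and `M` is `J²` times a circulant, so in the Fourier basis `eigvec` the operator `𝔏 + L₁`
becomes a real matrix with diagonal `n k` and cyclic nearest-neighbour couplings, `μ / 2` one way
and `exp (α k) μ⁻¹ / 2` the other way. Since `𝔏` is odd in the spectral parameter, the cofactor
problem at `lam < 0` has the same form at `μ = -lam` (`InitialData.L₁A_eq`), and only `μ > 0` has to
be studied.

Existence and smoothness: for `μ > 0` the numbers `l μ 0` and `l μ 1` are complex conjugate and have
the least real part. Hence the exponentials in the Volterra equations of the first two columns are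
bounded, and those in the scattering integrals with both indices in `{0, 1}` are unimodular. In a
space with a suitable exponential weight the Volterra operator has norm at most `1 / 2` however
large the potential is; its resolvent is differentiable in `μ` to every order, with polynomial
bounds in `μ + μ⁻¹` away from `μ = 0` (`polySmooth_scat`).

Nonvanishing: the vector product of the first two Jost columns solves the adjoint system. In the
Fourier basis this is a real system whose couplings all have one sign, so positivity propagates from
`+∞` to the left, and a Grönwall estimate bounds the third component below. At `-∞` that component
tends to `|s₁₁|² - |s₂₁|²`, by the conjugation symmetry `scat_swap`; hence `s₁₁` is bounded away
from zero (`le_norm_scat_sq`).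

Decay: as `μ → ∞` the Jost columns have an expansion in powers of `μ⁻¹` whose off-diagonal terms
vanish at `-∞`, so the off-diagonal scattering entries decay faster than any power
(`exists_norm_scat_le`). A diagonal gauge in the Fourier basis exchanges `μ` and `μ⁻¹`
(`scat_eq_flip`), which turns `μ → 0` into `μ → ∞`. Decay of the derivatives follows by
interpolation between the decay of a function and a polynomial bound for its second derivative
(`RapidDecay.deriv`). -/

open scoped BoundedContinuousFunction

noncomputable section

set_option linter.unusedSectionVars false

namespace TwoComponentKG

/-! ### Calculus of polynomially bounded derivatives, and interpolation of rapid decay. -/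

section PolyBounded

variable {E F G : Type*} [NormedAddCommGroup E] [NormedSpace ℝ E]
  [NormedAddCommGroup F] [NormedSpace ℝ F] [NormedAddCommGroup G] [NormedSpace ℝ G]

/-- The weight `μ + μ⁻¹`, which is large both as `μ → ∞` and as `μ → 0⁺`. -/
def rho (μ : ℝ) : ℝ := μ + μ⁻¹

lemma one_le_rho {μ : ℝ} (h : 0 < μ) : 1 ≤ rho μ := by
  unfold rho
  rcases le_total 1 μ with h1 | h1
  · have : 0 < μ⁻¹ := by positivity
    linarith
  · have : 1 ≤ μ⁻¹ := (one_le_inv₀ h).2 h1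
    linarith

lemma rho_pos {μ : ℝ} (h : 0 < μ) : 0 < rho μ := lt_of_lt_of_le one_pos (one_le_rho h)

lemma le_rho {μ : ℝ} (h : 0 < μ) : μ ≤ rho μ := by
  have : 0 < μ⁻¹ := by positivity
  unfold rho; linarith

lemma inv_le_rho {μ : ℝ} (h : 0 < μ) : μ⁻¹ ≤ rho μ := by
  unfold rho; linarith

lemma rho_inv (μ : ℝ) : rho μ⁻¹ = rho μ := by
  unfold rho; rw [inv_inv, add_comm]

/-- `f` is polynomially bounded in `rho` on `U`. -/
def PolyBound (U : Set ℝ) (f : ℝ → E) : Prop :=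
  ∃ (C : ℝ) (m : ℕ), ∀ μ ∈ U, ‖f μ‖ ≤ C * rho μ ^ m

lemma PolyBound.exists_pos {U : Set ℝ} {f : ℝ → E} (hU : U ⊆ Set.Ioi 0) (h : PolyBound U f) :
    ∃ (C : ℝ) (m : ℕ), 0 ≤ C ∧ ∀ μ ∈ U, ‖f μ‖ ≤ C * rho μ ^ m := by
  obtain ⟨C, m, hC⟩ := h
  refine ⟨|C|, m, abs_nonneg _, fun μ hμ => (hC μ hμ).trans ?_⟩
  have := rho_pos (hU hμ)
  gcongr
  exact le_abs_self C

lemma PolyBound.add {U : Set ℝ} {f g : ℝ → E} (hU : U ⊆ Set.Ioi 0)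
    (hf : PolyBound U f) (hg : PolyBound U g) : PolyBound U (fun μ => f μ + g μ) := by
  obtain ⟨C, m, hC, hf⟩ := hf.exists_pos hU
  obtain ⟨D, n, hD, hg⟩ := hg.exists_pos hU
  refine ⟨C + D, max m n, fun μ hμ => ?_⟩
  have h1 := one_le_rho (hU hμ)
  calc ‖f μ + g μ‖ ≤ ‖f μ‖ + ‖g μ‖ := norm_add_le _ _
    _ ≤ C * rho μ ^ m + D * rho μ ^ n := add_le_add (hf μ hμ) (hg μ hμ)
    _ ≤ C * rho μ ^ (max m n) + D * rho μ ^ (max m n) := by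
        gcongr
        · exact le_max_left _ _
        · exact le_max_right _ _
    _ = _ := by ring

lemma PolyBound.bilin {U : Set ℝ} {f : ℝ → E} {g : ℝ → F} (hU : U ⊆ Set.Ioi 0)
    (B : E →L[ℝ] F →L[ℝ] G)
    (hf : PolyBound U f) (hg : PolyBound U g) : PolyBound U (fun μ => B (f μ) (g μ)) := by
  obtain ⟨C, m, hC, hf⟩ := hf.exists_pos hU
  obtain ⟨D, n, hD, hg⟩ := hg.exists_pos hU
  refine ⟨‖B‖ * C * D, m + n, fun μ hμ => ?_⟩
  have h1 := rho_pos (hU hμ)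
  calc ‖B (f μ) (g μ)‖ ≤ ‖B‖ * ‖f μ‖ * ‖g μ‖ := B.le_opNorm₂ _ _
    _ ≤ ‖B‖ * (C * rho μ ^ m) * (D * rho μ ^ n) := by
        gcongr
        · exact hf μ hμ
        · exact hg μ hμ
    _ = _ := by ring

lemma PolyBound.of_le {U : Set ℝ} {f : ℝ → E} {C : ℝ} (h : ∀ μ ∈ U, ‖f μ‖ ≤ C) : PolyBound U f :=
  ⟨C, 0, by simpa using h⟩

/-- `f` is `n` times differentiable on `U`, all the derivatives being polynomially bounded
in `rho`. -/
def PolySmooth (U : Set ℝ) : ℕ → (ℝ → E) → Prop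
  | 0, f => PolyBound U f
  | n + 1, f => PolyBound U f ∧ (∀ μ ∈ U, DifferentiableAt ℝ f μ) ∧ PolySmooth U n (deriv f)

lemma PolyBound.congr {U : Set ℝ} {f g : ℝ → E} (h : PolyBound U f) (hfg : Set.EqOn f g U) :
    PolyBound U g := by
  obtain ⟨C, m, hC⟩ := h
  exact ⟨C, m, fun μ hμ => by rw [← hfg hμ]; exact hC μ hμ⟩

lemma PolySmooth.congr {U : Set ℝ} (hU : IsOpen U) {n : ℕ} {f g : ℝ → E} (h : PolySmooth U n f)
    (hfg : Set.EqOn f g U) : PolySmooth U n g := by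
  induction n generalizing f g with
  | zero => exact PolyBound.congr h hfg
  | succ n ih =>
    have hev : ∀ μ ∈ U, f =ᶠ[𝓝 μ] g := fun μ hμ =>
      hfg.eventuallyEq_of_mem (hU.mem_nhds hμ)
    exact ⟨h.1.congr hfg, fun μ hμ => (h.2.1 μ hμ).congr_of_eventuallyEq (hev μ hμ).symm,
      ih h.2.2 fun μ hμ => (hev μ hμ).deriv_eq⟩

lemma PolySmooth.of_hasDerivAt {U : Set ℝ} (hU : IsOpen U) {n : ℕ} {f f' : ℝ → E}
    (h0 : PolyBound U f) (h : ∀ μ ∈ U, HasDerivAt f (f' μ) μ) (h' : PolySmooth U n f') :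
    PolySmooth U (n + 1) f :=
  ⟨h0, fun μ hμ => (h μ hμ).differentiableAt, h'.congr hU fun μ hμ => (h μ hμ).deriv.symm⟩

lemma PolySmooth.of_succ {U : Set ℝ} {n : ℕ} {f : ℝ → E} (h : PolySmooth U (n + 1) f) :
    PolySmooth U n f := by
  induction n generalizing f with
  | zero => exact h.1
  | succ n ih => exact ⟨h.1, h.2.1, ih h.2.2⟩

lemma PolySmooth.union {U U' : Set ℝ} (hU : U ⊆ Set.Ioi 0) (hU' : U' ⊆ Set.Ioi 0)
    {n : ℕ} {f : ℝ → E} (h : PolySmooth U n f) (h' : PolySmooth U' n f) :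
    PolySmooth (U ∪ U') n f := by
  have key : ∀ f : ℝ → E, PolyBound U f → PolyBound U' f → PolyBound (U ∪ U') f := by
    intro f hf hf'
    obtain ⟨C, m, hC, hf⟩ := hf.exists_pos hU
    obtain ⟨D, n, hD, hf'⟩ := hf'.exists_pos hU'
    refine ⟨max C D, max m n, fun μ hμ => ?_⟩
    rcases hμ with hμ | hμ
    · have h1 := one_le_rho (hU hμ)
      refine (hf μ hμ).trans ?_
      gcongr
      · exact le_max_left _ _
      · exact le_max_left _ _
    · have h1 := one_le_rho (hU' hμ)
      refine (hf' μ hμ).trans ?_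
      gcongr
      · exact le_max_right _ _
      · exact le_max_right _ _
  induction n generalizing f with
  | zero => exact key f h h'
  | succ n ih =>
    exact ⟨key f h.1 h'.1, fun μ hμ => hμ.elim (h.2.1 μ) (h'.2.1 μ), ih h.2.2 h'.2.2⟩

lemma PolySmooth.const (U : Set ℝ) (n : ℕ) (c : E) : PolySmooth U n (fun _ => c) := by
  induction n generalizing c with
  | zero => exact PolyBound.of_le fun _ _ => le_rfl
  | succ n ih =>
    refine ⟨PolyBound.of_le fun _ _ => le_rfl, fun μ _ => by fun_prop, ?_⟩
    rw [deriv_const']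
    exact ih 0

lemma PolySmooth.add {U : Set ℝ} (hUo : IsOpen U) (hU : U ⊆ Set.Ioi 0) {n : ℕ} {f g : ℝ → E}
    (hf : PolySmooth U n f) (hg : PolySmooth U n g) : PolySmooth U n (fun μ => f μ + g μ) := by
  induction n generalizing f g with
  | zero => exact PolyBound.add hU hf hg
  | succ n ih =>
    exact .of_hasDerivAt hUo (hf.1.add hU hg.1)
      (fun μ hμ => (hf.2.1 μ hμ).hasDerivAt.add (hg.2.1 μ hμ).hasDerivAt) (ih hf.2.2 hg.2.2)

lemma PolySmooth.sum {U : Set ℝ} (hUo : IsOpen U) (hU : U ⊆ Set.Ioi 0) {n : ℕ} {ι : Type*}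
    (s : Finset ι) {f : ι → ℝ → E} (hf : ∀ i ∈ s, PolySmooth U n (f i)) :
    PolySmooth U n (fun μ => ∑ i ∈ s, f i μ) := by
  classical
  induction s using Finset.induction_on with
  | empty => simpa using PolySmooth.const U n (0 : E)
  | insert i s hi ih =>
    simp only [Finset.sum_insert hi]
    exact (hf i (by simp)).add hUo hU (ih fun j hj => hf j (by simp [hj]))

lemma PolySmooth.bilin {U : Set ℝ} (hUo : IsOpen U) (hU : U ⊆ Set.Ioi 0) {n : ℕ}
    {f : ℝ → E} {g : ℝ → F} (B : E →L[ℝ] F →L[ℝ] G)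
    (hf : PolySmooth U n f) (hg : PolySmooth U n g) :
    PolySmooth U n (fun μ => B (f μ) (g μ)) := by
  induction n generalizing f g with
  | zero => exact PolyBound.bilin hU B hf hg
  | succ n ih =>
    refine .of_hasDerivAt hUo (hf.1.bilin hU B hg.1)
      (f' := fun μ => B (f μ) (deriv g μ) + B (deriv f μ) (g μ)) (fun μ hμ => ?_)
      ((ih hf.of_succ hg.2.2).add hUo hU (ih hf.2.2 hg.of_succ))
    exact B.hasDerivAt_of_bilinear (fun _ => (hf.2.1 μ hμ).hasDerivAt)
      (fun _ => (hg.2.1 μ hμ).hasDerivAt)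

lemma PolySmooth.clm {U : Set ℝ} (hUo : IsOpen U) (hU : U ⊆ Set.Ioi 0) {n : ℕ}
    {f : ℝ → E} (L : E →L[ℝ] F) (hf : PolySmooth U n f) : PolySmooth U n (fun μ => L (f μ)) :=
  (PolySmooth.const U n L).bilin hUo hU (.id ℝ (E →L[ℝ] F)) hf

lemma PolySmooth.neg {U : Set ℝ} (hUo : IsOpen U) (hU : U ⊆ Set.Ioi 0) {n : ℕ}
    {f : ℝ → E} (hf : PolySmooth U n f) : PolySmooth U n (fun μ => -f μ) :=
  hf.clm hUo hU (-.id ℝ E)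

lemma PolySmooth.sub {U : Set ℝ} (hUo : IsOpen U) (hU : U ⊆ Set.Ioi 0) {n : ℕ} {f g : ℝ → E}
    (hf : PolySmooth U n f) (hg : PolySmooth U n g) : PolySmooth U n (fun μ => f μ - g μ) := by
  simpa only [sub_eq_add_neg] using hf.add hUo hU (hg.neg hUo hU)

lemma PolySmooth.mul {A : Type*} [NormedRing A] [NormedAlgebra ℝ A] {U : Set ℝ}
    (hUo : IsOpen U) (hU : U ⊆ Set.Ioi 0) {n : ℕ} {f g : ℝ → A}
    (hf : PolySmooth U n f) (hg : PolySmooth U n g) : PolySmooth U n (fun μ => f μ * g μ) :=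
  hf.bilin hUo hU (ContinuousLinearMap.mul ℝ A) hg

lemma PolySmooth.smul {𝕜 : Type*} [NormedField 𝕜] [NormedAlgebra ℝ 𝕜] [NormedSpace 𝕜 E]
    [IsScalarTower ℝ 𝕜 E] {U : Set ℝ}
    (hUo : IsOpen U) (hU : U ⊆ Set.Ioi 0) {n : ℕ} {f : ℝ → 𝕜} {g : ℝ → E}
    (hf : PolySmooth U n f) (hg : PolySmooth U n g) : PolySmooth U n (fun μ => f μ • g μ) :=
  hf.bilin hUo hU (ContinuousLinearMap.lsmul ℝ 𝕜) hg

/-- Inversion in a Banach algebra preserves `PolySmooth`, once the inverses are bounded. -/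
lemma PolySmooth.inverse {A : Type*} [NormedRing A] [NormedAlgebra ℝ A] [CompleteSpace A]
    {U : Set ℝ} (hUo : IsOpen U) (hU : U ⊆ Set.Ioi 0) {n : ℕ} {f g : ℝ → A}
    (hf : PolySmooth U n f) (hg : PolyBound U g) (hfg : ∀ μ ∈ U, f μ * g μ = 1)
    (hgf : ∀ μ ∈ U, g μ * f μ = 1) : PolySmooth U n g := by
  induction n generalizing f g with
  | zero => exact hg
  | succ n ih =>
    have hg' := ih hf.of_succ hg hfg hgf
    refine .of_hasDerivAt hUo hg (f' := fun μ => -(g μ * deriv f μ * g μ)) (fun μ hμ => ?_)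
      (((hg'.mul hUo hU hf.2.2).mul hUo hU hg').neg hUo hU)
    have hinv : ∀ ν ∈ U, Ring.inverse (f ν) = g ν := fun ν hν =>
      Ring.inverse_unit ⟨f ν, g ν, hfg ν hν, hgf ν hν⟩
    have h1 := (hasFDerivAt_ringInverse (𝕜 := ℝ)
      (⟨f μ, g μ, hfg μ hμ, hgf μ hμ⟩ : Aˣ)).comp_hasDerivAt μ (hf.2.1 μ hμ).hasDerivAt
    refine (h1.congr_of_eventuallyEq ?_).congr_deriv ?_
    · filter_upwards [hUo.mem_nhds hμ] with ν hν
      exact (hinv ν hν).symm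
    · simp

lemma PolySmooth.id {U : Set ℝ} (hUo : IsOpen U) (hU : U ⊆ Set.Ioi 0) (n : ℕ) :
    PolySmooth U n (fun μ : ℝ => μ) := by
  have h0 : PolyBound U (fun μ : ℝ => μ) := ⟨1, 1, fun μ hμ => by
    have h : 0 < μ := hU hμ
    simpa [abs_of_pos h] using le_rho h⟩
  cases n with
  | zero => exact h0
  | succ n => exact .of_hasDerivAt hUo h0 (fun μ _ => hasDerivAt_id μ) (.const U n 1)

lemma PolySmooth.inv_id {U : Set ℝ} (hUo : IsOpen U) (hU : U ⊆ Set.Ioi 0) (n : ℕ) :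
    PolySmooth U n (fun μ : ℝ => μ⁻¹) := by
  refine (PolySmooth.id hUo hU n).inverse hUo hU ⟨1, 1, fun μ hμ => ?_⟩
    (fun μ hμ => mul_inv_cancel₀ (hU hμ).ne') (fun μ hμ => inv_mul_cancel₀ (hU hμ).ne')
  have h : 0 < μ := hU hμ
  simpa [abs_of_pos h] using inv_le_rho h

/-- `rho` is invariant under inversion, and the chain rule only brings in the factor `-μ⁻²`, which
`rho` controls. -/
lemma PolySmooth.comp_inv {U U' : Set ℝ} (hUo' : IsOpen U')
    (hU' : U' ⊆ Set.Ioi 0) (hmaps : Set.MapsTo (fun μ => μ⁻¹) U' U) {n : ℕ} {f : ℝ → E}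
    (hf : PolySmooth U n f) : PolySmooth U' n (fun μ => f μ⁻¹) := by
  have key : ∀ f : ℝ → E, PolyBound U f → PolyBound U' (fun μ => f μ⁻¹) := by
    rintro f ⟨C, m, h⟩
    exact ⟨C, m, fun μ hμ => by simpa [rho_inv] using h _ (hmaps hμ)⟩
  induction n generalizing f with
  | zero => exact key f hf
  | succ n ih =>
    have h1 := ih hf.2.2
    have h2 := PolySmooth.inv_id hUo' hU' n
    refine .of_hasDerivAt hUo' (key f hf.1) (f' := fun μ => (-(μ⁻¹ * μ⁻¹)) • deriv f μ⁻¹)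
      (fun μ hμ => ?_) (((h2.mul hUo' hU' h2).neg hUo' hU').smul hUo' hU' h1)
    have h3 := (hf.2.1 _ (hmaps hμ)).hasDerivAt.scomp μ (hasDerivAt_inv (hU' hμ).ne')
    refine h3.congr_deriv ?_
    rw [sq, mul_inv]

/-- One order is lost because the derivative of highest order is only known to be bounded; its
antecedent is continuous, being differentiable. -/
lemma PolySmooth.contDiffOn {U : Set ℝ} (hUo : IsOpen U) {n : ℕ} {f : ℝ → E}
    (h : PolySmooth U (n + 1) f) : ContDiffOn ℝ n f U := by
  induction n generalizing f with
  | zero =>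
    rw [Nat.cast_zero, contDiffOn_zero]
    exact fun μ hμ => (h.2.1 μ hμ).continuousAt.continuousWithinAt
  | succ n ih =>
    rw [Nat.cast_succ, contDiffOn_succ_iff_deriv_of_isOpen hUo]
    exact ⟨fun μ hμ => (h.2.1 μ hμ).differentiableWithinAt, by simp, ih h.2.2⟩

/-- Faster than polynomial decay in `rho` on the half-line. -/
def RapidDecay (f : ℝ → E) : Prop :=
  ∀ k : ℕ, ∃ C : ℝ, ∀ μ : ℝ, 0 < μ → ‖f μ‖ * rho μ ^ k ≤ C

lemma rho_le_two_mul {μ t : ℝ} (h : 0 < μ) (h1 : μ ≤ t) (h2 : t ≤ 2 * μ) :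
    rho t ≤ 2 * rho μ ∧ rho μ ≤ 2 * rho t := by
  have ht : 0 < t := h.trans_le h1
  have a : t⁻¹ ≤ μ⁻¹ := inv_anti₀ h h1
  have b : μ⁻¹ ≤ 2 * t⁻¹ := by
    have : (2 * μ)⁻¹ ≤ t⁻¹ := inv_anti₀ ht h2
    rw [mul_inv] at this
    linarith
  have c : 0 < μ⁻¹ := by positivity
  unfold rho
  constructor <;> linarith

/-- Taylor's formula `f (a + h) - f a = h f' a + O(M h²)`, solved for `f' a`; the step `h` stays
free for optimisation. -/
lemma norm_deriv_le_of_second_deriv {f : ℝ → E} {a h M : ℝ} (hh : 0 < h)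
    (hf : ∀ t ∈ Set.Icc a (a + h), DifferentiableAt ℝ f t)
    (hf' : ∀ t ∈ Set.Icc a (a + h), DifferentiableAt ℝ (deriv f) t)
    (hM : ∀ t ∈ Set.Icc a (a + h), ‖deriv (deriv f) t‖ ≤ M) :
    ‖deriv f a‖ ≤ (‖f (a + h)‖ + ‖f a‖) / h + M * h := by
  have hmem : a ∈ Set.Icc a (a + h) := ⟨le_rfl, by linarith⟩
  have hmem' : a + h ∈ Set.Icc a (a + h) := ⟨by linarith, le_rfl⟩
  have h1 : ∀ t ∈ Set.Icc a (a + h), ‖deriv f t - deriv f a‖ ≤ M * h := by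
    intro t ht
    refine ((convex_Icc a (a + h)).norm_image_sub_le_of_norm_deriv_le hf' hM hmem ht).trans ?_
    have : ‖t - a‖ ≤ h := by
      rw [Real.norm_eq_abs, abs_of_nonneg (by linarith [ht.1])]; linarith [ht.2]
    have hM0 : 0 ≤ M := (norm_nonneg _).trans (hM a hmem)
    gcongr
  have h2 := (convex_Icc a (a + h)).norm_image_sub_le_of_norm_hasDerivWithin_le
    (f := fun t => f t - (t - a) • deriv f a) (f' := fun t => deriv f t - deriv f a)
    (fun t ht => by
      have := ((hf t ht).hasDerivAt.sub
        (((hasDerivAt_id t).sub_const a).smul_const (deriv f a))).hasDerivWithinAt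
          (s := Set.Icc a (a + h))
      simpa only [one_smul] using! this) h1 hmem hmem'
  simp only [add_sub_cancel_left, sub_self, zero_smul, sub_zero, Real.norm_eq_abs,
    abs_of_pos hh] at h2
  have h3 : ‖h • deriv f a‖ ≤ ‖f (a + h)‖ + ‖f a‖ + M * h * h := by
    have : h • deriv f a = f (a + h) - f a - (f (a + h) - h • deriv f a - f a) := by abel
    rw [this]
    exact (norm_sub_le _ _).trans (add_le_add (norm_sub_le _ _) h2)
  rw [norm_smul, Real.norm_eq_abs, abs_of_pos hh] at h3
  have : ‖deriv f a‖ = h * ‖deriv f a‖ / h := by field_simp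
  rw [this, div_add' _ _ _ hh.ne']
  gcongr

/-- Landau–Kolmogorov interpolation: `f'` is of size `|f| / h + h |f''|`. A step `h` equal to a high
negative power of `rho` beats the polynomial growth of `f''`, while the decay of `f` pays for the
division by `h`. -/
lemma RapidDecay.deriv {f : ℝ → E} (hf : RapidDecay f) (h2 : PolySmooth (Set.Ioi 0) 2 f) :
    RapidDecay (deriv f) := by
  intro k
  obtain ⟨M, m, hM0, hM⟩ := h2.2.2.2.2.exists_pos le_rfl
  -- The part `m + k` compensates the growth of `f''` and the factor `rho μ ^ k`; the extra `1`
  -- gives `h ≤ (rho μ)⁻¹ ≤ μ`, so that `[μ, μ + h]` lies in `[μ, 2 μ]`, where `rho` changes by a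
  -- factor at most two.
  set p := m + k + 1 with hp
  obtain ⟨C, hC⟩ := hf (p + k)
  have hC0 : 0 ≤ C := le_trans (by have := rho_pos one_pos; positivity) (hC 1 one_pos)
  refine ⟨2 ^ (p + k) * C + C + M * 2 ^ m, fun μ hμ => ?_⟩
  have hr := rho_pos hμ
  have hr1 := one_le_rho hμ
  set h : ℝ := (rho μ ^ p)⁻¹ with hh
  have hh0 : 0 < h := by positivity
  have hhμ : h ≤ μ := by
    rw [hh, inv_le_comm₀ (by positivity) hμ]
    refine (inv_le_rho hμ).trans ?_
    calc rho μ = rho μ ^ 1 := (pow_one _).symm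
      _ ≤ rho μ ^ p := pow_le_pow_right₀ hr1 (by omega)
  have hsub : ∀ t ∈ Set.Icc μ (μ + h), 0 < t ∧ rho t ≤ 2 * rho μ := fun t ht =>
    ⟨hμ.trans_le ht.1, (rho_le_two_mul hμ ht.1 (by linarith [ht.2])).1⟩
  have key := norm_deriv_le_of_second_deriv (M := M * (2 * rho μ) ^ m) hh0
    (fun t ht => h2.2.1 t (hsub t ht).1) (fun t ht => h2.2.2.2.1 t (hsub t ht).1)
    (fun t ht => (hM t (hsub t ht).1).trans (by
      have := rho_pos (hsub t ht).1
      gcongr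
      exact (hsub t ht).2))
  have e1 := hC μ hμ
  have e2 : ‖f (μ + h)‖ * rho μ ^ (p + k) ≤ 2 ^ (p + k) * C := by
    have := hC (μ + h) (by linarith)
    have h3 := (rho_le_two_mul hμ (by linarith : μ ≤ μ + h) (by linarith)).2
    have h4 : 0 < rho (μ + h) := rho_pos (by linarith)
    calc ‖f (μ + h)‖ * rho μ ^ (p + k) ≤ ‖f (μ + h)‖ * (2 * rho (μ + h)) ^ (p + k) := by gcongr
      _ = 2 ^ (p + k) * (‖f (μ + h)‖ * rho (μ + h) ^ (p + k)) := by ring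
      _ ≤ _ := by gcongr
  calc ‖_root_.deriv f μ‖ * rho μ ^ k
      ≤ ((‖f (μ + h)‖ + ‖f μ‖) / h + M * (2 * rho μ) ^ m * h) * rho μ ^ k := by gcongr
    _ = ‖f (μ + h)‖ * rho μ ^ (p + k) + ‖f μ‖ * rho μ ^ (p + k)
          + M * 2 ^ m * (rho μ ^ (m + k) * (rho μ ^ p)⁻¹) := by
        rw [hh, div_inv_eq_mul]; ring
    _ ≤ 2 ^ (p + k) * C + C + M * 2 ^ m * 1 := by
        gcongr
        rw [mul_inv_le_iff₀ (by positivity), one_mul]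
        exact pow_le_pow_right₀ hr1 (by omega)
    _ = _ := by ring

lemma RapidDecay.iteratedDeriv {f : ℝ → E} (hf : RapidDecay f)
    (hs : ∀ n, PolySmooth (Set.Ioi 0) n f) (n : ℕ) : RapidDecay (iteratedDeriv n f) := by
  induction n generalizing f with
  | zero => simpa using hf
  | succ n ih =>
    rw [iteratedDeriv_succ']
    exact ih (hf.deriv (hs 2)) fun n => (hs (n + 1)).2.2

lemma RapidDecay.isBigO_atTop {f : ℝ → E} (hf : RapidDecay f) (k : ℕ) :
    f =O[atTop] fun μ : ℝ => (μ ^ k)⁻¹ := by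
  obtain ⟨C, hC⟩ := hf k
  refine Asymptotics.IsBigO.of_bound C ?_
  filter_upwards [eventually_gt_atTop 0] with μ hμ
  rw [Real.norm_eq_abs, abs_of_pos (by positivity), ← div_eq_mul_inv, le_div_iff₀ (by positivity)]
  refine le_trans ?_ (hC μ hμ)
  have := le_rho hμ
  gcongr

lemma RapidDecay.isBigO_nhdsGT {f : ℝ → E} (hf : RapidDecay f) (k : ℕ) :
    f =O[𝓝[>] 0] fun μ : ℝ => μ ^ k := by
  obtain ⟨C, hC⟩ := hf k
  refine Asymptotics.IsBigO.of_bound C ?_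
  filter_upwards [self_mem_nhdsWithin] with μ hμ
  have hμ : 0 < μ := hμ
  rw [Real.norm_eq_abs, abs_of_pos (by positivity)]
  have h1 : ‖f μ‖ * (μ⁻¹) ^ k ≤ C := by
    refine le_trans ?_ (hC μ hμ)
    have := inv_le_rho hμ
    gcongr
  rwa [inv_pow, ← div_eq_mul_inv, div_le_iff₀ (by positivity)] at h1

end PolyBounded

/-! ### Exponentials as differentiable families of bounded continuous functions. -/

section ExpFamily

/-- The left half-plane is convex and `exp` is bounded by one on it, so the mean value inequality
can be applied twice along the segment from `z` to `w`. -/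
lemma norm_exp_sub_exp_sub_le {z w : ℂ} (hz : z.re ≤ 0) (hw : w.re ≤ 0) :
    ‖Complex.exp w - Complex.exp z - (w - z) * Complex.exp z‖ ≤ ‖w - z‖ ^ 2 := by
  have hconv : Convex ℝ (segment ℝ z w) := convex_segment z w
  have hH : Convex ℝ {z : ℂ | z.re ≤ 0} := convex_halfSpace_re_le 0
  have hsub : segment ℝ z w ⊆ {z : ℂ | z.re ≤ 0} := hH.segment_subset hz hw
  have hb : ∀ u ∈ segment ℝ z w, ‖Complex.exp u‖ ≤ 1 := fun u hu => by
    rw [Complex.norm_exp]; exact Real.exp_le_one_iff.2 (hsub hu)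
  have hlen : ∀ u ∈ segment ℝ z w, ‖u - z‖ ≤ ‖w - z‖ := by
    rintro u hu
    rw [segment_eq_image'] at hu
    obtain ⟨θ, hθ, rfl⟩ := hu
    simp only [add_sub_cancel_left, norm_smul, Real.norm_eq_abs, abs_of_nonneg hθ.1]
    exact mul_le_of_le_one_left (norm_nonneg _) hθ.2
  have h1 : ∀ u ∈ segment ℝ z w, ‖Complex.exp u - Complex.exp z‖ ≤ ‖w - z‖ := fun u hu => by
    refine (hconv.norm_image_sub_le_of_norm_hasDerivWithin_le
      (fun v _ => (Complex.hasDerivAt_exp v).hasDerivWithinAt) hb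
      (left_mem_segment ℝ z w) hu).trans ?_
    rw [one_mul]; exact hlen u hu
  have h2 := hconv.norm_image_sub_le_of_norm_hasDerivWithin_le
    (f := fun u => Complex.exp u - (u - z) * Complex.exp z)
    (f' := fun u => Complex.exp u - Complex.exp z)
    (fun v _ => by
      have := ((Complex.hasDerivAt_exp v).sub
        (((hasDerivAt_id v).sub_const z).mul_const (Complex.exp z)))
      simpa only [one_mul] using! this.hasDerivWithinAt)
    h1 (left_mem_segment ℝ z w) (right_mem_segment ℝ z w)
  calc _ = ‖Complex.exp w - (w - z) * Complex.exp z
        - (Complex.exp z - (z - z) * Complex.exp z)‖ := by congr 1; ring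
    _ ≤ _ := h2
    _ = _ := by ring

/-- The exponents `c` for which `exp (-τ(t) c)` is bounded by one. -/
def admissible (τ : C(ℝ, ℝ)) : Set ℂ := {c | ∀ t, 0 ≤ τ t * c.re}

lemma norm_exp_neg_le {τ : C(ℝ, ℝ)} {c : ℂ} (hc : c ∈ admissible τ) (t : ℝ) :
    ‖Complex.exp (-(τ t : ℂ) * c)‖ ≤ 1 := by
  rw [Complex.norm_exp, Real.exp_le_one_iff]
  simpa using hc t

open Classical in
/-- The function `t ↦ (1 + |t|)⁻ⁿ exp (-τ(t) c)` as a bounded continuous function. -/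
def expFamily (τ : C(ℝ, ℝ)) (n : ℕ) (c : ℂ) : ℝ →ᵇ ℂ :=
  if hc : c ∈ admissible τ then
    BoundedContinuousFunction.ofNormedAddCommGroup
      (fun t => (((1 + |t|) ^ n)⁻¹ : ℝ) * Complex.exp (-(τ t : ℂ) * c))
      (by
        refine Continuous.mul (Complex.continuous_ofReal.comp (Continuous.inv₀ (by fun_prop)
          fun t => ?_)) (by fun_prop)
        positivity) 1
      (fun t => by
        rw [norm_mul, Complex.norm_real, Real.norm_eq_abs, abs_of_pos (by positivity)]
        refine mul_le_one₀ (inv_le_one_of_one_le₀ (one_le_pow₀ (by linarith [abs_nonneg t])))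
          (norm_nonneg _) (norm_exp_neg_le hc t))
  else 0

lemma expFamily_apply {τ : C(ℝ, ℝ)} {c : ℂ} (hc : c ∈ admissible τ) (n : ℕ) (t : ℝ) :
    expFamily τ n c t = (((1 + |t|) ^ n)⁻¹ : ℝ) * Complex.exp (-(τ t : ℂ) * c) := by
  simp [expFamily, hc]

/-- No admissibility is needed, because the default value outside `admissible τ` is zero. -/
lemma norm_expFamily_le (τ : C(ℝ, ℝ)) (n : ℕ) (c : ℂ) : ‖expFamily τ n c‖ ≤ 1 := by
  unfold expFamily
  split_ifs
  · exact BoundedContinuousFunction.norm_ofNormedAddCommGroup_le _ zero_le_one _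
  · simp

/-- The multiplier `-τ(t) / (1 + |t|)` relating `expFamily` to its derivative in the exponent. -/
def expMultiplier (τ : C(ℝ, ℝ)) (hτ : ∀ t, |τ t| ≤ |t|) : ℝ →ᵇ ℂ :=
  BoundedContinuousFunction.ofNormedAddCommGroup
    (fun t => ((-τ t * (1 + |t|)⁻¹ : ℝ) : ℂ))
    (by
      refine Complex.continuous_ofReal.comp (Continuous.mul (by fun_prop)
        (Continuous.inv₀ (by fun_prop) fun t => ?_))
      positivity) 1
    (fun t => by
      rw [Complex.norm_real, Real.norm_eq_abs, abs_mul, abs_neg, abs_inv,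
        abs_of_pos (by positivity : 0 < 1 + |t|), ← div_eq_mul_inv, div_le_one (by positivity)]
      linarith [hτ t])

/-- Differentiating the exponential in `c` produces the unbounded factor `-τ t`. One power of `1 +
|t|` makes it bounded, and the quadratic remainder needs two; hence the index `n + 2`. -/
lemma expFamily_taylor {τ : C(ℝ, ℝ)} (hτ : ∀ t, |τ t| ≤ |t|) (n : ℕ) {c d : ℂ}
    (hc : c ∈ admissible τ) (hd : d ∈ admissible τ) :
    ‖expFamily τ (n + 2) d - expFamily τ (n + 2) c
      - (d - c) • (expMultiplier τ hτ * expFamily τ (n + 1) c)‖ ≤ ‖d - c‖ ^ 2 := by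
  refine (BoundedContinuousFunction.norm_le (by positivity)).2 fun t => ?_
  have h1 : (0 : ℝ) < 1 + |t| := by positivity
  have h1' : ((1 + |t| : ℝ) : ℂ) ≠ 0 := by exact_mod_cast h1.ne'
  have e : (expFamily τ (n + 2) d - expFamily τ (n + 2) c
      - (d - c) • (expMultiplier τ hτ * expFamily τ (n + 1) c)) t
      = ((((1 + |t|) ^ (n + 2))⁻¹ : ℝ) : ℂ) * (Complex.exp (-(τ t : ℂ) * d)
        - Complex.exp (-(τ t : ℂ) * c)
        - (-(τ t : ℂ) * d - -(τ t : ℂ) * c) * Complex.exp (-(τ t : ℂ) * c)) := by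
    simp only [BoundedContinuousFunction.coe_sub, BoundedContinuousFunction.coe_smul,
      BoundedContinuousFunction.coe_mul, Pi.sub_apply, Pi.mul_apply, expFamily_apply hc,
      expFamily_apply hd, smul_eq_mul]
    simp only [expMultiplier, BoundedContinuousFunction.coe_ofNormedAddCommGroup]
    rw [pow_succ _ (n + 1)]
    push_cast at h1' ⊢
    field_simp
    ring
  rw [e, norm_mul, Complex.norm_real, Real.norm_eq_abs, abs_of_pos (by positivity)]
  have h2 := norm_exp_sub_exp_sub_le (z := -(τ t : ℂ) * c) (w := -(τ t : ℂ) * d)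
    (by simpa using hc t) (by simpa using hd t)
  have h3 : ‖-(τ t : ℂ) * d - -(τ t : ℂ) * c‖ ≤ (1 + |t|) * ‖d - c‖ := by
    rw [← mul_sub, norm_mul, norm_neg, Complex.norm_real, Real.norm_eq_abs]
    gcongr
    linarith [hτ t]
  have h4 : (1 + |t|) ^ 2 ≤ (1 + |t|) ^ (n + 2) :=
    pow_le_pow_right₀ (by linarith [abs_nonneg t]) (by omega)
  rw [inv_mul_le_iff₀ (by positivity)]
  calc _ ≤ _ := h2
    _ ≤ ((1 + |t|) * ‖d - c‖) ^ 2 := by gcongr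
    _ = (1 + |t|) ^ 2 * ‖d - c‖ ^ 2 := by ring
    _ ≤ _ := by gcongr

/-- The set `admissible τ` need not be open (for the identity it is the imaginary axis), so the
derivative is taken within it and then composed with a curve that stays inside. -/
lemma hasDerivAt_expFamily {τ : C(ℝ, ℝ)} (hτ : ∀ t, |τ t| ≤ |t|) (n : ℕ) {U : Set ℝ}
    (hUo : IsOpen U) {c : ℝ → ℂ} {c' : ℂ} (hc : ∀ μ ∈ U, c μ ∈ admissible τ) {μ : ℝ} (hμ : μ ∈ U)
    (h : HasDerivAt c c' μ) :
    HasDerivAt (fun ν => expFamily τ (n + 2) (c ν))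
      (c' • (expMultiplier τ hτ * expFamily τ (n + 1) (c μ))) μ := by
  have h1 : HasDerivWithinAt (expFamily τ (n + 2))
      (expMultiplier τ hτ * expFamily τ (n + 1) (c μ)) (admissible τ) (c μ) := by
    rw [hasDerivWithinAt_iff_isLittleO]
    refine Asymptotics.IsBigO.trans_isLittleO
      (g := fun d : ℂ => ‖d - c μ‖ ^ 2) ?_ ?_
    · refine Asymptotics.IsBigO.of_bound 1 ?_
      filter_upwards [self_mem_nhdsWithin] with d hd
      simpa using expFamily_taylor hτ n (hc μ hμ) hd
    · exact (Asymptotics.isLittleO_pow_sub_sub (c μ) one_lt_two).mono nhdsWithin_le_nhds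
  exact (h1.scomp μ h.hasDerivWithinAt hc).hasDerivAt (hUo.mem_nhds hμ)

/-- Each derivative costs one power of `1 + |t|`, and one more is kept for the quadratic Taylor
remainder. -/
lemma polySmooth_expFamily {τ : C(ℝ, ℝ)} (hτ : ∀ t, |τ t| ≤ |t|) {U : Set ℝ}
    (hUo : IsOpen U) (hU : U ⊆ Set.Ioi 0) {c c' : ℝ → ℂ} (hc : ∀ μ ∈ U, c μ ∈ admissible τ)
    (h : ∀ μ ∈ U, HasDerivAt c (c' μ) μ) (m : ℕ) (hc' : PolySmooth U m c') (n : ℕ)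
    (hn : m + 1 ≤ n) :
    PolySmooth U m (fun μ => expFamily τ n (c μ)) := by
  induction m generalizing n with
  | zero => exact PolyBound.of_le fun μ _ => norm_expFamily_le _ _ _
  | succ m ih =>
    obtain ⟨n, rfl⟩ : ∃ k, n = k + 2 := ⟨n - 2, by omega⟩
    refine .of_hasDerivAt hUo (PolyBound.of_le fun μ _ => norm_expFamily_le _ _ _)
      (fun μ hμ => hasDerivAt_expFamily hτ n hUo hc hμ (h μ hμ)) ?_
    exact hc'.of_succ.smul hUo hU ((PolySmooth.const U m _).mul hUo hU
      (ih hc'.of_succ (n + 1) (by omega)))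

end ExpFamily

/-! ### Volterra operators in weighted spaces. -/

section Volterra

variable {V : Type*} [NormedAddCommGroup V] [NormedSpace ℂ V]
  {V' : Type*} [NormedAddCommGroup V'] [NormedSpace ℂ V']

/-- The weight `(1 + |x|)ⁿ exp Γ(x)`. -/
def weight (n : ℕ) (Γ : ℝ → ℝ) (x : ℝ) : ℝ := (1 + |x|) ^ n * Real.exp (Γ x)

lemma weight_pos (n : ℕ) (Γ : ℝ → ℝ) (x : ℝ) : 0 < weight n Γ x := by unfold weight; positivity

lemma continuous_weight (n : ℕ) {Γ : ℝ → ℝ} (hΓ : Continuous Γ) : Continuous (weight n Γ) := by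
  unfold weight; fun_prop

/-- The kernel by which `expFamily` and the potential are multiplied in weighted spaces. -/
def weightKernel (n : ℕ) (Γ : ℝ → ℝ) (x y : ℝ) : ℝ :=
  (weight n Γ x)⁻¹ * (1 + |y - x|) ^ n * weight n Γ y

lemma weightKernel_pos (n : ℕ) (Γ : ℝ → ℝ) (x y : ℝ) : 0 < weightKernel n Γ x y := by
  have := weight_pos n Γ x
  have := weight_pos n Γ y
  unfold weightKernel; positivity

lemma continuous_weightKernel (n : ℕ) {Γ : ℝ → ℝ} (hΓ : Continuous Γ) :
    Continuous (fun p : ℝ × ℝ => weightKernel n Γ p.1 p.2) := by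
  have h := continuous_weight n hΓ
  unfold weightKernel
  refine Continuous.mul (Continuous.mul (Continuous.inv₀ (by fun_prop) fun p => ?_)
    (by fun_prop)) (by fun_prop)
  exact (weight_pos _ _ _).ne'

/-- Rests on `1 + |y - x| ≤ (1 + |x|) (1 + |y|)`. The polynomial part of the weight at `x` absorbs
the first factor, and the decay of the potential will absorb `(1 + |y|) ^ (2 n)`; thus a loss of
powers of `y - x` from differentiating in `μ` is harmless. -/
lemma weightKernel_le (n : ℕ) (Γ : ℝ → ℝ) (x y : ℝ) :
    weightKernel n Γ x y ≤ Real.exp (-Γ x) * ((1 + |y|) ^ (2 * n) * Real.exp (Γ y)) := by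
  have h1 : 1 + |y - x| ≤ (1 + |x|) * (1 + |y|) := by
    have := abs_sub y x
    nlinarith [abs_nonneg x, abs_nonneg y, mul_nonneg (abs_nonneg x) (abs_nonneg y)]
  have h2 : (1 + |y - x|) ^ n ≤ ((1 + |x|) * (1 + |y|)) ^ n := by gcongr
  have hx : 0 < (1 + |x|) ^ n := by positivity
  unfold weightKernel weight
  calc ((1 + |x|) ^ n * Real.exp (Γ x))⁻¹ * (1 + |y - x|) ^ n * ((1 + |y|) ^ n * Real.exp (Γ y))
      ≤ ((1 + |x|) ^ n * Real.exp (Γ x))⁻¹ * ((1 + |x|) * (1 + |y|)) ^ n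
        * ((1 + |y|) ^ n * Real.exp (Γ y)) := by gcongr
    _ = _ := by
      rw [Real.exp_neg, mul_pow, two_mul, pow_add]
      field_simp

/-- The integrand of `volterraFun`. -/
def volterraIntegrand (n : ℕ) (Γ : ℝ → ℝ) (f : ℝ → ℂ) (T : V →L[ℂ] V') (e : ℝ →ᵇ ℂ) (v : ℝ →ᵇ V)
    (x y : ℝ) : V' :=
  ((weightKernel n Γ x y : ℂ) * f y) • (e (y - x) • T (v y))

variable {n : ℕ} {Γ : ℝ → ℝ} {f : ℝ → ℂ} (T : V →L[ℂ] V') (e : ℝ →ᵇ ℂ) (v : ℝ →ᵇ V)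

lemma norm_volterraIntegrand_le (x y : ℝ) :
    ‖volterraIntegrand n Γ f T e v x y‖ ≤
      ‖T‖ * ‖e‖ * ‖v‖ * (Real.exp (-Γ x) * ((1 + |y|) ^ (2 * n) * ‖f y‖ * Real.exp (Γ y))) := by
  unfold volterraIntegrand
  rw [norm_smul, norm_smul, norm_mul, Complex.norm_real, Real.norm_eq_abs,
    abs_of_pos (weightKernel_pos _ _ _ _)]
  calc weightKernel n Γ x y * ‖f y‖ * (‖e (y - x)‖ * ‖T (v y)‖)
      ≤ (Real.exp (-Γ x) * ((1 + |y|) ^ (2 * n) * Real.exp (Γ y))) * ‖f y‖ *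
        (‖e‖ * (‖T‖ * ‖v‖)) := by
        gcongr
        · exact weightKernel_le n Γ x y
        · exact e.norm_coe_le_norm _
        · exact T.le_opNorm_of_le (v.norm_coe_le_norm y)
    _ = _ := by ring

lemma continuous_volterraIntegrand (hΓ : Continuous Γ) (hf : Continuous f) :
    Continuous (fun p : ℝ × ℝ => volterraIntegrand n Γ f T e v p.1 p.2) := by
  have h := continuous_weightKernel n hΓ
  unfold volterraIntegrand
  fun_prop

lemma integrable_volterraIntegrand (hΓ : Continuous Γ) (hf : Continuous f)
    (hi : Integrable fun y => (1 + |y|) ^ (2 * n) * ‖f y‖ * Real.exp (Γ y)) (x : ℝ) :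
    Integrable (volterraIntegrand n Γ f T e v x) := by
  refine ((hi.const_mul (Real.exp (-Γ x))).const_mul (‖T‖ * ‖e‖ * ‖v‖)).mono' ?_
    (Eventually.of_forall fun y => norm_volterraIntegrand_le T e v x y)
  have := continuous_volterraIntegrand (n := n) T e v hΓ hf
  exact (this.comp (by fun_prop : Continuous fun y : ℝ => (x, y))).aestronglyMeasurable

lemma norm_volterraIntegral_le
    (hi : Integrable fun y => (1 + |y|) ^ (2 * n) * ‖f y‖ * Real.exp (Γ y)) (x : ℝ) :
    ‖∫ y in Set.Ioi x, volterraIntegrand n Γ f T e v x y‖ ≤ ‖T‖ * ‖e‖ * ‖v‖ *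
      (Real.exp (-Γ x) * ∫ y in Set.Ioi x, (1 + |y|) ^ (2 * n) * ‖f y‖ * Real.exp (Γ y)) := by
  have h := norm_integral_le_of_norm_le (μ := volume.restrict (Set.Ioi x))
    ((hi.integrableOn.const_mul (Real.exp (-Γ x))).const_mul (‖T‖ * ‖e‖ * ‖v‖))
    (Eventually.of_forall fun y => norm_volterraIntegrand_le T e v x y)
  rwa [integral_const_mul, integral_const_mul] at h

lemma continuous_volterraIntegral (hΓ : Continuous Γ) (hΓ0 : ∀ x, 0 ≤ Γ x) (hf : Continuous f)
    (hi : Integrable fun y => (1 + |y|) ^ (2 * n) * ‖f y‖ * Real.exp (Γ y)) :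
    Continuous fun x => ∫ y in Set.Ioi x, volterraIntegrand n Γ f T e v x y := by
  have hc := continuous_volterraIntegrand (n := n) T e v hΓ hf
  simp_rw [← integral_indicator (measurableSet_Ioi)]
  rw [continuous_iff_continuousAt]
  intro x₀
  refine continuousAt_of_dominated (bound := fun y => ‖T‖ * ‖e‖ * ‖v‖ *
    ((1 + |y|) ^ (2 * n) * ‖f y‖ * Real.exp (Γ y))) ?_ ?_ (hi.const_mul _) ?_
  · refine Eventually.of_forall fun x => AEStronglyMeasurable.indicator ?_ measurableSet_Ioi
    exact (hc.comp (by fun_prop : Continuous fun y : ℝ => (x, y))).aestronglyMeasurable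
  · refine Eventually.of_forall fun x => Eventually.of_forall fun y => ?_
    refine (norm_indicator_le_norm_self _ _).trans ((norm_volterraIntegrand_le T e v x y).trans ?_)
    refine mul_le_mul_of_nonneg_left (mul_le_of_le_one_left (by positivity)
      (Real.exp_le_one_iff.2 ?_)) (by positivity)
    linarith [hΓ0 x]
  · have hne : ∀ᵐ y : ℝ, y ≠ x₀ := volume.ae_ne x₀
    filter_upwards [hne] with y hy
    have hcx : Continuous fun x => volterraIntegrand n Γ f T e v x y := by
      have hp : Continuous fun x : ℝ => (x, y) := by fun_prop
      have hcp := hc.comp hp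
      exact hcp
    rcases lt_or_gt_of_ne hy with h | h
    · have h1 : (fun x => (Set.Ioi x).indicator (fun y => volterraIntegrand n Γ f T e v x y) y)
          =ᶠ[𝓝 x₀] fun _ => (0 : V') := by
        filter_upwards [lt_mem_nhds h] with x hx
        exact Set.indicator_of_notMem (by simpa using hx.le) _
      exact h1.continuousAt
    · have h1 : (fun x => (Set.Ioi x).indicator (fun y => volterraIntegrand n Γ f T e v x y) y)
          =ᶠ[𝓝 x₀] fun x => volterraIntegrand n Γ f T e v x y := by
        filter_upwards [gt_mem_nhds h] with x hx
        exact Set.indicator_of_mem (by simpa using hx) _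
      exact (continuousAt_congr h1).2 hcx.continuousAt

/-- Hypotheses under which the weighted Volterra operator is bounded. -/
structure VolterraHyp (n : ℕ) (Γ : ℝ → ℝ) (f : ℝ → ℂ) : Prop where
  cont_weight : Continuous Γ
  nonneg : ∀ x, 0 ≤ Γ x
  cont : Continuous f
  int : Integrable fun y => (1 + |y|) ^ (2 * n) * ‖f y‖ * Real.exp (Γ y)

lemma VolterraHyp.norm_integral_le (h : VolterraHyp n Γ f) (x : ℝ) :
    ‖∫ y in Set.Ioi x, volterraIntegrand n Γ f T e v x y‖ ≤
      ‖T‖ * (∫ y, (1 + |y|) ^ (2 * n) * ‖f y‖ * Real.exp (Γ y)) * ‖e‖ * ‖v‖ := by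
  refine (norm_volterraIntegral_le T e v h.int x).trans ?_
  have h0 : 0 ≤ fun y => (1 + |y|) ^ (2 * n) * ‖f y‖ * Real.exp (Γ y) := fun y => by
    simp only [Pi.zero_apply]; positivity
  have h1 := setIntegral_le_integral h.int (s := Set.Ioi x) (Eventually.of_forall h0)
  have h2 : Real.exp (-Γ x) ≤ 1 := Real.exp_le_one_iff.2 (by linarith [h.nonneg x])
  have h3 : 0 ≤ ∫ y in Set.Ioi x, (1 + |y|) ^ (2 * n) * ‖f y‖ * Real.exp (Γ y) :=
    integral_nonneg h0
  calc _ ≤ ‖T‖ * ‖e‖ * ‖v‖ * (1 * ∫ y, (1 + |y|) ^ (2 * n) * ‖f y‖ * Real.exp (Γ y)) := by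
        gcongr
    _ = _ := by ring

/-- The value of the weighted Volterra operator. -/
def volterraFun (h : VolterraHyp n Γ f) (T : V →L[ℂ] V') (e : ℝ →ᵇ ℂ) (v : ℝ →ᵇ V) : ℝ →ᵇ V' :=
  BoundedContinuousFunction.ofNormedAddCommGroup
    (fun x => ∫ y in Set.Ioi x, volterraIntegrand n Γ f T e v x y)
    (continuous_volterraIntegral T e v h.cont_weight h.nonneg h.cont h.int) _
    (h.norm_integral_le T e v)

lemma volterraFun_apply (h : VolterraHyp n Γ f) (T : V →L[ℂ] V') (e : ℝ →ᵇ ℂ) (v : ℝ →ᵇ V)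
    (x : ℝ) : volterraFun h T e v x = ∫ y in Set.Ioi x, volterraIntegrand n Γ f T e v x y := rfl

/-- The weighted Volterra operator, as a bilinear map in the exponential factor and the
argument. -/
def volterraOp (h : VolterraHyp n Γ f) (T : V →L[ℂ] V') :
    (ℝ →ᵇ ℂ) →L[ℂ] (ℝ →ᵇ V) →L[ℂ] (ℝ →ᵇ V') :=
  LinearMap.mkContinuous₂
    (LinearMap.mk₂ ℂ (volterraFun h T)
      (fun e₁ e₂ v => by
        ext1 x
        simp only [BoundedContinuousFunction.coe_add, Pi.add_apply, volterraFun_apply]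
        rw [← integral_add
          (integrable_volterraIntegrand T e₁ v h.cont_weight h.cont h.int x).integrableOn
          (integrable_volterraIntegrand T e₂ v h.cont_weight h.cont h.int x).integrableOn]
        simp [volterraIntegrand, add_smul])
      (fun c e v => by
        ext1 x
        simp only [BoundedContinuousFunction.coe_smul, volterraFun_apply]
        rw [← integral_smul]
        refine integral_congr_ae (Eventually.of_forall fun y => ?_)
        simp only [volterraIntegrand, BoundedContinuousFunction.coe_smul, smul_eq_mul, smul_smul]
        congr 1; ring)
      (fun e v₁ v₂ => by
        ext1 x
        simp only [BoundedContinuousFunction.coe_add, Pi.add_apply, volterraFun_apply]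
        rw [← integral_add
          (integrable_volterraIntegrand T e v₁ h.cont_weight h.cont h.int x).integrableOn
          (integrable_volterraIntegrand T e v₂ h.cont_weight h.cont h.int x).integrableOn]
        simp [volterraIntegrand])
      (fun c e v => by
        ext1 x
        simp only [BoundedContinuousFunction.coe_smul, volterraFun_apply]
        rw [← integral_smul]
        refine integral_congr_ae (Eventually.of_forall fun y => ?_)
        simp only [volterraIntegrand, BoundedContinuousFunction.coe_smul, map_smul, smul_smul]
        congr 1; ring))
    (‖T‖ * ∫ y, (1 + |y|) ^ (2 * n) * ‖f y‖ * Real.exp (Γ y))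
    (fun e v => BoundedContinuousFunction.norm_ofNormedAddCommGroup_le _ (by
      have : 0 ≤ ∫ y, (1 + |y|) ^ (2 * n) * ‖f y‖ * Real.exp (Γ y) :=
        integral_nonneg fun y => by simp only [Pi.zero_apply]; positivity
      positivity) (h.norm_integral_le T e v))

lemma volterraOp_apply (h : VolterraHyp n Γ f) (T : V →L[ℂ] V') (e : ℝ →ᵇ ℂ) (v : ℝ →ᵇ V)
    (x : ℝ) : volterraOp h T e v x = ∫ y in Set.Ioi x, volterraIntegrand n Γ f T e v x y := rfl

/-- The integrand of `endpointOp`. -/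
def endpointIntegrand (n : ℕ) (Γ : ℝ → ℝ) (f : ℝ → ℂ) (T : V →L[ℂ] V') (e : ℝ →ᵇ ℂ) (v : ℝ →ᵇ V)
    (y : ℝ) : V' :=
  (((1 + |y|) ^ n * weight n Γ y : ℝ) * f y) • (e y • T (v y))

lemma norm_endpointIntegrand_le (y : ℝ) :
    ‖endpointIntegrand n Γ f T e v y‖ ≤
      ‖T‖ * ‖e‖ * ‖v‖ * ((1 + |y|) ^ (2 * n) * ‖f y‖ * Real.exp (Γ y)) := by
  unfold endpointIntegrand weight
  rw [norm_smul, norm_smul, norm_mul, Complex.norm_real, Real.norm_eq_abs,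
    abs_of_pos (by positivity)]
  calc (1 + |y|) ^ n * ((1 + |y|) ^ n * Real.exp (Γ y)) * ‖f y‖ * (‖e y‖ * ‖T (v y)‖)
      ≤ (1 + |y|) ^ n * ((1 + |y|) ^ n * Real.exp (Γ y)) * ‖f y‖ * (‖e‖ * (‖T‖ * ‖v‖)) := by
        gcongr
        · exact e.norm_coe_le_norm _
        · exact T.le_opNorm_of_le (v.norm_coe_le_norm y)
    _ = _ := by rw [two_mul, pow_add]; ring

lemma integrable_endpointIntegrand (h : VolterraHyp n Γ f) :
    Integrable (endpointIntegrand n Γ f T e v) := by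
  refine (h.int.const_mul (‖T‖ * ‖e‖ * ‖v‖)).mono' ?_
    (Eventually.of_forall fun y => norm_endpointIntegrand_le T e v y)
  have h1 := h.cont
  have h2 := continuous_weight n h.cont_weight
  have : Continuous (endpointIntegrand n Γ f T e v) := by unfold endpointIntegrand; fun_prop
  exact this.aestronglyMeasurable

/-- The bilinear functional giving the contribution of the potential `f` to the limit at `-∞`. -/
def endpointOp (h : VolterraHyp n Γ f) (T : V →L[ℂ] V') :
    (ℝ →ᵇ ℂ) →L[ℂ] (ℝ →ᵇ V) →L[ℂ] V' :=
  LinearMap.mkContinuous₂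
    (LinearMap.mk₂ ℂ (fun e v => ∫ y, endpointIntegrand n Γ f T e v y)
      (fun e₁ e₂ v => by
        rw [← integral_add (integrable_endpointIntegrand T e₁ v h)
          (integrable_endpointIntegrand T e₂ v h)]
        simp [endpointIntegrand, add_smul])
      (fun c e v => by
        rw [← integral_smul]
        refine integral_congr_ae (Eventually.of_forall fun y => ?_)
        simp only [endpointIntegrand, BoundedContinuousFunction.coe_smul, smul_eq_mul, smul_smul]
        congr 1; ring)
      (fun e v₁ v₂ => by
        rw [← integral_add (integrable_endpointIntegrand T e v₁ h)
          (integrable_endpointIntegrand T e v₂ h)]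
        simp [endpointIntegrand])
      (fun c e v => by
        rw [← integral_smul]
        refine integral_congr_ae (Eventually.of_forall fun y => ?_)
        simp only [endpointIntegrand, BoundedContinuousFunction.coe_smul, map_smul, smul_smul]
        congr 1; ring))
    (‖T‖ * ∫ y, (1 + |y|) ^ (2 * n) * ‖f y‖ * Real.exp (Γ y))
    (fun e v => by
      refine (norm_integral_le_of_norm_le (h.int.const_mul (‖T‖ * ‖e‖ * ‖v‖))
        (Eventually.of_forall fun y => norm_endpointIntegrand_le T e v y)).trans_eq ?_
      rw [integral_const_mul]; ring)

lemma endpointOp_apply (h : VolterraHyp n Γ f) (T : V →L[ℂ] V') (e : ℝ →ᵇ ℂ) (v : ℝ →ᵇ V) :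
    endpointOp h T e v = ∫ y, endpointIntegrand n Γ f T e v y := rfl

end Volterra

/-! ### Integrals over half-lines as functions of the endpoint. -/

section Tail

variable {E : Type*} [NormedAddCommGroup E] [NormedSpace ℝ E] [CompleteSpace E]

lemma hasDerivAt_integral_Ioi {g : ℝ → E} (hg : Continuous g)
    (hi : ∀ a, IntegrableOn g (Set.Ioi a)) (x : ℝ) :
    HasDerivAt (fun x => ∫ y in Set.Ioi x, g y) (-g x) x := by
  have h : (fun x => ∫ y in Set.Ioi x, g y)
      = fun x => (∫ y in Set.Ioi 0, g y) - ∫ y in (0 : ℝ)..x, g y := by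
    ext x
    rw [← intervalIntegral.integral_interval_add_Ioi (a := 0) (b := x) (hi 0) (hi x)]
    abel
  rw [h]
  exact (hg.integral_hasStrictDerivAt 0 x).hasDerivAt.const_sub _

lemma tendsto_integral_Ioi_atBot {g : ℝ → E} (hi : Integrable g) :
    Tendsto (fun x => ∫ y in Set.Ioi x, g y) atBot (𝓝 (∫ y, g y)) :=
  (aecover_Ioi tendsto_id).integral_tendsto_of_countably_generated hi

end Tail

/-! ### Contraction and resolvent for Volterra equations with several exponentials. -/

/-- The data of a Volterra equation with finitely many exponentials: rapidly decaying potentials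
`f i`, matrices `T i`, and bounds `B i` for the coefficients. -/
structure VolterraFamily (ι : Type*) [Fintype ι] (V : Type*) [NormedAddCommGroup V]
    [NormedSpace ℂ V] where
  f : ι → ℝ → ℂ
  T : ι → V →L[ℂ] V
  B : ι → ℝ
  nonneg : ∀ i, 0 ≤ B i
  cont : ∀ i, Continuous (f i)
  int : ∀ (n : ℕ) (i : ι), Integrable fun y => (1 + |y|) ^ n * ‖f i y‖

namespace VolterraFamily

variable {ι : Type*} [Fintype ι] {V : Type*} [NormedAddCommGroup V] [NormedSpace ℂ V]
  (D : VolterraFamily ι V)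

/-- The total weighted size of the potentials. -/
def density (n : ℕ) (y : ℝ) : ℝ := ∑ i, D.B i * ‖D.T i‖ * ((1 + |y|) ^ (2 * n) * ‖D.f i y‖)

lemma density_nonneg (n : ℕ) (y : ℝ) : 0 ≤ D.density n y :=
  Finset.sum_nonneg fun i _ => by have := D.nonneg i; positivity

lemma continuous_density (n : ℕ) : Continuous (D.density n) := by
  have := D.cont
  unfold density; fun_prop

lemma integrable_density (n : ℕ) : Integrable (D.density n) :=
  integrable_finsetSum _ fun i _ => (D.int (2 * n) i).const_mul _

/-- The exponent of the weight making the Volterra operator a contraction. -/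
def expo (n : ℕ) (x : ℝ) : ℝ := 2 * ∫ y in Set.Ioi x, D.density n y

lemma expo_nonneg (n : ℕ) (x : ℝ) : 0 ≤ D.expo n x :=
  mul_nonneg zero_le_two (integral_nonneg fun y => D.density_nonneg n y)

lemma hasDerivAt_expo (n : ℕ) (x : ℝ) : HasDerivAt (D.expo n) (-2 * D.density n x) x := by
  have := (hasDerivAt_integral_Ioi (D.continuous_density n)
    (fun _ => (D.integrable_density n).integrableOn) x).const_mul 2
  exact this.congr_deriv (by ring)

lemma continuous_expo (n : ℕ) : Continuous (D.expo n) :=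
  continuous_iff_continuousAt.2 fun x => (D.hasDerivAt_expo n x).continuousAt

lemma expo_le (n : ℕ) (x : ℝ) : D.expo n x ≤ 2 * ∫ y, D.density n y :=
  mul_le_mul_of_nonneg_left (setIntegral_le_integral (D.integrable_density n)
    (Eventually.of_forall (D.density_nonneg n))) zero_le_two

lemma tendsto_expo (n : ℕ) : Tendsto (D.expo n) atTop (𝓝 0) := by
  have := (tendsto_integral_Ioi_zero (f := D.density n) (μ := volume) tendsto_id).const_mul 2
  rw [mul_zero] at this
  exact this

lemma integrable_mul_exp_expo (n : ℕ) {g : ℝ → ℝ} (hg : Integrable g) :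
    Integrable fun y => g y * Real.exp (D.expo n y) := by
  refine hg.mul_bdd (c := Real.exp (2 * ∫ y, D.density n y))
    (Real.continuous_exp.comp (D.continuous_expo n)).aestronglyMeasurable
    (Eventually.of_forall fun y => ?_)
  rw [Real.norm_eq_abs, abs_of_pos (Real.exp_pos _)]
  exact Real.exp_le_exp.2 (D.expo_le n y)

lemma volterraHyp (n : ℕ) (i : ι) : VolterraHyp n (D.expo n) (D.f i) :=
  ⟨D.continuous_expo n, D.expo_nonneg n, D.cont i, D.integrable_mul_exp_expo n (D.int _ i)⟩

/-- The integrand is the derivative of `-exp (expo) / 2`, which tends to `-1 / 2` at `+∞`. -/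
lemma integral_density_mul_exp (n : ℕ) (x : ℝ) :
    ∫ y in Set.Ioi x, D.density n y * Real.exp (D.expo n y) = (Real.exp (D.expo n x) - 1) / 2 := by
  have h := integral_Ioi_of_hasDerivAt_of_tendsto' (a := x) (m := -1 / 2)
    (f := fun y => -Real.exp (D.expo n y) / 2)
    (f' := fun y => D.density n y * Real.exp (D.expo n y))
    (fun y _ => (((D.hasDerivAt_expo n y).exp.neg).div_const 2).congr_deriv (by ring))
    (D.integrable_mul_exp_expo n (D.integrable_density n)).integrableOn
    (by simpa using (((Real.continuous_exp.tendsto _).comp (D.tendsto_expo n)).neg).div_const 2)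
  rw [h]; ring

/-- The weighted Volterra operator with coefficients `b` and exponential factors `e`. -/
def op (n : ℕ) (b : ι → ℂ) (e : ι → ℝ →ᵇ ℂ) : (ℝ →ᵇ V) →L[ℂ] (ℝ →ᵇ V) :=
  ∑ i, b i • volterraOp (D.volterraHyp n i) (D.T i) (e i)

lemma op_apply (n : ℕ) (b : ι → ℂ) (e : ι → ℝ →ᵇ ℂ) (v : ℝ →ᵇ V) (x : ℝ) :
    D.op n b e v x = ∑ i, b i •
      ∫ y in Set.Ioi x, volterraIntegrand n (D.expo n) (D.f i) (D.T i) (e i) v x y := by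
  have h : ∀ s : Finset ι, (∑ i ∈ s, b i • volterraOp (D.volterraHyp n i) (D.T i) (e i)) v x
      = ∑ i ∈ s, b i •
        ∫ y in Set.Ioi x, volterraIntegrand n (D.expo n) (D.f i) (D.T i) (e i) v x y := by
    intro s
    simp [volterraOp_apply]
  exact h _

/-- The weight is adapted to the potential: the operator norm is at most the supremum of `exp (-Γ x)
(exp (Γ x) - 1) / 2` with `Γ = expo`. The factor `2` in `expo` is what gives `1 / 2`, with no
smallness of the potential. -/
lemma norm_op_le (n : ℕ) {b : ι → ℂ} {e : ι → ℝ →ᵇ ℂ} (hb : ∀ i, ‖b i‖ ≤ D.B i)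
    (he : ∀ i, ‖e i‖ ≤ 1) : ‖D.op n b e‖ ≤ 1 / 2 := by
  refine ContinuousLinearMap.opNorm_le_bound _ (by norm_num) fun v => ?_
  refine (BoundedContinuousFunction.norm_le (by positivity)).2 fun x => ?_
  rw [op_apply]
  have hi : ∀ i, Integrable fun y => (1 + |y|) ^ (2 * n) * ‖D.f i y‖ * Real.exp (D.expo n y) :=
    fun i => (D.volterraHyp n i).int
  calc ‖∑ i, b i • ∫ y in Set.Ioi x, volterraIntegrand n (D.expo n) (D.f i) (D.T i) (e i) v x y‖
      ≤ ∑ i, D.B i * (‖D.T i‖ * 1 * ‖v‖ * (Real.exp (-D.expo n x) *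
        ∫ y in Set.Ioi x, (1 + |y|) ^ (2 * n) * ‖D.f i y‖ * Real.exp (D.expo n y))) := by
        refine norm_sum_le_of_le _ fun i _ => ?_
        rw [norm_smul]
        refine mul_le_mul (hb i) ?_ (norm_nonneg _) (D.nonneg i)
        refine (norm_volterraIntegral_le _ _ _ (hi i) x).trans ?_
        have : 0 ≤ ∫ y in Set.Ioi x, (1 + |y|) ^ (2 * n) * ‖D.f i y‖ * Real.exp (D.expo n y) :=
          integral_nonneg fun y => by simp only [Pi.zero_apply]; positivity
        gcongr
        exact he i
    _ = ‖v‖ * Real.exp (-D.expo n x) *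
        ∫ y in Set.Ioi x, D.density n y * Real.exp (D.expo n y) := by
        simp only [density, Finset.sum_mul]
        rw [integral_finsetSum _ fun i _ => ?_, Finset.mul_sum]
        · refine Finset.sum_congr rfl fun i _ => ?_
          rw [← integral_const_mul, ← integral_const_mul, ← integral_const_mul,
            ← integral_const_mul]
          refine integral_congr_ae (Eventually.of_forall fun y => ?_)
          simp only; ring
        · simpa only [mul_assoc] using
            (((hi i).integrableOn (s := Set.Ioi x)).const_mul (D.B i * ‖D.T i‖))
    _ = ‖v‖ * ((1 - Real.exp (-D.expo n x)) / 2) := by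
        rw [integral_density_mul_exp, mul_assoc, Real.exp_neg]
        field_simp
    _ ≤ 1 / 2 * ‖v‖ := by
        have := Real.exp_pos (-D.expo n x)
        nlinarith [norm_nonneg v]

variable [CompleteSpace V]

/-- The inverse of `1 + op`. -/
def resolvent (n : ℕ) (b : ι → ℂ) (e : ι → ℝ →ᵇ ℂ) : (ℝ →ᵇ V) →L[ℂ] (ℝ →ᵇ V) :=
  Ring.inverse (1 + D.op n b e)

lemma isUnit_one_add_op (n : ℕ) {b : ι → ℂ} {e : ι → ℝ →ᵇ ℂ} (hb : ∀ i, ‖b i‖ ≤ D.B i)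
    (he : ∀ i, ‖e i‖ ≤ 1) : IsUnit (1 + D.op n b e) := by
  have h : ‖-D.op n b e‖ < 1 := by
    rw [norm_neg]; exact (D.norm_op_le n hb he).trans_lt (by norm_num)
  have := isUnit_one_sub_of_norm_lt_one h
  rwa [sub_neg_eq_add] at this

lemma norm_resolvent_le (n : ℕ) {b : ι → ℂ} {e : ι → ℝ →ᵇ ℂ} (hb : ∀ i, ‖b i‖ ≤ D.B i)
    (he : ∀ i, ‖e i‖ ≤ 1) : ‖D.resolvent n b e‖ ≤ 2 := by
  refine ContinuousLinearMap.opNorm_le_bound _ zero_le_two fun v => ?_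
  have h := Ring.mul_inverse_cancel _ (D.isUnit_one_add_op n hb he)
  have h1 : D.resolvent n b e v = v - D.op n b e (D.resolvent n b e v) := by
    have h2 := congrArg (fun A : (ℝ →ᵇ V) →L[ℂ] (ℝ →ᵇ V) => A v) h
    have h3 : D.resolvent n b e v + D.op n b e (D.resolvent n b e v) = v := by
      simpa [add_mul, resolvent] using h2
    exact eq_sub_of_add_eq h3
  have h2 : ‖D.op n b e (D.resolvent n b e v)‖ ≤ 1 / 2 * ‖D.resolvent n b e v‖ :=
    (D.op n b e).le_of_opNorm_le (D.norm_op_le n hb he) _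
  have h3 : ‖D.resolvent n b e v‖ ≤ ‖v‖ + ‖D.op n b e (D.resolvent n b e v)‖ := by
    conv_lhs => rw [h1]
    exact norm_sub_le _ _
  linarith

lemma eq_resolvent (n : ℕ) {b : ι → ℂ} {e : ι → ℝ →ᵇ ℂ} (hb : ∀ i, ‖b i‖ ≤ D.B i)
    (he : ∀ i, ‖e i‖ ≤ 1) {v v₀ : ℝ →ᵇ V} (h : v + D.op n b e v = v₀) :
    v = D.resolvent n b e v₀ := by
  have h1 := Ring.inverse_mul_cancel _ (D.isUnit_one_add_op n hb he)
  have h2 := congrArg (fun A : (ℝ →ᵇ V) →L[ℂ] (ℝ →ᵇ V) => A v) h1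
  rw [← h]
  simpa [resolvent] using h2.symm

lemma resolvent_spec (n : ℕ) {b : ι → ℂ} {e : ι → ℝ →ᵇ ℂ} (hb : ∀ i, ‖b i‖ ≤ D.B i)
    (he : ∀ i, ‖e i‖ ≤ 1) (v₀ : ℝ →ᵇ V) :
    D.resolvent n b e v₀ + D.op n b e (D.resolvent n b e v₀) = v₀ := by
  have h := Ring.mul_inverse_cancel _ (D.isUnit_one_add_op n hb he)
  have h2 := congrArg (fun A : (ℝ →ᵇ V) →L[ℂ] (ℝ →ᵇ V) => A v₀) h
  simpa [resolvent, add_mul] using h2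

lemma polySmooth_resolvent {U : Set ℝ} (hUo : IsOpen U) (hU : U ⊆ Set.Ioi 0) (n m : ℕ)
    {b : ι → ℝ → ℂ} {e : ι → ℝ → ℝ →ᵇ ℂ} (hb : ∀ μ ∈ U, ∀ i, ‖b i μ‖ ≤ D.B i)
    (he : ∀ μ ∈ U, ∀ i, ‖e i μ‖ ≤ 1) (hbs : ∀ i, PolySmooth U m (b i))
    (hes : ∀ i, PolySmooth U m (e i)) :
    PolySmooth U m (fun μ => D.resolvent n (fun i => b i μ) (fun i => e i μ)) := by
  have h1 : PolySmooth U m (fun μ => 1 + D.op n (fun i => b i μ) (fun i => e i μ)) := by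
    refine (PolySmooth.const U m 1).add hUo hU (PolySmooth.sum hUo hU _ fun i _ =>
      (hbs i).smul hUo hU ?_)
    exact (hes i).clm hUo hU ((volterraOp (D.volterraHyp n i) (D.T i)).restrictScalars ℝ)
  exact h1.inverse hUo hU (PolyBound.of_le fun μ hμ => D.norm_resolvent_le n (hb μ hμ) (he μ hμ))
    (fun μ hμ => Ring.mul_inverse_cancel _ (D.isUnit_one_add_op n (hb μ hμ) (he μ hμ)))
    (fun μ hμ => Ring.inverse_mul_cancel _ (D.isUnit_one_add_op n (hb μ hμ) (he μ hμ)))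

end VolterraFamily

/-! ### Bounded solutions of Volterra equations: existence, uniqueness, a priori bound. -/

/-- The absolute value as a continuous map. -/
def absMap : C(ℝ, ℝ) := ⟨fun t => |t|, continuous_abs⟩

lemma abs_absMap_le (t : ℝ) : |absMap t| ≤ |t| := (abs_abs t).le

lemma mem_admissible_absMap {c : ℂ} (hc : 0 ≤ c.re) : c ∈ admissible absMap := fun t =>
  mul_nonneg (abs_nonneg t) hc

namespace VolterraFamily

variable {ι : Type*} [Fintype ι] {V : Type*} [NormedAddCommGroup V] [NormedSpace ℂ V]
  (D : VolterraFamily ι V)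

/-- `w` solves the Volterra equation with coefficients `b`, exponents `c` and source `g`. -/
def IsSolution (b c : ι → ℂ) (g w : ℝ → V) : Prop :=
  ∀ x, w x = g x - ∑ i, b i • ∫ y in Set.Ioi x,
    (Complex.exp (((x - y : ℝ) : ℂ) * c i) * D.f i y) • D.T i (w y)

lemma one_le_weight (n : ℕ) (x : ℝ) : 1 ≤ weight n (D.expo n) x :=
  one_le_mul_of_one_le_of_one_le (one_le_pow₀ (by linarith [abs_nonneg x]))
    (Real.one_le_exp (D.expo_nonneg n x))

/-- A bounded continuous function divided by the weight. -/
def toWeighted (n : ℕ) (w : ℝ → V) (hw : Continuous w) (C : ℝ) (hC : ∀ x, ‖w x‖ ≤ C) : ℝ →ᵇ V :=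
  BoundedContinuousFunction.ofNormedAddCommGroup
    (fun x => (((weight n (D.expo n) x)⁻¹ : ℝ) : ℂ) • w x)
    ((Complex.continuous_ofReal.comp ((continuous_weight n (D.continuous_expo n)).inv₀
      fun x => (weight_pos _ _ _).ne')).smul hw) C
    (fun x => by
      rw [norm_smul, Complex.norm_real, Real.norm_eq_abs,
        abs_of_pos (inv_pos.2 (weight_pos _ _ _))]
      exact (mul_le_of_le_one_left (norm_nonneg _)
        (inv_le_one_of_one_le₀ (D.one_le_weight n x))).trans (hC x))

lemma weight_smul_toWeighted (n : ℕ) {w : ℝ → V} (hw : Continuous w) {C : ℝ}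
    (hC : ∀ x, ‖w x‖ ≤ C) (x : ℝ) :
    (weight n (D.expo n) x : ℂ) • D.toWeighted n w hw C hC x = w x := by
  have : (weight n (D.expo n) x : ℂ) ≠ 0 := by exact_mod_cast (weight_pos _ _ _).ne'
  simp [toWeighted, smul_smul, this]

lemma norm_toWeighted_le (n : ℕ) {w : ℝ → V} (hw : Continuous w) {C : ℝ} (hC0 : 0 ≤ C)
    (hC : ∀ x, ‖w x‖ ≤ C) : ‖D.toWeighted n w hw C hC‖ ≤ C :=
  BoundedContinuousFunction.norm_ofNormedAddCommGroup_le _ hC0 _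

lemma weight_smul_integral (n : ℕ) (i : ι) {c : ℂ} (hc : 0 ≤ c.re) {v : ℝ →ᵇ V} {w : ℝ → V}
    (hv : ∀ x, (weight n (D.expo n) x : ℂ) • v x = w x) (x : ℝ) :
    (weight n (D.expo n) x : ℂ) • ∫ y in Set.Ioi x,
      volterraIntegrand n (D.expo n) (D.f i) (D.T i) (expFamily absMap n c) v x y
    = ∫ y in Set.Ioi x, (Complex.exp (((x - y : ℝ) : ℂ) * c) * D.f i y) • D.T i (w y) := by
  rw [← integral_smul]
  refine setIntegral_congr_fun measurableSet_Ioi fun y hy => ?_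
  have hy : x < y := hy
  have h1 : (weight n (D.expo n) x : ℂ) ≠ 0 := by exact_mod_cast (weight_pos _ _ _).ne'
  have h2 : (((1 + |y - x|) ^ n : ℝ) : ℂ) ≠ 0 := by
    have : 0 < (1 + |y - x|) ^ n := by positivity
    exact_mod_cast this.ne'
  -- The absolute value keeps the exponential bounded on the whole line; on the domain of
  -- integration `y > x` it has no effect.
  have h3 : absMap (y - x) = y - x := abs_of_pos (sub_pos.2 hy)
  simp only [volterraIntegrand, expFamily_apply (mem_admissible_absMap hc), ← hv y, map_smul,
    smul_smul, h3, weightKernel]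
  congr 1
  have h4 : -((y - x : ℝ) : ℂ) * c = ((x - y : ℝ) : ℂ) * c := by push_cast; ring
  rw [h4]
  push_cast at h2 ⊢
  field_simp

lemma isSolution_iff (n : ℕ) {b c : ι → ℂ} (hc : ∀ i, 0 ≤ (c i).re) {v v₀ : ℝ →ᵇ V} {g w : ℝ → V}
    (hv : ∀ x, (weight n (D.expo n) x : ℂ) • v x = w x)
    (hv₀ : ∀ x, (weight n (D.expo n) x : ℂ) • v₀ x = g x) :
    D.IsSolution b c g w ↔ v + D.op n b (fun i => expFamily absMap n (c i)) v = v₀ := by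
  have key : ∀ x, (weight n (D.expo n) x : ℂ) • (v + D.op n b
      (fun i => expFamily absMap n (c i)) v) x = w x + ∑ i, b i • ∫ y in Set.Ioi x,
        (Complex.exp (((x - y : ℝ) : ℂ) * c i) * D.f i y) • D.T i (w y) := by
    intro x
    rw [BoundedContinuousFunction.coe_add, Pi.add_apply, smul_add, hv, op_apply, Finset.smul_sum]
    congr 1
    refine Finset.sum_congr rfl fun i _ => ?_
    rw [smul_comm, D.weight_smul_integral n i (hc i) hv]
  constructor
  · intro h
    ext1 x
    have h1 : (weight n (D.expo n) x : ℂ) ≠ 0 := by exact_mod_cast (weight_pos _ _ _).ne'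
    refine smul_right_injective V h1 ?_
    simp only
    rw [key, hv₀, h x]
    abel
  · intro h x
    have h1 := key x
    rw [h, hv₀] at h1
    rw [h1]; abel

variable [CompleteSpace V]

lemma exists_isSolution {b c : ι → ℂ} (hb : ∀ i, ‖b i‖ ≤ D.B i) (hc : ∀ i, 0 ≤ (c i).re) (w₀ : V) :
    ∃ w, Continuous w ∧ (∃ C, ∀ x, ‖w x‖ ≤ C) ∧ D.IsSolution b c (fun _ => w₀) w := by
  set v₀ := D.toWeighted 0 (fun _ => w₀) continuous_const ‖w₀‖ (fun _ => le_rfl)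
  set v := D.resolvent 0 b (fun i => expFamily absMap 0 (c i)) v₀
  refine ⟨fun x => (weight 0 (D.expo 0) x : ℂ) • v x, ?_,
    ⟨Real.exp (2 * ∫ y, D.density 0 y) * ‖v‖, fun x => ?_⟩, ?_⟩
  · have := continuous_weight 0 (D.continuous_expo 0)
    fun_prop
  · rw [norm_smul, Complex.norm_real, Real.norm_eq_abs, abs_of_pos (weight_pos _ _ _)]
    gcongr
    · simpa [weight] using D.expo_le 0 x
    · exact v.norm_coe_le_norm x
  · exact (D.isSolution_iff 0 hc (fun _ => rfl)
      (D.weight_smul_toWeighted 0 continuous_const _)).2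
      (D.resolvent_spec 0 hb (fun i => norm_expFamily_le _ _ _) v₀)

/-- A bounded solution does not depend on the weight, so one solution is given by the resolvent in
every weighted space at once. Each order of differentiability may therefore use its own `n`. -/
lemma toWeighted_eq_resolvent (n : ℕ) {b c : ι → ℂ} (hb : ∀ i, ‖b i‖ ≤ D.B i)
    (hc : ∀ i, 0 ≤ (c i).re) {g w : ℝ → V} (hg : Continuous g) {G : ℝ} (hG : ∀ x, ‖g x‖ ≤ G)
    (hw : Continuous w) {C : ℝ} (hC : ∀ x, ‖w x‖ ≤ C) (h : D.IsSolution b c g w) :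
    D.toWeighted n w hw C hC =
      D.resolvent n b (fun i => expFamily absMap n (c i)) (D.toWeighted n g hg G hG) :=
  D.eq_resolvent n hb (fun _ => norm_expFamily_le _ _ _)
    ((D.isSolution_iff n hc (D.weight_smul_toWeighted n hw hC)
      (D.weight_smul_toWeighted n hg hG)).1 h)

/-- The factor `2` bounds the resolvent and the exponential bounds the weight with `n = 0`. The
constant depends on the coefficients only through `D.B`, hence is uniform in the spectral parameter.
-/
lemma IsSolution.norm_le {D : VolterraFamily ι V} {b c : ι → ℂ} (hb : ∀ i, ‖b i‖ ≤ D.B i)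
    (hc : ∀ i, 0 ≤ (c i).re) {g w : ℝ → V} (hg : Continuous g) {G : ℝ} (hG : ∀ x, ‖g x‖ ≤ G)
    (hw : Continuous w) (hC : ∃ C, ∀ x, ‖w x‖ ≤ C) (h : D.IsSolution b c g w) (x : ℝ) :
    ‖w x‖ ≤ 2 * Real.exp (2 * ∫ y, D.density 0 y) * G := by
  obtain ⟨C, hC⟩ := hC
  have hG0 : 0 ≤ G := (norm_nonneg _).trans (hG 0)
  rw [← D.weight_smul_toWeighted 0 hw hC x, norm_smul, Complex.norm_real, Real.norm_eq_abs,
    abs_of_pos (weight_pos _ _ _), D.toWeighted_eq_resolvent 0 hb hc hg hG hw hC h]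
  have h1 : weight 0 (D.expo 0) x ≤ Real.exp (2 * ∫ y, D.density 0 y) := by
    simpa [weight] using D.expo_le 0 x
  have h2 : ‖D.resolvent 0 b (fun i => expFamily absMap 0 (c i)) (D.toWeighted 0 g hg G hG)‖
      ≤ 2 * G :=
    ((D.resolvent 0 b _).le_of_opNorm_le (D.norm_resolvent_le 0 hb
      (fun i => norm_expFamily_le _ _ _)) _).trans
      (mul_le_mul_of_nonneg_left (D.norm_toWeighted_le 0 hg hG0 hG) zero_le_two)
  calc _ ≤ Real.exp (2 * ∫ y, D.density 0 y) * (2 * G) := by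
        gcongr
        exact (BoundedContinuousFunction.norm_coe_le_norm _ x).trans h2
    _ = _ := by ring

lemma IsSolution.unique {D : VolterraFamily ι V} {b c : ι → ℂ} (hb : ∀ i, ‖b i‖ ≤ D.B i)
    (hc : ∀ i, 0 ≤ (c i).re) {w₀ : V} {w w' : ℝ → V} (hw : Continuous w)
    (hC : ∃ C, ∀ x, ‖w x‖ ≤ C) (h : D.IsSolution b c (fun _ => w₀) w) (hw' : Continuous w')
    (hC' : ∃ C, ∀ x, ‖w' x‖ ≤ C) (h' : D.IsSolution b c (fun _ => w₀) w') : w = w' := by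
  obtain ⟨C, hC⟩ := hC
  obtain ⟨C', hC'⟩ := hC'
  have e := D.toWeighted_eq_resolvent 0 hb hc continuous_const (fun _ => le_rfl) hw hC h
  have e' := D.toWeighted_eq_resolvent 0 hb hc continuous_const (fun _ => le_rfl) hw' hC' h'
  ext1 x
  rw [← D.weight_smul_toWeighted 0 hw hC x, ← D.weight_smul_toWeighted 0 hw' hC' x, e, e']

end VolterraFamily

/-! ### Cube roots of unity and the exponents `l`. -/

section Omega

lemma omega_pow_three : omega ^ 3 = 1 := by
  unfold omega
  rw [← Complex.exp_nat_mul]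
  convert Complex.exp_two_pi_mul_I using 2
  push_cast; ring

lemma omega_ne_zero : omega ≠ 0 := Complex.exp_ne_zero _

lemma omega_ne_one : omega ≠ 1 := by
  intro h
  have h1 := (Complex.isPrimitiveRoot_exp 3 (by norm_num)).ne_one (by norm_num)
  apply h1
  rw [← h, omega]
  congr 1; push_cast; ring

lemma omega_sq : omega ^ 2 = -1 - omega := by
  have h : (omega - 1) * (omega ^ 2 + omega + 1) = 0 := by
    linear_combination omega_pow_three
  rcases mul_eq_zero.1 h with h | h
  · exact absurd (sub_eq_zero.1 h) omega_ne_one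
  · linear_combination h

lemma conj_omega : starRingEnd ℂ omega = omega ^ 2 := by
  have h1 : omega * starRingEnd ℂ omega = 1 := by
    rw [Complex.mul_conj, Complex.normSq_eq_norm_sq]
    have : ‖omega‖ = 1 := by
      unfold omega
      rw [show (2 * (Real.pi : ℂ) / 3 * Complex.I) = ((2 * Real.pi / 3 : ℝ) : ℂ) * Complex.I by
        push_cast; ring]
      exact Complex.norm_exp_ofReal_mul_I _
    simp [this]
  have h2 : omega * omega ^ 2 = 1 := by rw [← omega_pow_three]; ring
  exact mul_left_cancel₀ omega_ne_zero (h1.trans h2.symm)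

lemma omega_inv : omega⁻¹ = omega ^ 2 :=
  inv_eq_of_mul_eq_one_right (by rw [← omega_pow_three]; ring)

lemma l_eq (μ : ℂ) (j : Fin 3) :
    l μ j = omega ^ ((j : ℕ) + 1) / 2 * μ + (omega ^ ((j : ℕ) + 1))⁻¹ / 2 * μ⁻¹ := by
  unfold l; rw [mul_inv]; ring

lemma l_zero (μ : ℂ) : l μ 0 = omega / 2 * μ + (-1 - omega) / 2 * μ⁻¹ := by
  rw [l_eq]; simp [omega_inv, omega_sq]

lemma l_one (μ : ℂ) : l μ 1 = (-1 - omega) / 2 * μ + omega / 2 * μ⁻¹ := by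
  rw [l_eq, Fin.val_one, one_add_one_eq_two, omega_sq,
    show (-1 - omega)⁻¹ = omega by rw [← omega_sq, ← omega_inv, inv_inv]]

lemma l_two (μ : ℂ) : l μ 2 = (μ + μ⁻¹) / 2 := by
  rw [l_eq]
  have : omega ^ (((2 : Fin 3) : ℕ) + 1) = 1 := omega_pow_three
  rw [this]; norm_num; ring

lemma l_sum (μ : ℂ) : l μ 0 + l μ 1 + l μ 2 = 0 := by
  rw [l_zero, l_one, l_two]; ring

lemma conj_l_zero (μ : ℝ) : starRingEnd ℂ (l μ 0) = l μ 1 := by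
  rw [l_zero, l_one]
  simp only [map_add, map_mul, map_div₀, conj_omega, omega_sq, map_sub, map_neg, map_one,
    map_inv₀, Complex.conj_ofReal, map_ofNat]
  ring

lemma conj_l_one (μ : ℝ) : starRingEnd ℂ (l μ 1) = l μ 0 := by
  rw [← conj_l_zero, Complex.conj_conj]

lemma conj_l_two (μ : ℝ) : starRingEnd ℂ (l μ 2) = l μ 2 := by
  rw [l_two]
  simp only [map_div₀, map_add, map_inv₀, Complex.conj_ofReal, map_ofNat]

/-- The third exponent is real, the first two are complex conjugate, and the three add up to zero.
-/
lemma l_re (μ : ℝ) : (l μ 0).re = -(μ + μ⁻¹) / 4 ∧ (l μ 1).re = -(μ + μ⁻¹) / 4 ∧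
    (l μ 2).re = (μ + μ⁻¹) / 2 := by
  have h2 : (l μ 2).re = (μ + μ⁻¹) / 2 := by
    rw [l_two, show ((μ : ℂ) + (μ : ℂ)⁻¹) / 2 = (((μ + μ⁻¹) / 2 : ℝ) : ℂ) by push_cast; ring,
      Complex.ofReal_re]
  have h01 : (l μ 1).re = (l μ 0).re := by rw [← conj_l_zero, Complex.conj_re]
  have h := congrArg Complex.re (l_sum μ)
  simp only [Complex.add_re, Complex.zero_re] at h
  refine ⟨?_, ?_, h2⟩ <;> linarith

/-- This is why exactly the first two columns are used: their exponents have the least real part, so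
every exponential in their Volterra equations is bounded by one. -/
lemma l_sub_re_nonneg {μ : ℝ} (hμ : 0 < μ) (i : Fin 3) {j : Fin 3} (hj : j = 0 ∨ j = 1) :
    0 ≤ (l μ i - l μ j).re := by
  obtain ⟨h0, h1, h2⟩ := l_re μ
  have : 0 < μ⁻¹ := by positivity
  rcases hj with rfl | rfl <;> fin_cases i <;> simp [h0, h1, h2] <;> linarith

lemma l_sub_re_eq_zero (μ : ℝ) {i j : Fin 3} (hi : i = 0 ∨ i = 1) (hj : j = 0 ∨ j = 1) :
    (l μ i - l μ j).re = 0 := by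
  obtain ⟨h0, h1, h2⟩ := l_re μ
  rcases hj with rfl | rfl <;> rcases hi with rfl | rfl <;> simp [h0, h1]

lemma hasDerivAt_l {μ : ℝ} (hμ : 0 < μ) (i : Fin 3) :
    HasDerivAt (fun ν : ℝ => l ν i)
      (omega ^ ((i : ℕ) + 1) / 2 + (omega ^ ((i : ℕ) + 1))⁻¹ / 2 *
        ((-(μ⁻¹ * μ⁻¹) : ℝ) : ℂ)) μ := by
  have h1 : HasDerivAt (fun ν : ℝ => (ν : ℂ)) 1 μ := Complex.ofRealCLM.hasDerivAt
  have h2 : HasDerivAt (fun ν : ℝ => ((ν⁻¹ : ℝ) : ℂ)) ((-(μ⁻¹ * μ⁻¹) : ℝ) : ℂ) μ := by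
    have := (hasDerivAt_inv hμ.ne').ofReal_comp
    rwa [sq, mul_inv] at this
  have h3 : (fun ν : ℝ => l ν i) = fun ν : ℝ => omega ^ ((i : ℕ) + 1) / 2 * (ν : ℂ)
      + (omega ^ ((i : ℕ) + 1))⁻¹ / 2 * ((ν⁻¹ : ℝ) : ℂ) := by
    ext ν; rw [l_eq]; push_cast; rfl
  rw [h3]
  exact ((h1.const_mul _).add (h2.const_mul _)).congr_deriv (by ring)

lemma polySmooth_ofReal {U : Set ℝ} (hUo : IsOpen U) (hU : U ⊆ Set.Ioi 0) {m : ℕ} {f : ℝ → ℝ}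
    (hf : PolySmooth U m f) : PolySmooth U m (fun μ => (f μ : ℂ)) :=
  hf.clm hUo hU Complex.ofRealCLM

lemma polySmooth_deriv_l {U : Set ℝ} (hUo : IsOpen U) (hU : U ⊆ Set.Ioi 0) (m : ℕ) (i : Fin 3) :
    PolySmooth U m (fun μ : ℝ => omega ^ ((i : ℕ) + 1) / 2 + (omega ^ ((i : ℕ) + 1))⁻¹ / 2 *
        ((-(μ⁻¹ * μ⁻¹) : ℝ) : ℂ)) := by
  have h := PolySmooth.inv_id hUo hU m
  exact (PolySmooth.const U m _).add hUo hU ((PolySmooth.const U m _).mul hUo hU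
    (polySmooth_ofReal hUo hU ((h.mul hUo hU h).neg hUo hU)))

end Omega

/-! ### Jost columns of the potential `N + μ⁻¹ M`. -/

section Potential

/-- The potential `N + μ⁻¹ M`. -/
def pot (NN MM : ℝ → Matrix (Fin 3) (Fin 3) ℂ) (μ : ℝ) (x : ℝ) : Matrix (Fin 3) (Fin 3) ℂ :=
  NN x + (μ : ℂ)⁻¹ • MM x

/-- The function `f` underlies a Schwartz function. -/
def IsSchwartz (f : ℝ → ℂ) : Prop := ∃ g : 𝓢(ℝ, ℂ), ⇑g = f

/-- All the entries of `A` are Schwartz functions. -/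
def SchwartzEntries (A : ℝ → Matrix (Fin 3) (Fin 3) ℂ) : Prop :=
  ∀ i k, IsSchwartz (fun x => A x i k)

lemma IsSchwartz.continuous {f : ℝ → ℂ} (hf : IsSchwartz f) : Continuous f := by
  obtain ⟨g, rfl⟩ := hf; exact g.continuous

lemma IsSchwartz.integrable_weight {f : ℝ → ℂ} (hf : IsSchwartz f) (n : ℕ) :
    Integrable fun y => (1 + |y|) ^ n * ‖f y‖ := by
  obtain ⟨g, rfl⟩ := hf
  have h : (fun y => (1 + |y|) ^ n * ‖g y‖)
      = fun y => ∑ k ∈ Finset.range (n + 1), (n.choose k : ℝ) * (‖y‖ ^ k * ‖g y‖) := by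
    ext y
    rw [add_comm, add_pow, Finset.sum_mul]
    refine Finset.sum_congr rfl fun k _ => ?_
    rw [Real.norm_eq_abs]; ring
  rw [h]
  exact integrable_finsetSum _ fun k _ => (g.integrable_pow_mul volume k).const_mul _

lemma IsSchwartz.integrable {f : ℝ → ℂ} (hf : IsSchwartz f) : Integrable f := by
  obtain ⟨g, rfl⟩ := hf; exact g.integrable

/-- The Volterra family of the potential `N + μ⁻¹ M` for `μ > ε`. -/
def potFamily {NN MM : ℝ → Matrix (Fin 3) (Fin 3) ℂ} (hN : SchwartzEntries NN)
    (hM : SchwartzEntries MM) {ε : ℝ} (hε : 0 < ε) :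
    VolterraFamily (Fin 3 × Fin 3 × Bool) (Fin 3 → ℂ) where
  f p x := cond p.2.2 (NN x p.1 p.2.1) (MM x p.1 p.2.1)
  T p := (ContinuousLinearMap.single ℂ (fun _ : Fin 3 => ℂ) p.1).comp
    (ContinuousLinearMap.proj p.2.1)
  B p := cond p.2.2 1 ε⁻¹
  nonneg := by rintro ⟨i, k, _ | _⟩ <;> simp [hε.le]
  cont := by
    rintro ⟨i, k, _ | _⟩
    · exact (hM i k).continuous
    · exact (hN i k).continuous
  int := by
    rintro n ⟨i, k, _ | _⟩
    · exact (hM i k).integrable_weight n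
    · exact (hN i k).integrable_weight n

/-- The coefficients of `potFamily`. -/
def potCoeff (μ : ℝ) (p : Fin 3 × Fin 3 × Bool) : ℂ := cond p.2.2 1 (μ : ℂ)⁻¹

variable {NN MM : ℝ → Matrix (Fin 3) (Fin 3) ℂ}

lemma norm_potCoeff_le (hN : SchwartzEntries NN) (hM : SchwartzEntries MM) {ε : ℝ} (hε : 0 < ε)
    {μ : ℝ} (hμ : ε < μ) (p : Fin 3 × Fin 3 × Bool) :
    ‖potCoeff μ p‖ ≤ (potFamily hN hM hε).B p := by
  obtain ⟨i, k, _ | _⟩ := p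
  · simp only [potCoeff, potFamily, cond_false, norm_inv, Complex.norm_real, Real.norm_eq_abs,
      abs_of_pos (hε.trans hμ)]
    exact inv_anti₀ hε hμ.le
  · simp [potCoeff, potFamily]

lemma integrable_entry_mul {a : ℝ → ℂ} (ha : IsSchwartz a) {e : ℝ → ℂ} (he : Continuous e)
    {s : Set ℝ} (hs : MeasurableSet s) (he1 : ∀ y ∈ s, ‖e y‖ ≤ 1) {w : ℝ → Fin 3 → ℂ}
    (hw : Continuous w) {C : ℝ}
    (hC : ∀ x, ‖w x‖ ≤ C) (k : Fin 3) : IntegrableOn (fun y => e y * (a y * w y k)) s := by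
  have h1 : IntegrableOn (fun y => a y * (e y * w y k)) s := by
    refine Integrable.mul_bdd (c := C) ha.integrable.integrableOn
      (by fun_prop : Continuous fun y => e y * w y k).aestronglyMeasurable ?_
    refine (ae_restrict_iff' hs).2 (Eventually.of_forall fun y hy => ?_)
    rw [norm_mul]
    exact (mul_le_of_le_one_left (norm_nonneg _) (he1 y hy)).trans
      ((norm_le_pi_norm _ k).trans (hC y))
  refine h1.congr (Eventually.of_forall fun y => ?_)
  simp only; ring

lemma pot_mulVec_apply (μ : ℝ) (y : ℝ) (w : Fin 3 → ℂ) (i : Fin 3) :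
    (pot NN MM μ y).mulVec w i
      = ∑ k, (NN y i k * w k) + (μ : ℂ)⁻¹ * ∑ k, MM y i k * w k := by
  simp only [pot, Matrix.mulVec, dotProduct, Matrix.add_apply, Matrix.smul_apply, smul_eq_mul,
    add_mul, Finset.sum_add_distrib, Finset.mul_sum, mul_assoc]

lemma mul_pot_mulVec_apply (μ : ℝ) (y : ℝ) (w : Fin 3 → ℂ) (i : Fin 3) (e : ℂ) :
    e * (pot NN MM μ y).mulVec w i
      = ∑ k, e * (NN y i k * w k) + (μ : ℂ)⁻¹ * ∑ k, e * (MM y i k * w k) := by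
  rw [pot_mulVec_apply]
  simp only [mul_add, Finset.mul_sum]
  congr 1
  refine Finset.sum_congr rfl fun k _ => ?_
  ring

lemma integrable_mul_pot_mulVec (hN : SchwartzEntries NN) (hM : SchwartzEntries MM) (μ : ℝ)
    {e : ℝ → ℂ} (he : Continuous e) {s : Set ℝ} (hs : MeasurableSet s)
    (he1 : ∀ y ∈ s, ‖e y‖ ≤ 1) {w : ℝ → Fin 3 → ℂ}
    (hw : Continuous w) {C : ℝ} (hC : ∀ x, ‖w x‖ ≤ C) (i : Fin 3) :
    IntegrableOn (fun y => e y * (pot NN MM μ y).mulVec (w y) i) s := by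
  simp only [mul_pot_mulVec_apply]
  exact (integrable_finsetSum _ fun k _ => integrable_entry_mul (hN i k) he hs he1 hw hC k).add
    ((integrable_finsetSum _ fun k _ =>
      integrable_entry_mul (hM i k) he hs he1 hw hC k).const_mul _)

lemma integral_mul_pot_mulVec (hN : SchwartzEntries NN) (hM : SchwartzEntries MM) (μ : ℝ)
    {e : ℝ → ℂ} (he : Continuous e) {s : Set ℝ} (hs : MeasurableSet s)
    (he1 : ∀ y ∈ s, ‖e y‖ ≤ 1) {w : ℝ → Fin 3 → ℂ}
    (hw : Continuous w) {C : ℝ} (hC : ∀ x, ‖w x‖ ≤ C) (i : Fin 3) :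
    ∫ y in s, e y * (pot NN MM μ y).mulVec (w y) i
      = ∑ k, (∫ y in s, e y * (NN y i k * w y k))
        + (μ : ℂ)⁻¹ * ∑ k, ∫ y in s, e y * (MM y i k * w y k) := by
  simp only [mul_pot_mulVec_apply]
  rw [integral_add (integrable_finsetSum _ fun k _ =>
    integrable_entry_mul (hN i k) he hs he1 hw hC k)
    ((integrable_finsetSum _ fun k _ =>
      integrable_entry_mul (hM i k) he hs he1 hw hC k).const_mul _), integral_const_mul,
    integral_finsetSum _ fun k _ => integrable_entry_mul (hN i k) he hs he1 hw hC k,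
    integral_finsetSum _ fun k _ => integrable_entry_mul (hM i k) he hs he1 hw hC k]

lemma norm_exp_sub_mul_le {c : ℂ} (hc : 0 ≤ c.re) {x y : ℝ} (h : y ∈ Set.Ioi x) :
    ‖Complex.exp (((x - y : ℝ) : ℂ) * c)‖ ≤ 1 := by
  rw [Complex.norm_exp, Real.exp_le_one_iff]
  have h : x < y := h
  simpa using mul_nonpos_of_nonpos_of_nonneg (by linarith : x - y ≤ 0) hc

/-- The componentwise Volterra equation in terms of `potFamily`. -/
lemma isSolution_potFamily_iff (hN : SchwartzEntries NN) (hM : SchwartzEntries MM) {ε : ℝ}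
    (hε : 0 < ε) (μ : ℝ) {c : Fin 3 → ℂ} (hc : ∀ i, 0 ≤ (c i).re) {g w : ℝ → Fin 3 → ℂ}
    (hw : Continuous w) {C : ℝ} (hC : ∀ x, ‖w x‖ ≤ C) :
    (potFamily hN hM hε).IsSolution (potCoeff μ) (fun p => c p.1) g w ↔
      ∀ x i, w x i = g x i - ∫ y in Set.Ioi x,
        Complex.exp (((x - y : ℝ) : ℂ) * c i) * (pot NN MM μ y).mulVec (w y) i := by
  unfold VolterraFamily.IsSolution
  refine forall_congr' fun x => ?_
  rw [funext_iff]
  refine forall_congr' fun i => ?_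
  have he : ∀ i, Continuous fun y : ℝ => Complex.exp (((x - y : ℝ) : ℂ) * c i) := fun i => by
    fun_prop
  have key : (∑ p : Fin 3 × Fin 3 × Bool, potCoeff μ p • ∫ y in Set.Ioi x,
      (Complex.exp (((x - y : ℝ) : ℂ) * c p.1) * (potFamily hN hM hε).f p y) •
        (potFamily hN hM hε).T p (w y)) i
      = ∫ y in Set.Ioi x,
        Complex.exp (((x - y : ℝ) : ℂ) * c i) * (pot NN MM μ y).mulVec (w y) i := by
    rw [integral_mul_pot_mulVec hN hM μ (he i) measurableSet_Ioi
      (fun y hy => norm_exp_sub_mul_le (hc i) hy) hw hC]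
    have h1 : ∀ (i' k : Fin 3) (a : ℝ → ℂ), IsSchwartz a →
        (∫ y in Set.Ioi x, (Complex.exp (((x - y : ℝ) : ℂ) * c i') * a y) •
          ((ContinuousLinearMap.single ℂ (fun _ : Fin 3 => ℂ) i').comp
            (ContinuousLinearMap.proj k)) (w y)) i
        = if i = i' then ∫ y in Set.Ioi x,
          Complex.exp (((x - y : ℝ) : ℂ) * c i) * (a y * w y k) else 0 := by
      intro i' k a ha
      have h2 : (fun y : ℝ => (Complex.exp (((x - y : ℝ) : ℂ) * c i') * a y) •
          ((ContinuousLinearMap.single ℂ (fun _ : Fin 3 => ℂ) i').comp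
            (ContinuousLinearMap.proj k)) (w y))
          = fun y => ContinuousLinearMap.single ℂ (fun _ : Fin 3 => ℂ) i'
            (Complex.exp (((x - y : ℝ) : ℂ) * c i') * (a y * w y k)) := by
        ext y m
        simp only [ContinuousLinearMap.comp_apply, ContinuousLinearMap.proj_apply,
          ← map_smul, smul_eq_mul, mul_assoc]
      rw [h2, ContinuousLinearMap.integral_comp_comm _ (integrable_entry_mul ha (he i')
        measurableSet_Ioi (fun y hy => norm_exp_sub_mul_le (hc i') hy) hw hC k)]
      by_cases hi : i = i'
      · subst hi; simp
      · simp [hi]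
    simp only [Fintype.sum_prod_type, Finset.sum_apply, Pi.smul_apply, Fintype.sum_bool]
    simp only [potFamily, potCoeff, cond_true, cond_false]
    simp only [h1 _ _ _ (hN _ _), h1 _ _ _ (hM _ _), smul_eq_mul, one_mul,
      Finset.sum_add_distrib, mul_ite, mul_zero]
    congr 1
    · rw [Finset.sum_comm]
      simp
    · rw [Finset.sum_comm]
      simp [Finset.mul_sum]
  rw [Pi.sub_apply, key]

lemma one_apply_eq_single (j : Fin 3) (i : Fin 3) :
    (1 : Matrix (Fin 3) (Fin 3) ℂ) i j = (Pi.single j 1 : Fin 3 → ℂ) i := by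
  rw [Matrix.one_apply, Pi.single_apply]

lemma isJostColumn_iff (hN : SchwartzEntries NN) (hM : SchwartzEntries MM) {ε : ℝ} (hε : 0 < ε)
    (μ : ℝ) {d : Fin 3 → ℂ} {j : Fin 3} (hd : ∀ i, 0 ≤ (d i - d j).re) {w : ℝ → Fin 3 → ℂ} :
    IsJostColumn d (pot NN MM μ) j w ↔ Continuous w ∧ (∃ C, ∀ x, ‖w x‖ ≤ C) ∧
      (potFamily hN hM hε).IsSolution (potCoeff μ) (fun p => d p.1 - d j)
        (fun _ => Pi.single j 1) w := by
  unfold IsJostColumn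
  refine and_congr_right fun hw => and_congr_right fun ⟨C, hC⟩ => ?_
  rw [isSolution_potFamily_iff hN hM hε μ (c := fun i => d i - d j) hd hw hC]
  refine forall_congr' fun x => forall_congr' fun i => ?_
  rw [one_apply_eq_single]
  exact and_iff_right (integrable_mul_pot_mulVec hN hM μ (by fun_prop) measurableSet_Ioi
    (fun y hy => norm_exp_sub_mul_le (hd i) hy) hw hC i)

lemma existsUnique_isJostColumn (hN : SchwartzEntries NN) (hM : SchwartzEntries MM) {μ : ℝ}
    (hμ : 0 < μ) {d : Fin 3 → ℂ} {j : Fin 3} (hd : ∀ i, 0 ≤ (d i - d j).re) :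
    ∃! w, IsJostColumn d (pot NN MM μ) j w := by
  -- Any `ε` strictly between `0` and `μ` would do; it only enters the bounds of the family.
  have hε := half_pos hμ
  have hb := norm_potCoeff_le hN hM hε (half_lt_self hμ)
  have hc : ∀ p : Fin 3 × Fin 3 × Bool, 0 ≤ (d p.1 - d j).re := fun p => hd p.1
  simp only [isJostColumn_iff hN hM hε μ hd]
  obtain ⟨w, hw⟩ := (potFamily hN hM hε).exists_isSolution hb hc (Pi.single j 1)
  exact ⟨w, hw, fun w' hw' => hw'.2.2.unique hb hc hw'.1 hw'.2.1 hw.1 hw.2.1 hw.2.2⟩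

lemma jostColumn_spec (hN : SchwartzEntries NN) (hM : SchwartzEntries MM) {μ : ℝ}
    (hμ : 0 < μ) {d : Fin 3 → ℂ} {j : Fin 3} (hd : ∀ i, 0 ≤ (d i - d j).re) :
    IsJostColumn d (pot NN MM μ) j (jostColumn d (pot NN MM μ) j) :=
  Classical.epsilon_spec (existsUnique_isJostColumn hN hM hμ hd).exists

lemma jostColumn_eq (hN : SchwartzEntries NN) (hM : SchwartzEntries MM) {μ : ℝ}
    (hμ : 0 < μ) {d : Fin 3 → ℂ} {j : Fin 3} (hd : ∀ i, 0 ≤ (d i - d j).re) {w : ℝ → Fin 3 → ℂ}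
    (hw : IsJostColumn d (pot NN MM μ) j w) : jostColumn d (pot NN MM μ) j = w :=
  (existsUnique_isJostColumn hN hM hμ hd).unique (jostColumn_spec hN hM hμ hd) hw

end Potential

/-! ### The scalar linear equation: integral form against differential form. -/

section ScalarODE

lemma continuous_exp_sub_mul (c : ℂ) (x : ℝ) :
    Continuous fun y : ℝ => Complex.exp (((x - y : ℝ) : ℂ) * c) := by fun_prop

lemma integrableOn_exp_mul {c : ℂ} (hc : 0 ≤ c.re) {h : ℝ → ℂ} (hi : Integrable h) (x : ℝ) :
    IntegrableOn (fun y : ℝ => Complex.exp (((x - y : ℝ) : ℂ) * c) * h y) (Set.Ioi x) :=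
  hi.integrableOn.bdd_mul (continuous_exp_sub_mul c x).aestronglyMeasurable
    ((ae_restrict_iff' measurableSet_Ioi).2 (Eventually.of_forall fun _ hy =>
      norm_exp_sub_mul_le hc hy))

lemma hasDerivAt_ofReal_mul (c : ℂ) (x : ℝ) : HasDerivAt (fun y : ℝ => (y : ℂ) * c) c x := by
  simpa using (Complex.ofRealCLM.hasDerivAt (x := x)).mul_const c

/-- Variation of constants at `+∞`. -/
lemma eq_sub_integral_of_hasDerivAt {c : ℂ} (hc : 0 ≤ c.re) {z h : ℝ → ℂ} {a : ℂ}
    (hi : Integrable h) (hz : ∀ x, HasDerivAt z (c * z x + h x) x)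
    (hlim : Tendsto z atTop (𝓝 a)) (hca : c * a = 0) (x : ℝ) :
    z x = a - ∫ y in Set.Ioi x, Complex.exp (((x - y : ℝ) : ℂ) * c) * h y := by
  have hexp : ∀ y : ℝ, HasDerivAt (fun y : ℝ => Complex.exp (((x - y : ℝ) : ℂ) * c))
      (Complex.exp (((x - y : ℝ) : ℂ) * c) * (-c)) y := by
    intro y
    have h1 : HasDerivAt (fun y : ℝ => ((x - y : ℝ) : ℂ) * c) (-c) y := by
      have h2 := (hasDerivAt_ofReal_mul c y).const_sub ((x : ℂ) * c)
      refine h2.congr_of_eventuallyEq (Eventually.of_forall fun y => ?_)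
      simp only; push_cast; ring
    exact h1.cexp
  have hd : ∀ y ∈ Set.Ici x, HasDerivAt
      (fun y : ℝ => Complex.exp (((x - y : ℝ) : ℂ) * c) * z y)
      (Complex.exp (((x - y : ℝ) : ℂ) * c) * h y) y := fun y _ =>
    ((hexp y).mul (hz y)).congr_deriv (by ring)
  have ht : Tendsto (fun y : ℝ => Complex.exp (((x - y : ℝ) : ℂ) * c) * z y) atTop (𝓝 a) := by
    -- Either the exponent is zero and nothing is multiplied, or the limit is zero and a factor
    -- bounded by one preserves it. This is the dichotomy between diagonal and off-diagonal entries.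
    rcases mul_eq_zero.1 hca with rfl | rfl
    · simpa using hlim
    · refine squeeze_zero_norm' ?_ (tendsto_zero_iff_norm_tendsto_zero.1 hlim)
      filter_upwards [eventually_gt_atTop x] with y hy
      rw [norm_mul]
      exact mul_le_of_le_one_left (norm_nonneg _) (norm_exp_sub_mul_le hc hy)
  have := integral_Ioi_of_hasDerivAt_of_tendsto' hd (integrableOn_exp_mul hc hi x) ht
  rw [this]
  simp

lemma hasDerivAt_of_eq_sub_integral {c : ℂ} (hc : 0 ≤ c.re) {z h : ℝ → ℂ} {a : ℂ}
    (hcont : Continuous h) (hi : Integrable h) (hca : c * a = 0)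
    (hz : ∀ x : ℝ, z x = a - ∫ y in Set.Ioi x, Complex.exp (((x - y : ℝ) : ℂ) * c) * h y) (x : ℝ) :
    HasDerivAt z (c * z x + h x) x := by
  have hsplit : ∀ x y : ℝ, Complex.exp (((x - y : ℝ) : ℂ) * c) * h y
      = Complex.exp ((x : ℂ) * c) * (Complex.exp (-((y : ℂ) * c)) * h y) := fun x y => by
    rw [← mul_assoc, ← Complex.exp_add]
    congr 2; push_cast; ring
  have hint : ∀ x, IntegrableOn (fun y : ℝ => Complex.exp (-((y : ℂ) * c)) * h y)
      (Set.Ioi x) := fun x => by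
    have h1 := (integrableOn_exp_mul hc hi x).const_mul (Complex.exp (-((x : ℂ) * c)))
    refine h1.congr (Eventually.of_forall fun y => ?_)
    simp only [hsplit]
    rw [← mul_assoc, ← Complex.exp_add, neg_add_cancel, Complex.exp_zero, one_mul]
  have hz' : z = fun x : ℝ => a - Complex.exp ((x : ℂ) * c) *
      ∫ y in Set.Ioi x, Complex.exp (-((y : ℂ) * c)) * h y := by
    ext x
    rw [hz x, ← integral_const_mul]
    simp only [hsplit]
  have hd := ((hasDerivAt_ofReal_mul c x).cexp.mul
    (hasDerivAt_integral_Ioi (by fun_prop) hint x)).const_sub a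
  rw [hz']
  refine hd.congr_deriv ?_
  have h0 : Complex.exp ((x : ℂ) * c) * Complex.exp (-((x : ℂ) * c)) = 1 := by
    rw [← Complex.exp_add, add_neg_cancel, Complex.exp_zero]
  simp only
  linear_combination h x * h0 - hca

lemma tendsto_of_eq_sub_integral {c : ℂ} (hc : 0 ≤ c.re) {z h : ℝ → ℂ} {a : ℂ}
    (hi : Integrable h)
    (hz : ∀ x : ℝ, z x = a - ∫ y in Set.Ioi x, Complex.exp (((x - y : ℝ) : ℂ) * c) * h y) :
    Tendsto z atTop (𝓝 a) := by
  rw [tendsto_iff_norm_sub_tendsto_zero]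
  refine squeeze_zero (fun _ => norm_nonneg _) (fun x => ?_)
    (tendsto_integral_Ioi_zero (f := fun y => ‖h y‖) (μ := volume) tendsto_id)
  rw [hz x, sub_sub_cancel_left, norm_neg]
  refine norm_integral_le_of_norm_le hi.norm.integrableOn
    ((ae_restrict_iff' measurableSet_Ioi).2 (Eventually.of_forall fun y hy => ?_))
  rw [norm_mul]
  exact mul_le_of_le_one_left (norm_nonneg _) (norm_exp_sub_mul_le hc hy)

lemma norm_exp_neg_mul_eq_one {c : ℂ} (hc : c.re = 0) (y : ℝ) :
    ‖Complex.exp (-(y : ℂ) * c)‖ = 1 := by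
  rw [Complex.norm_exp]; simp [hc]

/-- For imaginary `c` the factor `exp (-x c)` is unimodular and can be moved into the integral.
Scattering entries thereby become limits at `-∞`, the form in which the symmetries and the decay are
proved. -/
lemma tendsto_exp_mul_atBot {c : ℂ} (hc : c.re = 0) {z h : ℝ → ℂ} {a : ℂ}
    (hi : Integrable h) (hca : c * a = 0)
    (hz : ∀ x : ℝ, z x = a - ∫ y in Set.Ioi x, Complex.exp (((x - y : ℝ) : ℂ) * c) * h y) :
    Tendsto (fun x : ℝ => Complex.exp (-(x : ℂ) * c) * z x) atBot
      (𝓝 (a - ∫ y : ℝ, Complex.exp (-(y : ℂ) * c) * h y)) := by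
  have hi' : Integrable fun y : ℝ => Complex.exp (-(y : ℂ) * c) * h y :=
    hi.bdd_mul (c := 1)
      (by fun_prop : Continuous fun y : ℝ => Complex.exp (-(y : ℂ) * c)).aestronglyMeasurable
      (Eventually.of_forall fun y => (norm_exp_neg_mul_eq_one hc y).le)
  have h1 : (fun x : ℝ => Complex.exp (-(x : ℂ) * c) * z x) = fun x : ℝ =>
      a - ∫ y in Set.Ioi x, Complex.exp (-(y : ℂ) * c) * h y := by
    ext x
    have e1 : Complex.exp (-(x : ℂ) * c) * a = a := by
      rcases mul_eq_zero.1 hca with rfl | rfl <;> simp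
    rw [hz x, mul_sub, e1, ← integral_const_mul]
    congr 1
    refine integral_congr_ae (Eventually.of_forall fun y => ?_)
    simp only
    rw [← mul_assoc, ← Complex.exp_add]
    congr 2; push_cast; ring
  rw [h1]
  exact (tendsto_integral_Ioi_atBot hi').const_sub a

end ScalarODE

/-! ### Jost columns as solutions of a differential system. -/

section JostODE

variable {NN MM : ℝ → Matrix (Fin 3) (Fin 3) ℂ}

lemma continuous_pot_mulVec (hN : SchwartzEntries NN) (hM : SchwartzEntries MM) (μ : ℝ)
    {w : ℝ → Fin 3 → ℂ} (hw : Continuous w) (i : Fin 3) :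
    Continuous fun y => (pot NN MM μ y).mulVec (w y) i := by
  simp only [pot_mulVec_apply]
  have h1 := fun k => (hN i k).continuous
  have h2 := fun k => (hM i k).continuous
  fun_prop

lemma integrable_pot_mulVec (hN : SchwartzEntries NN) (hM : SchwartzEntries MM) (μ : ℝ)
    {w : ℝ → Fin 3 → ℂ} (hw : Continuous w) (hC : ∃ C, ∀ x, ‖w x‖ ≤ C) (i : Fin 3) :
    Integrable fun y => (pot NN MM μ y).mulVec (w y) i := by
  obtain ⟨C, hC⟩ := hC
  have := integrable_mul_pot_mulVec hN hM μ (e := fun _ => 1) continuous_const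
    MeasurableSet.univ (fun _ _ => by simp) hw hC i
  simpa using this

lemma sub_mul_one_apply (d : Fin 3 → ℂ) (i j : Fin 3) :
    (d i - d j) * (1 : Matrix (Fin 3) (Fin 3) ℂ) i j = 0 := by
  by_cases h : i = j
  · simp [h]
  · simp [Matrix.one_apply_ne h]

lemma IsJostColumn.hasDerivAt (hN : SchwartzEntries NN) (hM : SchwartzEntries MM) {μ : ℝ}
    {d : Fin 3 → ℂ} {j : Fin 3} (hd : ∀ i, 0 ≤ (d i - d j).re) {w : ℝ → Fin 3 → ℂ}
    (h : IsJostColumn d (pot NN MM μ) j w) (x : ℝ) (i : Fin 3) :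
    HasDerivAt (fun x => w x i) ((d i - d j) * w x i + (pot NN MM μ x).mulVec (w x) i) x :=
  hasDerivAt_of_eq_sub_integral (hd i) (continuous_pot_mulVec hN hM μ h.1 i)
    (integrable_pot_mulVec hN hM μ h.1 h.2.1 i) (sub_mul_one_apply d i j)
    (fun x => (h.2.2 x i).2) x

lemma IsJostColumn.tendsto_atTop (hN : SchwartzEntries NN) (hM : SchwartzEntries MM) {μ : ℝ}
    {d : Fin 3 → ℂ} {j : Fin 3} (hd : ∀ i, 0 ≤ (d i - d j).re) {w : ℝ → Fin 3 → ℂ}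
    (h : IsJostColumn d (pot NN MM μ) j w) (i : Fin 3) :
    Tendsto (fun x => w x i) atTop (𝓝 ((1 : Matrix (Fin 3) (Fin 3) ℂ) i j)) :=
  tendsto_of_eq_sub_integral (hd i) (integrable_pot_mulVec hN hM μ h.1 h.2.1 i)
    (fun x => (h.2.2 x i).2)

/-- Boundedness, the differential system and the limit at `+∞` characterise a Jost column.
Transformed columns are recognised through this criterion. -/
lemma isJostColumn_of_hasDerivAt (hN : SchwartzEntries NN) (hM : SchwartzEntries MM) {μ : ℝ}
    {d : Fin 3 → ℂ} {j : Fin 3} (hd : ∀ i, 0 ≤ (d i - d j).re) {w : ℝ → Fin 3 → ℂ}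
    (hC : ∃ C, ∀ x, ‖w x‖ ≤ C)
    (h : ∀ x i, HasDerivAt (fun x => w x i)
      ((d i - d j) * w x i + (pot NN MM μ x).mulVec (w x) i) x)
    (hlim : ∀ i, Tendsto (fun x => w x i) atTop (𝓝 ((1 : Matrix (Fin 3) (Fin 3) ℂ) i j))) :
    IsJostColumn d (pot NN MM μ) j w := by
  have hw : Continuous w := continuous_pi fun i =>
    continuous_iff_continuousAt.2 fun x => (h x i).continuousAt
  refine ⟨hw, hC, fun x i => ⟨?_, ?_⟩⟩
  · exact integrableOn_exp_mul (hd i) (integrable_pot_mulVec hN hM μ hw hC i) x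
  · exact eq_sub_integral_of_hasDerivAt (hd i) (integrable_pot_mulVec hN hM μ hw hC i)
      (fun x => h x i) (hlim i) (sub_mul_one_apply d i j) x

lemma tendsto_scatteringEntry (hN : SchwartzEntries NN) (hM : SchwartzEntries MM) {μ : ℝ}
    (hμ : 0 < μ) {d : Fin 3 → ℂ} {i j : Fin 3} (hd : ∀ i, 0 ≤ (d i - d j).re)
    (hij : (d i - d j).re = 0) :
    Tendsto (fun x : ℝ => Complex.exp (-(x : ℂ) * (d i - d j)) *
      jostColumn d (pot NN MM μ) j x i) atBot (𝓝 (scatteringEntry d (pot NN MM μ) i j)) := by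
  have h := jostColumn_spec hN hM hμ hd
  exact tendsto_exp_mul_atBot hij (integrable_pot_mulVec hN hM μ h.1 h.2.1 i)
    (sub_mul_one_apply d i j) (fun x => (h.2.2 x i).2)

lemma integrable_scatteringIntegrand (hN : SchwartzEntries NN) (hM : SchwartzEntries MM) {μ : ℝ}
    (hμ : 0 < μ) {d : Fin 3 → ℂ} {i j : Fin 3} (hd : ∀ i, 0 ≤ (d i - d j).re)
    (hij : (d i - d j).re = 0) : Integrable (scatteringIntegrand d (pot NN MM μ) i j) := by
  have h := jostColumn_spec hN hM hμ hd
  obtain ⟨C, hC⟩ := h.2.1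
  have := integrable_mul_pot_mulVec hN hM μ
    (e := fun y : ℝ => Complex.exp (-(y : ℂ) * (d i - d j))) (by fun_prop)
    MeasurableSet.univ (fun y _ => (norm_exp_neg_mul_eq_one hij y).le) h.1 hC i
  exact integrableOn_univ.1 this

end JostODE

/-! ### Smooth dependence of the scattering matrix on `μ`. -/

section Smoothness

variable {NN MM : ℝ → Matrix (Fin 3) (Fin 3) ℂ}

/-- The scattering matrix of the potential `N + μ⁻¹ M`. -/
def scat (NN MM : ℝ → Matrix (Fin 3) (Fin 3) ℂ) (i j : Fin 3) (μ : ℝ) : ℂ :=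
  scatteringEntry (l μ) (pot NN MM μ) i j

/-- The identity as a continuous map. -/
def idMap : C(ℝ, ℝ) := ⟨fun t => t, continuous_id⟩

lemma mem_admissible_idMap {c : ℂ} (hc : c.re = 0) : c ∈ admissible idMap := fun t => by
  rw [hc, mul_zero]

lemma polySmooth_coeff {U : Set ℝ} (hUo : IsOpen U) (hU : U ⊆ Set.Ioi 0) (m : ℕ)
    (p : Fin 3 × Fin 3 × Bool) : PolySmooth U m (fun μ => potCoeff μ p) := by
  obtain ⟨i, k, _ | _⟩ := p
  · have := polySmooth_ofReal hUo hU (PolySmooth.inv_id hUo hU m)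
    simpa [potCoeff] using this
  · exact PolySmooth.const U m 1

lemma polySmooth_expFamily_l {U : Set ℝ} (hUo : IsOpen U) (hU : U ⊆ Set.Ioi 0) {τ : C(ℝ, ℝ)}
    (hτ : ∀ t, |τ t| ≤ |t|) (m : ℕ) {i j : Fin 3}
    (h : ∀ μ ∈ U, l (μ : ℝ) i - l μ j ∈ admissible τ) :
    PolySmooth U m (fun μ : ℝ => expFamily τ (m + 1) (l μ i - l μ j)) :=
  polySmooth_expFamily hτ hUo hU h
    (fun _ hμ => (hasDerivAt_l (hU hμ) i).sub (hasDerivAt_l (hU hμ) j)) m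
    ((polySmooth_deriv_l hUo hU m i).sub hUo hU (polySmooth_deriv_l hUo hU m j)) _ le_rfl

lemma integral_endpoint (hN : SchwartzEntries NN) (hM : SchwartzEntries MM) {ε : ℝ}
    (hε : 0 < ε) (n : ℕ) (p : Fin 3 × Fin 3 × Bool) {c : ℂ} (hc : c.re = 0) {w : ℝ → Fin 3 → ℂ}
    (hw : Continuous w) {C : ℝ} (hC : ∀ x, ‖w x‖ ≤ C) :
    endpointOp ((potFamily hN hM hε).volterraHyp n p) (ContinuousLinearMap.proj p.2.1)
      (expFamily idMap n c) ((potFamily hN hM hε).toWeighted n w hw C hC)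
    = ∫ y : ℝ, Complex.exp (-(y : ℂ) * c) * ((potFamily hN hM hε).f p y * w y p.2.1) := by
  rw [endpointOp_apply]
  refine integral_congr_ae (Eventually.of_forall fun y => ?_)
  have h1 := congrFun ((potFamily hN hM hε).weight_smul_toWeighted n hw hC y) p.2.1
  have h2 : (((1 + |y|) ^ n : ℝ) : ℂ) ≠ 0 := by
    have : 0 < (1 + |y|) ^ n := by positivity
    exact_mod_cast this.ne'
  have h3 : idMap y = y := rfl
  simp only [endpointIntegrand, ContinuousLinearMap.proj_apply,
    expFamily_apply (mem_admissible_idMap hc), ← h1, Pi.smul_apply, smul_eq_mul, h3]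
  push_cast at h2 ⊢
  field_simp

/-- The scattering entry is assembled by bounded bilinear maps from `μ⁻¹`, the exponential families
and the resolvent, each of which is `PolySmooth`. The weight of index `m + 1` pays for `m`
derivatives. -/
lemma polySmooth_scat (hN : SchwartzEntries NN) (hM : SchwartzEntries MM) {ε : ℝ} (hε : 0 < ε)
    {i j : Fin 3} (hi : i = 0 ∨ i = 1) (hj : j = 0 ∨ j = 1) (m : ℕ) :
    PolySmooth (Set.Ioi ε) m (scat NN MM i j) := by
  have hUo : IsOpen (Set.Ioi ε) := isOpen_Ioi
  have hU : Set.Ioi ε ⊆ Set.Ioi 0 := Set.Ioi_subset_Ioi hε.le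
  set D := potFamily hN hM hε
  set v₀ := D.toWeighted (m + 1) (fun _ => (Pi.single j 1 : Fin 3 → ℂ)) continuous_const _
    (fun _ => le_rfl)
  set v : ℝ → ℝ →ᵇ (Fin 3 → ℂ) := fun μ => D.resolvent (m + 1) (fun p => potCoeff μ p)
    (fun p => expFamily absMap (m + 1) (l μ p.1 - l μ j)) v₀ with hv
  have hvs : PolySmooth (Set.Ioi ε) m v := by
    have h1 := D.polySmooth_resolvent hUo hU (m + 1) m (b := fun p μ => potCoeff μ p)
      (e := fun p μ => expFamily absMap (m + 1) (l μ p.1 - l μ j))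
      (fun μ hμ p => norm_potCoeff_le hN hM hε hμ p) (fun μ _ p => norm_expFamily_le _ _ _)
      (fun p => polySmooth_coeff hUo hU m p)
      (fun p => polySmooth_expFamily_l hUo hU abs_absMap_le m fun μ hμ =>
        mem_admissible_absMap (l_sub_re_nonneg (hU hμ) p.1 hj))
    exact h1.clm hUo hU ((ContinuousLinearMap.apply ℂ (ℝ →ᵇ (Fin 3 → ℂ)) v₀).restrictScalars ℝ)
  -- The scattering integral runs over the whole line, so `idMap` replaces `absMap`; this is
  -- admissible because the exponent is imaginary.
  have hs : PolySmooth (Set.Ioi ε) m (fun μ => expFamily idMap (m + 1) (l μ i - l μ j)) :=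
    polySmooth_expFamily_l hUo hU (fun t => le_rfl) m fun μ _ =>
      mem_admissible_idMap (l_sub_re_eq_zero μ hi hj)
  have hterm : ∀ p, PolySmooth (Set.Ioi ε) m (fun μ : ℝ =>
      endpointOp (D.volterraHyp (m + 1) p) (ContinuousLinearMap.proj p.2.1)
        (expFamily idMap (m + 1) (l μ i - l μ j)) (v μ)) := fun p => by
    have h1 := hs.clm hUo hU ((endpointOp (D.volterraHyp (m + 1) p)
      (ContinuousLinearMap.proj (R := ℂ) (φ := fun _ : Fin 3 => ℂ) p.2.1)).restrictScalars ℝ)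
    exact h1.bilin hUo hU (ContinuousLinearMap.restrictScalarsL ℂ (ℝ →ᵇ (Fin 3 → ℂ)) ℂ ℝ ℝ) hvs
  have hfinal : PolySmooth (Set.Ioi ε) m (fun μ : ℝ => (1 : Matrix (Fin 3) (Fin 3) ℂ) i j -
      (∑ k, endpointOp (D.volterraHyp (m + 1) (i, k, true)) (ContinuousLinearMap.proj k)
        (expFamily idMap (m + 1) (l μ i - l μ j)) (v μ)
      + ((μ⁻¹ : ℝ) : ℂ) * ∑ k, endpointOp (D.volterraHyp (m + 1) (i, k, false))
        (ContinuousLinearMap.proj k) (expFamily idMap (m + 1) (l μ i - l μ j)) (v μ))) :=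
    (PolySmooth.const _ _ _).sub hUo hU
      ((PolySmooth.sum hUo hU _ fun k _ => hterm (i, k, true)).add hUo hU
        ((polySmooth_ofReal hUo hU (PolySmooth.inv_id hUo hU m)).mul hUo hU
          (PolySmooth.sum hUo hU _ fun k _ => hterm (i, k, false))))
  refine hfinal.congr hUo fun μ hμ => ?_
  have hμ0 : 0 < μ := hU hμ
  have hd := fun i => l_sub_re_nonneg hμ0 i hj
  have hw := jostColumn_spec hN hM hμ0 hd
  obtain ⟨C, hC⟩ := hw.2.1
  have hsol := ((isJostColumn_iff hN hM hε μ hd).1 hw).2.2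
  -- By uniqueness the smooth family built from the resolvent is the Jost column divided by the
  -- weight.
  have hveq : v μ = D.toWeighted (m + 1) _ hw.1 C hC :=
    (D.toWeighted_eq_resolvent (m + 1) (norm_potCoeff_le hN hM hε hμ) (fun p => hd p.1)
      continuous_const (fun _ => le_rfl) hw.1 hC hsol).symm
  have hre := l_sub_re_eq_zero μ hi hj
  have hint := integral_mul_pot_mulVec hN hM μ
    (e := fun y : ℝ => Complex.exp (-(y : ℂ) * (l μ i - l μ j))) (by fun_prop)
    MeasurableSet.univ (fun y _ => (norm_exp_neg_mul_eq_one hre y).le) hw.1 hC i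
  simp only [Measure.restrict_univ] at hint
  simp only [scat, scatteringEntry, scatteringIntegrand]
  rw [hint, hveq]
  congr 2
  · exact Finset.sum_congr rfl fun k _ => integral_endpoint hN hM hε (m + 1) (i, k, true) hre hw.1 hC
  · rw [Complex.ofReal_inv]
    congr 1
    exact Finset.sum_congr rfl fun k _ =>
      integral_endpoint hN hM hε (m + 1) (i, k, false) hre hw.1 hC

end Smoothness

/-! ### Closure properties of Schwartz functions. -/

section SchwartzClosure

namespace IsSchwartz

variable {f g : ℝ → ℂ}

lemma add (hf : IsSchwartz f) (hg : IsSchwartz g) : IsSchwartz (fun x => f x + g x) := by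
  obtain ⟨f, rfl⟩ := hf
  obtain ⟨g, rfl⟩ := hg
  exact ⟨f + g, rfl⟩

lemma const_mul (c : ℂ) (hf : IsSchwartz f) : IsSchwartz (fun x => c * f x) := by
  obtain ⟨f, rfl⟩ := hf
  exact ⟨c • f, rfl⟩

lemma neg (hf : IsSchwartz f) : IsSchwartz (fun x => -f x) := by
  simpa using hf.const_mul (-1)

lemma sub (hf : IsSchwartz f) (hg : IsSchwartz g) : IsSchwartz (fun x => f x - g x) := by
  simpa only [sub_eq_add_neg] using hf.add hg.neg

lemma zero : IsSchwartz (fun _ => 0) := ⟨0, rfl⟩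

lemma sum {ι : Type*} (s : Finset ι) {f : ι → ℝ → ℂ} (hf : ∀ i ∈ s, IsSchwartz (f i)) :
    IsSchwartz (fun x => ∑ i ∈ s, f i x) := by
  classical
  induction s using Finset.induction_on with
  | empty => simpa using zero
  | insert i s hi ih =>
    simp only [Finset.sum_insert hi]
    exact (hf i (by simp)).add (ih fun j hj => hf j (by simp [hj]))

lemma mul_temperate (hf : IsSchwartz f) (hg : g.HasTemperateGrowth) :
    IsSchwartz (fun x => f x * g x) := by
  obtain ⟨f, rfl⟩ := hf
  refine ⟨SchwartzMap.smulLeftCLM ℂ g f, ?_⟩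
  ext x
  rw [SchwartzMap.smulLeftCLM_apply_apply hg, smul_eq_mul, mul_comm]

lemma hasTemperateGrowth (hf : IsSchwartz f) : f.HasTemperateGrowth := by
  obtain ⟨f, rfl⟩ := hf
  exact f.hasTemperateGrowth

lemma mul (hf : IsSchwartz f) (hg : IsSchwartz g) : IsSchwartz (fun x => f x * g x) :=
  hf.mul_temperate hg.hasTemperateGrowth

lemma deriv (hf : IsSchwartz f) : IsSchwartz (deriv f) := by
  obtain ⟨f, rfl⟩ := hf
  refine ⟨SchwartzMap.derivCLM ℝ ℂ f, ?_⟩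
  ext x
  simp

lemma tendsto_atTop (hf : IsSchwartz f) : Tendsto f atTop (𝓝 0) := by
  obtain ⟨f, rfl⟩ := hf
  exact f.tendsto_cocompact.mono_left atTop_le_cocompact

lemma tendsto_atBot (hf : IsSchwartz f) : Tendsto f atBot (𝓝 0) := by
  obtain ⟨f, rfl⟩ := hf
  exact f.tendsto_cocompact.mono_left atBot_le_cocompact

lemma bounded (hf : IsSchwartz f) : ∃ C, ∀ x, ‖f x‖ ≤ C := by
  obtain ⟨f, rfl⟩ := hf
  exact ⟨_, f.norm_le_seminorm ℝ⟩

end IsSchwartz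

lemma hasTemperateGrowth_of_hasDerivAt {f f' : ℝ → ℂ} (hf : ∀ x, HasDerivAt f (f' x) x)
    (hf' : f'.HasTemperateGrowth) (hb : ∃ C, ∀ x, ‖f x‖ ≤ C) : f.HasTemperateGrowth := by
  obtain ⟨C, hC⟩ := hb
  refine Function.HasTemperateGrowth.of_fderiv (k := 0) (C := C) ?_
    (fun x => (hf x).differentiableAt) (by simpa using hC)
  have h : fderiv ℝ f = (ContinuousLinearMap.toSpanSingletonCLE (𝕜 := ℝ) (E := ℂ)) ∘ f' := by
    ext1 x
    exact (hf x).hasFDerivAt.fderiv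
  rw [h]
  exact (ContinuousLinearEquiv.hasTemperateGrowth _).comp hf'

/-- The antiderivative of a Schwartz function vanishing at `+∞`. -/
lemma IsSchwartz.exists_antideriv {g : ℝ → ℂ} (hg : IsSchwartz g) :
    ∃ Y : ℝ → ℂ, (∀ x, HasDerivAt Y (g x) x) ∧ Y.HasTemperateGrowth ∧ (∃ C, ∀ x, ‖Y x‖ ≤ C) ∧
      Tendsto Y atTop (𝓝 0) := by
  have hi := hg.integrable
  have hd : ∀ x, HasDerivAt (fun x => -∫ y in Set.Ioi x, g y) (g x) x := fun x => by
    simpa only [neg_neg] using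
      (hasDerivAt_integral_Ioi hg.continuous (fun a => hi.integrableOn) x).fun_neg
  have hb : ∃ C, ∀ x, ‖-∫ y in Set.Ioi x, g y‖ ≤ C := by
    refine ⟨∫ y, ‖g y‖, fun x => ?_⟩
    rw [norm_neg]
    exact (norm_integral_le_integral_norm _).trans (setIntegral_le_integral hi.norm
      (Eventually.of_forall fun _ => norm_nonneg _))
  refine ⟨_, hd, hasTemperateGrowth_of_hasDerivAt hd hg.hasTemperateGrowth hb, hb, ?_⟩
  simpa using (tendsto_integral_Ioi_zero (f := g) (μ := volume) tendsto_id).neg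

end SchwartzClosure

/-! ### Formal expansion of the Jost columns in powers of `μ⁻¹`. -/

section Asymptotics

variable {NN MM : ℝ → Matrix (Fin 3) (Fin 3) ℂ}

lemma omega_pow_succ_injective {i j : Fin 3} (h : i ≠ j) :
    omega ^ ((i : ℕ) + 1) - omega ^ ((j : ℕ) + 1) ≠ 0 := by
  have h1 : omega - 1 ≠ 0 := sub_ne_zero.2 omega_ne_one
  have h0 := omega_ne_zero
  have h2 : omega + 1 ≠ 0 := by
    intro h
    have h4 := omega_sq
    rw [eq_neg_of_add_eq_zero_left h] at h4
    norm_num at h4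
  intro h3
  have h5 := omega_pow_three
  fin_cases i <;> fin_cases j <;> simp at h h3 <;> ring_nf at h3
  · exact mul_ne_zero h0 h1 (by linear_combination -h3)
  · exact mul_ne_zero h1 one_ne_zero (by linear_combination h3 + h5)
  · exact mul_ne_zero h0 h1 (by linear_combination h3)
  · exact mul_ne_zero h1 h2 (by linear_combination h3 + h5)
  · exact mul_ne_zero h1 one_ne_zero (by linear_combination -h3 + h5)
  · exact mul_ne_zero h1 h2 (by linear_combination -h3 + h5)

lemma l_sub_eq (μ : ℝ) (i j : Fin 3) : l μ i - l μ j =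
    (omega ^ ((i : ℕ) + 1) - omega ^ ((j : ℕ) + 1)) / 2 * μ +
      ((omega ^ ((i : ℕ) + 1))⁻¹ - (omega ^ ((j : ℕ) + 1))⁻¹) / 2 * (μ : ℂ)⁻¹ := by
  rw [l_eq, l_eq]; ring

/-- `W` is an approximate Jost column with residual `μ⁻ᴷ ρ + μ⁻ᴷ⁻¹ σ`. -/
structure IsApproxColumn (NN MM : ℝ → Matrix (Fin 3) (Fin 3) ℂ) (j : Fin 3) (K : ℕ)
    (W : ℝ → ℝ → Fin 3 → ℂ) (ρ σ : Fin 3 → ℝ → ℂ) : Prop where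
  schwartz_rho : ∀ i, IsSchwartz (ρ i)
  schwartz_sigma : ∀ i, IsSchwartz (σ i)
  rho_diag : ∀ x, ρ j x = 0
  ode : ∀ μ : ℝ, 0 < μ → ∀ x i, HasDerivAt (fun x => W μ x i)
    ((l μ i - l μ j) * W μ x i + ((pot NN MM μ x).mulVec (W μ x) i +
      (((μ : ℂ)⁻¹) ^ K * ρ i x + ((μ : ℂ)⁻¹) ^ (K + 1) * σ i x))) x
  bounded : ∀ μ, 0 < μ → ∃ C, ∀ x, ‖W μ x‖ ≤ C
  lim_top : ∀ μ, 0 < μ → ∀ i,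
    Tendsto (fun x => W μ x i) atTop (𝓝 ((1 : Matrix (Fin 3) (Fin 3) ℂ) i j))
  lim_bot : ∀ μ, 0 < μ → ∀ i, i ≠ j → Tendsto (fun x => W μ x i) atBot (𝓝 0)

/-- The constant column `e_j` misses the equation by exactly the `j`-th column of the potential; `N
j j = 0` gives the condition on `ρ j`. -/
lemma exists_isApproxColumn_zero (hN : SchwartzEntries NN) (hM : SchwartzEntries MM)
    {j : Fin 3} (hdiag : ∀ x, NN x j j = 0) : ∃ W ρ σ, IsApproxColumn NN MM j 0 W ρ σ := by
  refine ⟨fun _ _ => Pi.single j 1, fun i x => -NN x i j, fun i x => -MM x i j,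
    fun i => (hN i j).neg, fun i => (hM i j).neg, fun x => by simp [hdiag], ?_, ?_, ?_, ?_⟩
  · intro μ hμ x i
    refine (hasDerivAt_const x _).congr_deriv ?_
    have h := sub_mul_one_apply (l μ) i j
    rw [one_apply_eq_single] at h
    rw [h, pot_mulVec_apply]
    simp [Pi.single_apply]
    ring
  · exact fun μ _ => ⟨_, fun _ => le_rfl⟩
  · intro μ _ i
    rw [one_apply_eq_single]
    exact tendsto_const_nhds
  · intro μ _ i hi
    simp [hi]

/-- Add `μ⁻¹ ^ (K + 1) Y` and use `l i - l j = α i μ + β i μ⁻¹`. The leading residual cancels if `α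
i Y i = ρ i`, which fixes `Y i` for `i ≠ j`. At `i = j` both sides are zero, and `Y j` is free to
annihilate the diagonal entry of the next residual: `Y j' = (N Y) j - σ j`. -/
lemma IsApproxColumn.exists_succ (hN : SchwartzEntries NN) (hM : SchwartzEntries MM)
    {j : Fin 3} (hdiag : ∀ x, NN x j j = 0) {K : ℕ} {W : ℝ → ℝ → Fin 3 → ℂ}
    {ρ σ : Fin 3 → ℝ → ℂ} (h : IsApproxColumn NN MM j K W ρ σ) :
    ∃ W ρ σ, IsApproxColumn NN MM j (K + 1) W ρ σ := by
  set α : Fin 3 → ℂ := fun i => (omega ^ ((i : ℕ) + 1) - omega ^ ((j : ℕ) + 1)) / 2 with hα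
  set β : Fin 3 → ℂ := fun i => ((omega ^ ((i : ℕ) + 1))⁻¹ - (omega ^ ((j : ℕ) + 1))⁻¹) / 2 with hβ
  have hα0 : ∀ i, i ≠ j → α i ≠ 0 := fun i hi => div_ne_zero (omega_pow_succ_injective hi) two_ne_zero
  set Z : Fin 3 → ℝ → ℂ := fun i x => (α i)⁻¹ * ρ i x with hZ
  have hZs : ∀ i, IsSchwartz (Z i) := fun i => (h.schwartz_rho i).const_mul _
  -- Since `N j j = 0`, the right side of the equation for `Y j` does not involve `Y j`, so one
  -- integration suffices. The result vanishes at `+∞` but in general not at `-∞`; hence `lim_bot`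
  -- leaves out `i = j`.
  obtain ⟨Yj, hYj, hYjt, hYjb, hYj0⟩ := ((IsSchwartz.sum Finset.univ fun k _ =>
    (hN j k).mul (hZs k)).sub (h.schwartz_sigma j)).exists_antideriv
  set Y : Fin 3 → ℝ → ℂ := fun i => if i = j then Yj else Z i with hY
  have hYne : ∀ i, i ≠ j → Y i = Z i := fun i hi => by simp [hY, hi]
  have hYt : ∀ i, (Y i).HasTemperateGrowth := fun i => by
    by_cases hi : i = j
    · simpa [hY, hi] using hYjt
    · rw [hYne i hi]; exact (hZs i).hasTemperateGrowth
  have hYb : ∀ i, ∃ C, ∀ x, ‖Y i x‖ ≤ C := fun i => by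
    by_cases hi : i = j
    · simpa [hY, hi] using hYjb
    · rw [hYne i hi]; exact (hZs i).bounded
  have hYtop : ∀ i, Tendsto (Y i) atTop (𝓝 0) := fun i => by
    by_cases hi : i = j
    · simpa [hY, hi] using hYj0
    · rw [hYne i hi]; exact (hZs i).tendsto_atTop
  have hYd : ∀ i x, HasDerivAt (Y i) (deriv (Y i) x) x := fun i x =>
    ((hYt i).1.differentiable (by simp) x).hasDerivAt
  have hNY : ∀ x, ∑ k, NN x j k * Y k x = ∑ k, NN x j k * Z k x := fun x =>
    Finset.sum_congr rfl fun k _ => by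
      by_cases hk : k = j
      · rw [hk, hdiag]; simp
      · rw [hYne k hk]
  have hYjd : ∀ x, deriv (Y j) x = ∑ k, NN x j k * Y k x - σ j x := fun x => by
    have : Y j = Yj := by simp [hY]
    rw [this, (hYj x).deriv, hNY]
  have hsum : ∀ {A : ℝ → Matrix (Fin 3) (Fin 3) ℂ}, SchwartzEntries A → ∀ i,
      IsSchwartz fun x => ∑ k, A x i k * Y k x := fun hA i =>
    IsSchwartz.sum Finset.univ fun k _ => (hA i k).mul_temperate (hYt k)
  have hYds : ∀ i, IsSchwartz (deriv (Y i)) := fun i => by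
    by_cases hi : i = j
    · subst hi
      rw [funext hYjd]
      exact (hsum hN i).sub (h.schwartz_sigma i)
    · rw [hYne i hi]; exact (hZs i).deriv
  -- `Y j` itself need not be Schwartz, but `β j = 0`.
  have hβY : ∀ i, IsSchwartz fun x => β i * Y i x := fun i => by
    by_cases hi : i = j
    · simpa [hβ, hi] using IsSchwartz.zero
    · rw [hYne i hi]; exact (hZs i).const_mul _
  have hαY : ∀ i x, α i * Y i x = ρ i x := fun i x => by
    by_cases hi : i = j
    · rw [hi, h.rho_diag]; simp [hα]
    · rw [hYne i hi, hZ]; simp only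
      rw [← mul_assoc, mul_inv_cancel₀ (hα0 i hi), one_mul]
  refine ⟨fun μ x i => W μ x i + ((μ : ℂ)⁻¹) ^ (K + 1) * Y i x,
    fun i x => σ i x + deriv (Y i) x - ∑ k, NN x i k * Y k x,
    fun i x => -(β i * Y i x) - ∑ k, MM x i k * Y k x,
    fun i => ((h.schwartz_sigma i).add (hYds i)).sub (hsum hN i),
    fun i => (hβY i).neg.sub (hsum hM i), fun x => by rw [hYjd]; ring, ?_, ?_, ?_, ?_⟩
  · intro μ hμ x i
    have hμ0 : (μ : ℂ) ≠ 0 := by exact_mod_cast hμ.ne'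
    refine ((h.ode μ hμ x i).add ((hYd i x).const_mul _)).congr_deriv ?_
    rw [pot_mulVec_apply, pot_mulVec_apply]
    simp only [mul_add, Finset.sum_add_distrib]
    have e1 : ∀ A : ℝ → Matrix (Fin 3) (Fin 3) ℂ,
        ∑ k, A x i k * (((μ : ℂ)⁻¹) ^ (K + 1) * Y k x)
          = ((μ : ℂ)⁻¹) ^ (K + 1) * ∑ k, A x i k * Y k x := fun A => by
      rw [Finset.mul_sum]
      exact Finset.sum_congr rfl fun k _ => by ring
    have hl : l μ i - l μ j = α i * (μ : ℂ) + β i * (μ : ℂ)⁻¹ := l_sub_eq μ i j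
    rw [e1, e1, ← hαY i x, hl]
    have e2 : (μ : ℂ) * (μ : ℂ)⁻¹ = 1 := mul_inv_cancel₀ hμ0
    linear_combination (-((μ : ℂ)⁻¹) ^ K * α i * Y i x) * e2
  · intro μ hμ
    obtain ⟨C, hC⟩ := h.bounded μ hμ
    choose B hB using hYb
    refine ⟨C + ∑ i, ‖((μ : ℂ)⁻¹) ^ (K + 1)‖ * B i, fun x => ?_⟩
    have hB0 : ∀ i, 0 ≤ B i := fun i => (norm_nonneg _).trans (hB i x)
    have hC0 : 0 ≤ C := (norm_nonneg _).trans (hC x)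
    refine (pi_norm_le_iff_of_nonneg (add_nonneg hC0 (Finset.sum_nonneg fun i _ =>
      mul_nonneg (norm_nonneg _) (hB0 i)))).2 fun i => ?_
    refine (norm_add_le _ _).trans (add_le_add ((norm_le_pi_norm _ i).trans (hC x)) ?_)
    rw [norm_mul]
    refine (mul_le_mul_of_nonneg_left (hB i x) (norm_nonneg _)).trans ?_
    exact Finset.single_le_sum (f := fun i => ‖((μ : ℂ)⁻¹) ^ (K + 1)‖ * B i)
      (fun i _ => mul_nonneg (norm_nonneg _) (hB0 i)) (Finset.mem_univ i)
  · intro μ hμ i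
    simpa using (h.lim_top μ hμ i).add ((hYtop i).const_mul _)
  · intro μ hμ i hi
    have h1 : Tendsto (Y i) atBot (𝓝 0) := by rw [hYne i hi]; exact (hZs i).tendsto_atBot
    simpa using (h.lim_bot μ hμ i hi).add (h1.const_mul _)

lemma exists_isApproxColumn (hN : SchwartzEntries NN) (hM : SchwartzEntries MM)
    {j : Fin 3} (hdiag : ∀ x, NN x j j = 0) (K : ℕ) :
    ∃ W ρ σ, IsApproxColumn NN MM j K W ρ σ := by
  induction K with
  | zero => exact exists_isApproxColumn_zero hN hM hdiag
  | succ K ih =>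
    obtain ⟨W, ρ, σ, h⟩ := ih
    exact h.exists_succ hN hM hdiag

end Asymptotics

/-! ### Error of the expansion, and decay of the off-diagonal scattering entries. -/

section OffDiagonalDecay

variable {NN MM : ℝ → Matrix (Fin 3) (Fin 3) ℂ}

lemma norm_inv_pow_le {ε μ : ℝ} (hε : 0 < ε) (hμ : ε < μ) (K : ℕ) (a b : ℂ) :
    ‖((μ : ℂ)⁻¹) ^ K * a + ((μ : ℂ)⁻¹) ^ (K + 1) * b‖ ≤ (μ⁻¹) ^ K * (‖a‖ + ε⁻¹ * ‖b‖) := by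
  have hμ0 : 0 < μ := hε.trans hμ
  have h1 : ‖(μ : ℂ)⁻¹‖ = μ⁻¹ := by
    rw [norm_inv, Complex.norm_real, Real.norm_eq_abs, abs_of_pos hμ0]
  have h2 : μ⁻¹ ≤ ε⁻¹ := inv_anti₀ hε hμ.le
  refine (norm_add_le _ _).trans ?_
  rw [norm_mul, norm_mul, norm_pow, norm_pow, h1, pow_succ, mul_add, mul_assoc]
  have : 0 < μ⁻¹ := by positivity
  gcongr

/-- The difference between the Jost column and an approximate Jost column. -/
lemma IsApproxColumn.norm_sub_le (hN : SchwartzEntries NN) (hM : SchwartzEntries MM)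
    {j : Fin 3} (hj : j = 0 ∨ j = 1) {K : ℕ} {W : ℝ → ℝ → Fin 3 → ℂ} {ρ σ : Fin 3 → ℝ → ℂ}
    (h : IsApproxColumn NN MM j K W ρ σ) {ε : ℝ} (hε : 0 < ε) :
    ∃ C, ∀ μ, ε < μ → ∀ x, ‖jostColumn (l μ) (pot NN MM μ) j x - W μ x‖ ≤ C * (μ⁻¹) ^ K := by
  set B : ℝ := ∑ i, ∫ y, (‖ρ i y‖ + ε⁻¹ * ‖σ i y‖) with hB
  have hBi : ∀ i, Integrable fun y => ‖ρ i y‖ + ε⁻¹ * ‖σ i y‖ := fun i =>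
    (h.schwartz_rho i).integrable.norm.add ((h.schwartz_sigma i).integrable.norm.const_mul _)
  refine ⟨2 * Real.exp (2 * ∫ y, (potFamily hN hM hε).density 0 y) * B, fun μ hμ x => ?_⟩
  have hμ0 : 0 < μ := hε.trans hμ
  have hd := fun i => l_sub_re_nonneg hμ0 i hj
  set w := jostColumn (l μ) (pot NN MM μ) j with hw
  have hjost : IsJostColumn (l μ) (pot NN MM μ) j w := jostColumn_spec hN hM hμ0 hd
  set R : Fin 3 → ℝ → ℂ := fun i x =>
    ((μ : ℂ)⁻¹) ^ K * ρ i x + ((μ : ℂ)⁻¹) ^ (K + 1) * σ i x with hR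
  have hRs : ∀ i, IsSchwartz (R i) := fun i =>
    ((h.schwartz_rho i).const_mul _).add ((h.schwartz_sigma i).const_mul _)
  have hWc : Continuous (W μ) := continuous_pi fun i =>
    continuous_iff_continuousAt.2 fun x => (h.ode μ hμ0 x i).continuousAt
  have hWb := h.bounded μ hμ0
  have hWint : ∀ i, Integrable fun y => (pot NN MM μ y).mulVec (W μ y) i := fun i =>
    integrable_pot_mulVec hN hM μ hWc hWb i
  have hWeq : ∀ x i, W μ x i = (1 : Matrix (Fin 3) (Fin 3) ℂ) i j - ∫ y in Set.Ioi x,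
      Complex.exp (((x - y : ℝ) : ℂ) * (l μ i - l μ j)) *
        ((pot NN MM μ y).mulVec (W μ y) i + R i y) := fun x i =>
    eq_sub_integral_of_hasDerivAt (hd i) ((hWint i).add (hRs i).integrable)
      (fun x => h.ode μ hμ0 x i) (h.lim_top μ hμ0 i) (sub_mul_one_apply _ i j) x
  -- Subtracting the two integral equations, `w - W` solves the Volterra equation whose source `g`
  -- is the integrated residual, of size `μ⁻ᴷ`; the a priori bound then applies.
  set g : ℝ → Fin 3 → ℂ := fun x i => ∫ y in Set.Ioi x,
    Complex.exp (((x - y : ℝ) : ℂ) * (l μ i - l μ j)) * R i y with hg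
  have hgc : Continuous g := continuous_pi fun i => by
    have h1 : ∀ x, HasDerivAt (fun x => -g x i) _ x := fun x =>
      hasDerivAt_of_eq_sub_integral (a := 0) (hd i) (hRs i).continuous (hRs i).integrable
        (mul_zero _) (fun x => by rw [zero_sub]) x
    have h2 : Continuous fun x => -g x i :=
      continuous_iff_continuousAt.2 fun x => (h1 x).continuousAt
    simpa only [neg_neg] using h2.fun_neg
  have hB0 : ∀ i, 0 ≤ ∫ y, (‖ρ i y‖ + ε⁻¹ * ‖σ i y‖) := fun i =>
    integral_nonneg fun y => by simp only [Pi.zero_apply]; positivity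
  have hgb : ∀ x, ‖g x‖ ≤ B * (μ⁻¹) ^ K := fun x => by
    have hμi : 0 < μ⁻¹ := by positivity
    refine (pi_norm_le_iff_of_nonneg (mul_nonneg (Finset.sum_nonneg fun i _ => hB0 i)
      (by positivity))).2 fun i => ?_
    calc ‖g x i‖ ≤ ∫ y in Set.Ioi x, (μ⁻¹) ^ K * (‖ρ i y‖ + ε⁻¹ * ‖σ i y‖) := by
          refine norm_integral_le_of_norm_le ((hBi i).const_mul _).integrableOn
            ((ae_restrict_iff' measurableSet_Ioi).2 (Eventually.of_forall fun y hy => ?_))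
          rw [norm_mul]
          exact (mul_le_of_le_one_left (norm_nonneg _) (norm_exp_sub_mul_le (hd i) hy)).trans
            (norm_inv_pow_le hε hμ K _ _)
      _ ≤ ∫ y, (μ⁻¹) ^ K * (‖ρ i y‖ + ε⁻¹ * ‖σ i y‖) :=
          setIntegral_le_integral ((hBi i).const_mul _)
            (Eventually.of_forall fun y => by simp only [Pi.zero_apply]; positivity)
      _ = (∫ y, (‖ρ i y‖ + ε⁻¹ * ‖σ i y‖)) * (μ⁻¹) ^ K := by rw [integral_const_mul, mul_comm]
      _ ≤ B * (μ⁻¹) ^ K := by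
          gcongr
          exact Finset.single_le_sum (f := fun i => ∫ y, (‖ρ i y‖ + ε⁻¹ * ‖σ i y‖))
            (fun i _ => hB0 i) (Finset.mem_univ i)
  obtain ⟨C₁, hC₁⟩ := hjost.2.1
  obtain ⟨C₂, hC₂⟩ := hWb
  have heC : ∀ x, ‖w x - W μ x‖ ≤ C₁ + C₂ := fun x =>
    (_root_.norm_sub_le _ _).trans (add_le_add (hC₁ x) (hC₂ x))
  have hec : Continuous fun x => w x - W μ x := hjost.1.sub hWc
  have hsol : (potFamily hN hM hε).IsSolution (potCoeff μ) (fun p => l μ p.1 - l μ j) g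
      (fun x => w x - W μ x) := by
    rw [isSolution_potFamily_iff hN hM hε μ (c := fun i => l μ i - l μ j) hd hec heC]
    intro x i
    have i1 := integrableOn_exp_mul (hd i) (integrable_pot_mulVec hN hM μ hjost.1 hjost.2.1 i) x
    have i2 := integrableOn_exp_mul (hd i) (hWint i) x
    have i3 := integrableOn_exp_mul (hd i) (hRs i).integrable x
    have e1 : ∫ y in Set.Ioi x, Complex.exp (((x - y : ℝ) : ℂ) * (l μ i - l μ j)) *
        (pot NN MM μ y).mulVec (w y - W μ y) i
        = (∫ y in Set.Ioi x, Complex.exp (((x - y : ℝ) : ℂ) * (l μ i - l μ j)) *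
          (pot NN MM μ y).mulVec (w y) i) - ∫ y in Set.Ioi x,
          Complex.exp (((x - y : ℝ) : ℂ) * (l μ i - l μ j)) *
          (pot NN MM μ y).mulVec (W μ y) i := by
      rw [← integral_sub i1 i2]
      simp only [Matrix.mulVec_sub, Pi.sub_apply, mul_sub]
    have e2 := hWeq x i
    simp only [mul_add] at e2
    rw [integral_add i2 i3] at e2
    rw [e1, Pi.sub_apply, (hjost.2.2 x i).2, e2]
    simp only [hg]
    ring
  have := hsol.norm_le (norm_potCoeff_le hN hM hε hμ) (fun p => hd p.1) hgc hgb hec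
    ⟨_, heC⟩ x
  rwa [← mul_assoc] at this

/-- The off-diagonal entries of the scattering matrix decay rapidly as `μ → ∞`. -/
lemma exists_norm_scat_le (hN : SchwartzEntries NN) (hM : SchwartzEntries MM)
    (hdiag : ∀ x i, NN x i i = 0) {i j : Fin 3} (hi : i = 0 ∨ i = 1) (hj : j = 0 ∨ j = 1)
    (hij : i ≠ j) {ε : ℝ} (hε : 0 < ε) (K : ℕ) :
    ∃ C, ∀ μ, ε < μ → ‖scat NN MM i j μ‖ ≤ C * (μ⁻¹) ^ K := by
  obtain ⟨W, ρ, σ, h⟩ := exists_isApproxColumn hN hM (fun x => hdiag x j) K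
  obtain ⟨C, hC⟩ := h.norm_sub_le hN hM hj hε
  refine ⟨C, fun μ hμ => ?_⟩
  have hμ0 : 0 < μ := hε.trans hμ
  have hre := l_sub_re_eq_zero μ hi hj
  have h1 := tendsto_scatteringEntry hN hM hμ0 (fun i => l_sub_re_nonneg hμ0 i hj) hre
  -- The approximate column contributes nothing at `-∞`, so the scattering entry is a limit of
  -- quantities bounded by the error of the expansion.
  have h2 : Tendsto (fun x : ℝ => Complex.exp (-(x : ℂ) * (l μ i - l μ j)) * W μ x i) atBot
      (𝓝 0) := by
    refine squeeze_zero_norm (fun x => ?_)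
      (tendsto_zero_iff_norm_tendsto_zero.1 (h.lim_bot μ hμ0 i hij))
    rw [norm_mul, norm_exp_neg_mul_eq_one hre, one_mul]
  have h3 := (h1.sub h2).norm
  rw [sub_zero] at h3
  refine le_of_tendsto h3 (Eventually.of_forall fun x => ?_)
  rw [← mul_sub, norm_mul, norm_exp_neg_mul_eq_one hre, one_mul]
  exact (norm_le_pi_norm (jostColumn (l μ) (pot NN MM μ) j x - W μ x) i).trans (hC μ hμ x)

end OffDiagonalDecay

/-! ### `exp f - 1` is Schwartz for a real Schwartz function `f`. -/

section ExpSchwartz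

/-- The derivative `f'` controls all orders at least one; comparison with `a` settles order zero. -/
lemma isSchwartz_of_hasDerivAt {f f' a : ℝ → ℂ} (hf : ∀ x, HasDerivAt f (f' x) x)
    (hf' : IsSchwartz f') (ha : IsSchwartz a) {C : ℝ} (h : ∀ x, ‖f x‖ ≤ C * ‖a x‖) :
    IsSchwartz f := by
  have hd : deriv f = f' := funext fun x => (hf x).deriv
  obtain ⟨g, rfl⟩ := hf'
  obtain ⟨a, rfl⟩ := ha
  have hsm : ContDiff ℝ ∞ f := by
    rw [contDiff_infty_iff_deriv, hd]
    exact ⟨fun x => (hf x).differentiableAt, g.smooth ⊤⟩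
  refine ⟨⟨f, hsm, fun k n => ?_⟩, rfl⟩
  cases n with
  | zero =>
    obtain ⟨B, hB⟩ := a.decay k 0
    refine ⟨|C| * B, fun x => ?_⟩
    have h1 := hB.2 x
    simp only [norm_iteratedFDeriv_zero] at h1 ⊢
    calc ‖x‖ ^ k * ‖f x‖ ≤ ‖x‖ ^ k * (|C| * ‖a x‖) := by
          gcongr
          exact (h x).trans (mul_le_mul_of_nonneg_right (le_abs_self C) (norm_nonneg _))
      _ = |C| * (‖x‖ ^ k * ‖a x‖) := by ring
      _ ≤ _ := by gcongr
  | succ n =>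
    obtain ⟨B, hB⟩ := g.decay k n
    refine ⟨B, fun x => ?_⟩
    have h1 := hB.2 x
    rwa [norm_iteratedFDeriv_eq_norm_iteratedDeriv, iteratedDeriv_succ', hd,
      ← norm_iteratedFDeriv_eq_norm_iteratedDeriv]

lemma hasTemperateGrowth_exp_comp {f : ℝ → ℝ} (hf : f.HasTemperateGrowth) {C : ℝ}
    (hC : ∀ x, |f x| ≤ C) : (fun x => Real.exp (f x)).HasTemperateGrowth := by
  have hC0 : 0 ≤ C := (abs_nonneg _).trans (hC 0)
  -- The enlargement by `1` keeps the interval nondegenerate even when `C = 0`.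
  have hu : UniqueDiffOn ℝ (Set.Icc (-(C + 1)) (C + 1)) := uniqueDiffOn_Icc (by linarith)
  refine Function.HasTemperateGrowth.comp' (g := Real.exp) (t := Set.Icc (-(C + 1)) (C + 1)) ?_ hu
    Real.contDiff_exp.contDiffOn (fun N => ?_) hf
  · rintro _ ⟨x, rfl⟩
    have := abs_le.1 (hC x)
    exact ⟨by linarith [this.1], by linarith [this.2]⟩
  · have h1 : ∀ n : ℕ, ∃ B, ∀ x ∈ Set.Icc (-(C + 1)) (C + 1),
        ‖iteratedFDerivWithin ℝ n Real.exp (Set.Icc (-(C + 1)) (C + 1)) x‖ ≤ B := fun n =>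
      isCompact_Icc.exists_bound_of_continuousOn
        ((Real.contDiff_exp (n := n)).contDiffOn.continuousOn_iteratedFDerivWithin le_rfl hu)
    choose B hB using h1
    refine ⟨0, ∑ n ∈ Finset.range (N + 1), |B n|, Finset.sum_nonneg fun _ _ => abs_nonneg _,
      fun n hn x hx => ?_⟩
    rw [pow_zero, mul_one]
    refine (hB n x hx).trans ((le_abs_self _).trans ?_)
    exact Finset.single_le_sum (f := fun n => |B n|) (fun _ _ => abs_nonneg _)
      (Finset.mem_range.2 (by omega))

lemma IsSchwartz.re_temperate {f : ℝ → ℝ} (hf : IsSchwartz fun x => (f x : ℂ)) :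
    f.HasTemperateGrowth :=
  (Complex.reCLM.hasTemperateGrowth).comp hf.hasTemperateGrowth

lemma IsSchwartz.hasDerivAt_real {f : ℝ → ℝ} (hf : IsSchwartz fun x => (f x : ℂ)) (x : ℝ) :
    HasDerivAt f (_root_.deriv f x) x :=
  (hf.re_temperate.1.differentiable (by simp) x).hasDerivAt

lemma IsSchwartz.deriv_real {f : ℝ → ℝ} (hf : IsSchwartz fun x => (f x : ℂ)) :
    IsSchwartz fun x => ((_root_.deriv f x : ℝ) : ℂ) := by
  have h : (fun x => ((_root_.deriv f x : ℝ) : ℂ)) = _root_.deriv fun x => (f x : ℂ) := by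
    ext x; exact ((hf.hasDerivAt_real x).ofReal_comp).deriv.symm
  rw [h]
  exact hf.deriv

lemma abs_exp_sub_one_le_mul {t C : ℝ} (h : |t| ≤ C) : |Real.exp t - 1| ≤ Real.exp C * |t| := by
  have h1 := (convex_Icc (-C) C).norm_image_sub_le_of_norm_deriv_le (f := Real.exp)
    (C := Real.exp C) (fun x _ => Real.differentiableAt_exp)
    (fun x hx => by
      rw [Real.deriv_exp, Real.norm_eq_abs, abs_of_pos (Real.exp_pos _)]
      exact Real.exp_le_exp.2 hx.2)
    (x := 0) (y := t) ⟨by linarith [abs_nonneg t], by linarith [abs_nonneg t]⟩ (abs_le.1 h)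
  simpa using h1

lemma IsSchwartz.exp_sub_one {f : ℝ → ℝ} (hf : IsSchwartz fun x => (f x : ℂ)) :
    IsSchwartz fun x => ((Real.exp (f x) - 1 : ℝ) : ℂ) := by
  obtain ⟨C, hC⟩ := hf.bounded
  have hC' : ∀ x, |f x| ≤ C := fun x => by simpa using hC x
  have hexp : (fun x => ((Real.exp (f x) : ℝ) : ℂ)).HasTemperateGrowth :=
    Complex.ofRealCLM.hasTemperateGrowth.comp (hasTemperateGrowth_exp_comp hf.re_temperate hC')
  refine isSchwartz_of_hasDerivAt (C := Real.exp C)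
    (f' := fun x => ((_root_.deriv f x : ℝ) : ℂ) * ((Real.exp (f x) : ℝ) : ℂ)) (fun x => ?_)
    (hf.deriv_real.mul_temperate hexp) hf (fun x => ?_)
  · have := (((hf.hasDerivAt_real x).exp).sub_const 1).ofReal_comp
    refine this.congr_deriv ?_
    push_cast; ring
  · rw [Complex.norm_real, Complex.norm_real]
    exact abs_exp_sub_one_le_mul (hC' x)

end ExpSchwartz

/-! ### Circulant matrices and their Fourier eigenvectors. -/

section Circulant

/-- The circulant matrix with eigenvalues `z k`. -/
def circ (z : Fin 3 → ℂ) : Matrix (Fin 3) (Fin 3) ℂ :=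
  (1 / 3 : ℂ) • !![z 0 + z 1 + z 2, z 0 + omega ^ 2 * z 1 + omega * z 2,
      z 0 + omega * z 1 + omega ^ 2 * z 2;
    z 0 + omega * z 1 + omega ^ 2 * z 2, z 0 + z 1 + z 2, z 0 + omega ^ 2 * z 1 + omega * z 2;
    z 0 + omega ^ 2 * z 1 + omega * z 2, z 0 + omega * z 1 + omega ^ 2 * z 2, z 0 + z 1 + z 2]

/-- The common eigenvectors of circulant matrices. -/
def eigvec : Fin 3 → Fin 3 → ℂ := ![![1, 1, 1], ![omega, omega ^ 2, 1], ![omega ^ 2, omega, 1]]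

/-- `J² = diag(ω², ω, 1)`. -/
def diagJ : Fin 3 → ℂ := ![omega ^ 2, omega, 1]

lemma omega_pow_four : omega ^ 4 = omega := by
  rw [show (4 : ℕ) = 3 + 1 from rfl, pow_succ, omega_pow_three, one_mul]

lemma circ_mulVec_eigvec (z : Fin 3 → ℂ) (k i : Fin 3) :
    (circ z).mulVec (eigvec k) i = z k * eigvec k i := by
  have h2 := omega_sq
  have h3 := omega_pow_three
  have h4 := omega_pow_four
  fin_cases k <;> fin_cases i <;>
    simp [circ, eigvec, Matrix.mulVec, dotProduct, Fin.sum_univ_three] <;> ring_nf <;>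
    simp only [h2, h3, h4] <;> ring_nf

/-- Transposing a circulant reverses the cyclic shift, that is, the sign of the Fourier index. -/
lemma vecMul_circ_eigvec (z : Fin 3 → ℂ) (k i : Fin 3) :
    (circ z).transpose.mulVec (eigvec k) i = z (-k) * eigvec k i := by
  have h2 := omega_sq
  have h3 := omega_pow_three
  have h4 := omega_pow_four
  have e1 : (-1 : Fin 3) = 2 := rfl
  have e2 : (-2 : Fin 3) = 1 := rfl
  fin_cases k <;> fin_cases i <;>
    simp [circ, eigvec, Matrix.mulVec, dotProduct, Fin.sum_univ_three, e1, e2] <;> ring_nf <;>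
    simp only [h2, h3, h4] <;> ring_nf

lemma diagJ_mul_eigvec (k i : Fin 3) : diagJ i * eigvec k i = eigvec (k - 1) i := by
  have h3 := omega_pow_three
  have h4 := omega_pow_four
  have e1 : (0 - 1 : Fin 3) = 2 := rfl
  fin_cases k <;> fin_cases i <;> simp [diagJ, eigvec] <;> ring_nf <;> simp [h3, h4]

/-- `J` raises and `J²` lowers the Fourier index, so the diagonal matrix `𝔏` becomes a cyclic
nearest-neighbour coupling. -/
lemma l_mul_eigvec (μ : ℂ) (k i : Fin 3) :
    l μ i * eigvec k i = μ / 2 * eigvec (k + 1) i + μ⁻¹ / 2 * eigvec (k - 1) i := by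
  have h2 := omega_sq
  have h3 := omega_pow_three
  fin_cases k <;> fin_cases i <;> simp [l_zero, l_one, l_two, eigvec] <;> ring_nf <;>
    simp only [h2, h3] <;> ring_nf

/-- Conjugation exchanges `ω` and `ω²`, and exchanging the first two indices undoes this when the
eigenvalues are real. -/
lemma conj_circ (z : Fin 3 → ℝ) (i k : Fin 3) :
    starRingEnd ℂ (circ (fun m => (z m : ℂ)) (Equiv.swap 0 1 i) (Equiv.swap 0 1 k))
      = circ (fun m => (z m : ℂ)) i k := by
  have h4 := omega_pow_four
  have h5 : (omega ^ 2) ^ 2 = omega := by rw [← pow_mul]; exact h4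
  fin_cases i <;> fin_cases k <;>
    simp [circ, Equiv.swap_apply_def, conj_omega, h5, Complex.conj_ofNat]

lemma conj_diagJ (i : Fin 3) : starRingEnd ℂ (diagJ (Equiv.swap 0 1 i)) = diagJ i := by
  have h4 := omega_pow_four
  have h5 : (omega ^ 2) ^ 2 = omega := by rw [← pow_mul]; exact h4
  fin_cases i <;> simp [diagJ, Equiv.swap_apply_def, conj_omega, h5]

lemma isSchwartz_circ {z : Fin 3 → ℝ → ℂ} (hz : ∀ k, IsSchwartz (z k)) :
    SchwartzEntries fun x => circ fun k => z k x := by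
  have key : ∀ a b c : ℂ, IsSchwartz fun x => 3⁻¹ * (a * z 0 x + b * z 1 x + c * z 2 x) :=
    fun a b c => ((((hz 0).const_mul a).add ((hz 1).const_mul b)).add
      ((hz 2).const_mul c)).const_mul _
  intro i k
  fin_cases i <;> fin_cases k <;> simp [circ]
  · simpa using key 1 1 1
  · simpa using key 1 (omega ^ 2) omega
  · simpa using key 1 omega (omega ^ 2)
  · simpa using key 1 omega (omega ^ 2)
  · simpa using key 1 1 1
  · simpa using key 1 (omega ^ 2) omega
  · simpa using key 1 (omega ^ 2) omega
  · simpa using key 1 omega (omega ^ 2)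
  · simpa using key 1 1 1

end Circulant

/-! ### The spectral problem in Toda form. -/

/-- The coefficients of the spectral problem, a Lax pair of affine Toda type, in the basis of
eigenvectors of the cyclic shift. -/
structure TodaData where
  n : Fin 3 → ℝ → ℝ
  α : Fin 3 → ℝ → ℝ
  schwartz_n : ∀ k, IsSchwartz fun x => (n k x : ℂ)
  schwartz_α : ∀ k, IsSchwartz fun x => (α k x : ℂ)
  sum_n : ∀ x, n 0 x + n 1 x + n 2 x = 0
  sum_α : ∀ x, α 0 x + α 1 x + α 2 x = 0

namespace TodaData

variable (T : TodaData)

/-- The part of the potential which does not depend on the spectral parameter. -/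
def NN (x : ℝ) : Matrix (Fin 3) (Fin 3) ℂ := circ fun k => (T.n k x : ℂ)

/-- The circulant factor of the coefficient of `μ⁻¹`. -/
def expCirc (x : ℝ) : Matrix (Fin 3) (Fin 3) ℂ := circ fun k => ((Real.exp (T.α k x) - 1 : ℝ) : ℂ)

/-- The coefficient of `μ⁻¹` in the potential. -/
def MM (x : ℝ) : Matrix (Fin 3) (Fin 3) ℂ :=
  Matrix.of fun i k => 1 / 2 * diagJ i * T.expCirc x i k

lemma schwartz_NN : SchwartzEntries T.NN := isSchwartz_circ T.schwartz_n

lemma schwartz_MM : SchwartzEntries T.MM := fun i k =>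
  (isSchwartz_circ (fun k => (T.schwartz_α k).exp_sub_one) i k).const_mul _

lemma NN_diag (x : ℝ) (i : Fin 3) : T.NN x i i = 0 := by
  have h : (T.n 0 x : ℂ) + T.n 1 x + T.n 2 x = 0 := by exact_mod_cast T.sum_n x
  fin_cases i <;> simp [NN, circ, h]

lemma MM_mulVec (x : ℝ) (w : Fin 3 → ℂ) (i : Fin 3) :
    (T.MM x).mulVec w i = 1 / 2 * diagJ i * (T.expCirc x).mulVec w i := by
  simp only [MM, Matrix.mulVec, dotProduct, Matrix.of_apply, Finset.mul_sum, mul_assoc]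

lemma transpose_MM_mulVec (x : ℝ) (w : Fin 3 → ℂ) (i : Fin 3) :
    (T.MM x).transpose.mulVec w i
      = 1 / 2 * (T.expCirc x).transpose.mulVec (fun k => diagJ k * w k) i := by
  simp only [MM, Matrix.mulVec, dotProduct, Matrix.of_apply, Matrix.transpose_apply,
    Finset.mul_sum]
  exact Finset.sum_congr rfl fun k _ => by ring

/-- The spectral problem in the basis of eigenvectors of the cyclic shift. -/
lemma act_eigvec (μ : ℝ) (x : ℝ) (k i : Fin 3) :
    l μ i * eigvec k i + (pot T.NN T.MM μ x).mulVec (eigvec k) i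
      = T.n k x * eigvec k i + μ / 2 * eigvec (k + 1) i
        + (Real.exp (T.α k x) : ℂ) * (μ : ℂ)⁻¹ / 2 * eigvec (k - 1) i := by
  rw [pot, Matrix.add_mulVec, Pi.add_apply, Matrix.smul_mulVec, Pi.smul_apply, MM_mulVec, NN,
    expCirc, circ_mulVec_eigvec, circ_mulVec_eigvec, l_mul_eigvec, ← diagJ_mul_eigvec k i,
    smul_eq_mul]
  push_cast; ring

lemma act_transpose_eigvec (μ : ℝ) (x : ℝ) (k i : Fin 3) :
    l μ i * eigvec k i + (pot T.NN T.MM μ x).transpose.mulVec (eigvec k) i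
      = T.n (-k) x * eigvec k i + μ / 2 * eigvec (k + 1) i
        + (Real.exp (T.α (-(k - 1)) x) : ℂ) * (μ : ℂ)⁻¹ / 2 * eigvec (k - 1) i := by
  rw [pot, Matrix.transpose_add, Matrix.transpose_smul, Matrix.add_mulVec, Pi.add_apply,
    Matrix.smul_mulVec, Pi.smul_apply, transpose_MM_mulVec, NN, vecMul_circ_eigvec, expCirc,
    funext (diagJ_mul_eigvec k), vecMul_circ_eigvec, l_mul_eigvec, smul_eq_mul]
  push_cast; ring

end TodaData

/-! ### Identification of scattering entries from their limits. -/

section Transfer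

variable {NN MM : ℝ → Matrix (Fin 3) (Fin 3) ℂ}

lemma scat_eq_of_tendsto (hN : SchwartzEntries NN) (hM : SchwartzEntries MM) {μ : ℝ} (hμ : 0 < μ)
    {i j : Fin 3} (hi : i = 0 ∨ i = 1) (hj : j = 0 ∨ j = 1) {w : ℝ → Fin 3 → ℂ}
    (hw : IsJostColumn (l μ) (pot NN MM μ) j w) {s : ℂ}
    (hs : Tendsto (fun x : ℝ => Complex.exp (-(x : ℂ) * (l μ i - l μ j)) * w x i) atBot (𝓝 s)) :
    scat NN MM i j μ = s := by
  have hd := fun i => l_sub_re_nonneg hμ i hj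
  have h := tendsto_scatteringEntry hN hM hμ hd (l_sub_re_eq_zero μ hi hj)
  rw [jostColumn_eq hN hM hμ hd hw] at h
  exact tendsto_nhds_unique h hs

lemma tendsto_scat (hN : SchwartzEntries NN) (hM : SchwartzEntries MM) {μ : ℝ} (hμ : 0 < μ)
    {i j : Fin 3} (hi : i = 0 ∨ i = 1) (hj : j = 0 ∨ j = 1) :
    Tendsto (fun x : ℝ => Complex.exp (-(x : ℂ) * (l μ i - l μ j)) *
      jostColumn (l μ) (pot NN MM μ) j x i) atBot (𝓝 (scat NN MM i j μ)) :=
  tendsto_scatteringEntry hN hM hμ (fun i => l_sub_re_nonneg hμ i hj) (l_sub_re_eq_zero μ hi hj)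

lemma conj_l_swap (μ : ℝ) (i : Fin 3) : starRingEnd ℂ (l μ (Equiv.swap 0 1 i)) = l μ i := by
  fin_cases i
  · simpa using conj_l_one μ
  · simpa using conj_l_zero μ
  · simpa [Equiv.swap_apply_def] using conj_l_two μ

lemma l_inv_swap (μ : ℝ) (i : Fin 3) : l ((μ⁻¹ : ℝ) : ℂ) (Equiv.swap 0 1 i) = l μ i := by
  fin_cases i
  · simp [l_zero, l_one]; ring
  · simp [l_zero, l_one]; ring
  · simp [Equiv.swap_apply_def, l_two]; ring

lemma swap_zero_or_one {j : Fin 3} (hj : j = 0 ∨ j = 1) :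
    (Equiv.swap 0 1 : Equiv.Perm (Fin 3)) j = 0 ∨ (Equiv.swap 0 1 : Equiv.Perm (Fin 3)) j = 1 := by
  rcases hj with rfl | rfl <;> simp

end Transfer

/-! ### Conjugation symmetry, and the symmetry between `μ` and `μ⁻¹`. -/

namespace TodaData

variable (T : TodaData)

/-- Complex conjugation symmetry of the scattering matrix. -/
lemma scat_swap {μ : ℝ} (hμ : 0 < μ) {i j : Fin 3} (hi : i = 0 ∨ i = 1) (hj : j = 0 ∨ j = 1) :
    scat T.NN T.MM (Equiv.swap 0 1 i) (Equiv.swap 0 1 j) μ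
      = starRingEnd ℂ (scat T.NN T.MM i j μ) := by
  set τ : Equiv.Perm (Fin 3) := Equiv.swap 0 1 with hτ
  have hττ : ∀ i, τ (τ i) = i := Equiv.swap_apply_self 0 1 |> fun h i => h i
  have hd := fun i => l_sub_re_nonneg hμ i hj
  have hd' := fun i => l_sub_re_nonneg hμ i (swap_zero_or_one hj)
  have hw := jostColumn_spec T.schwartz_NN T.schwartz_MM hμ hd
  have hpot : ∀ x i k, starRingEnd ℂ (pot T.NN T.MM μ x (τ i) (τ k)) = pot T.NN T.MM μ x i k := by
    intro x i k
    simp only [pot, Matrix.add_apply, Matrix.smul_apply, smul_eq_mul, map_add, map_mul, map_inv₀,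
      Complex.conj_ofReal, NN, conj_circ, MM, Matrix.of_apply, expCirc, conj_diagJ, map_div₀,
      map_one, hτ, Complex.conj_ofNat]
  have hl : ∀ i, starRingEnd ℂ (l μ (τ i)) = l μ i := conj_l_swap μ
  have hl' : ∀ i, starRingEnd ℂ (l μ i) = l μ (τ i) := fun i => by rw [← hl (τ i), hττ]
  -- The system is invariant under conjugation combined with the exchange of the first two indices,
  -- so this operation carries Jost columns to Jost columns.
  have hwJ : IsJostColumn (l μ) (pot T.NN T.MM μ) (τ j)
      (fun x i => starRingEnd ℂ (jostColumn (l μ) (pot T.NN T.MM μ) j x (τ i))) := by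
    obtain ⟨C, hC⟩ := hw.2.1
    refine isJostColumn_of_hasDerivAt T.schwartz_NN T.schwartz_MM hd' ⟨C, fun x => ?_⟩
      (fun x i => ?_) (fun i => ?_)
    · refine (pi_norm_le_iff_of_nonneg ((norm_nonneg _).trans (hC x))).2 fun i => ?_
      rw [RCLike.norm_conj]
      exact (norm_le_pi_norm _ _).trans (hC x)
    · have h1 := (hw.hasDerivAt T.schwartz_NN T.schwartz_MM hd x (τ i)).star
      refine h1.congr_deriv ?_
      change starRingEnd ℂ _ = _
      rw [map_add, map_mul, map_sub, hl, hl']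
      congr 1
      simp only [Matrix.mulVec, dotProduct, map_sum, map_mul]
      rw [← Equiv.sum_comp τ]
      exact Finset.sum_congr rfl fun k _ => by rw [hpot]
    · have h1 := (Complex.continuous_conj.tendsto _).comp
        (hw.tendsto_atTop T.schwartz_NN T.schwartz_MM hd (τ i))
      have h2 : starRingEnd ℂ ((1 : Matrix (Fin 3) (Fin 3) ℂ) (τ i) j)
          = (1 : Matrix (Fin 3) (Fin 3) ℂ) i (τ j) := by
        have : τ i = j ↔ i = τ j := by
          constructor
          · rintro rfl; rw [hττ]
          · rintro rfl; rw [hττ]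
        simp only [Matrix.one_apply, this]
        split_ifs <;> simp
      rw [h2] at h1
      exact h1
  refine scat_eq_of_tendsto T.schwartz_NN T.schwartz_MM hμ (swap_zero_or_one hi)
    (swap_zero_or_one hj) hwJ ?_
  have h1 := (Complex.continuous_conj.tendsto _).comp
    (tendsto_scat T.schwartz_NN T.schwartz_MM hμ hi hj)
  refine h1.congr fun x => ?_
  simp only [Function.comp_apply, map_mul, ← Complex.exp_conj, map_neg, map_sub,
    Complex.conj_ofReal, hl', ← hτ, hττ]

/-- The exponents of the gauge transformation relating large and small spectral parameters. -/
def gauge (k : Fin 3) (x : ℝ) : ℝ := (T.α k x - T.α (k + 1) x) / 3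

lemma schwartz_gauge (k : Fin 3) : IsSchwartz fun x => (T.gauge k x : ℂ) := by
  have := ((T.schwartz_α k).sub (T.schwartz_α (k + 1))).const_mul (1 / 3)
  convert this using 2 with x
  unfold gauge; push_cast; ring

/-- The data governing the spectral problem at the inverse spectral parameter. -/
def flip : TodaData where
  n k x := T.n (-k) x + deriv (T.gauge (-k)) x
  α k x := T.α (1 - k) x
  schwartz_n k := by
    simpa using (T.schwartz_n (-k)).add (T.schwartz_gauge (-k)).deriv_real
  schwartz_α k := T.schwartz_α (1 - k)
  sum_n x := by
    have h0 := (T.schwartz_gauge 0).hasDerivAt_real x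
    have h1 := (T.schwartz_gauge 1).hasDerivAt_real x
    have h2 := (T.schwartz_gauge 2).hasDerivAt_real x
    have hz : (fun x => T.gauge 0 x + T.gauge 1 x + T.gauge 2 x) = fun _ => 0 := by
      ext x
      have : (2 + 1 : Fin 3) = 0 := rfl
      have e2 : (1 + 1 : Fin 3) = 2 := rfl
      simp only [gauge, this, e2, zero_add]; ring
    have h3 := ((h0.add h1).add h2).unique
      ((hasDerivAt_const x (0 : ℝ)).congr_of_eventuallyEq (Eventually.of_forall fun y =>
        congrFun hz y))
    have e1 : (-1 : Fin 3) = 2 := rfl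
    have e2 : (-2 : Fin 3) = 1 := rfl
    simp only [neg_zero, e1, e2]
    linarith [T.sum_n x]
  sum_α x := by
    have e1 : (1 - 2 : Fin 3) = 2 := rfl
    simp only [sub_zero, sub_self, e1]
    linarith [T.sum_α x]

/-- The coordinates of `w` in the basis of eigenvectors. -/
def coord (k : Fin 3) (w : Fin 3 → ℂ) : ℂ := 1 / 3 * ∑ i, eigvec (-k) i * w i

lemma sum_coord_mul_eigvec (w : Fin 3 → ℂ) (i : Fin 3) :
    ∑ k, coord k w * eigvec k i = w i := by
  have h2 := omega_sq
  have h3 := omega_pow_three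
  have h4 := omega_pow_four
  have e1 : (-1 : Fin 3) = 2 := rfl
  have e2 : (-2 : Fin 3) = 1 := rfl
  fin_cases i <;> simp [coord, eigvec, Fin.sum_univ_three, e1, e2] <;> ring_nf <;>
    simp only [h2, h3, h4] <;> ring_nf

lemma eigvec_neg (k i : Fin 3) : eigvec (-k) i = eigvec k (Equiv.swap 0 1 i) := by
  have e1 : (-1 : Fin 3) = 2 := rfl
  have e2 : (-2 : Fin 3) = 1 := rfl
  fin_cases k <;> fin_cases i <;> simp [eigvec, e1, e2, Equiv.swap_apply_def]

/-- A coordinate is a pairing with a Fourier vector of index `-k`, so the operator is moved onto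
that vector by transposition. -/
lemma hasDerivAt_coord {μ : ℝ} {a : ℂ} {w : ℝ → Fin 3 → ℂ}
    (hw : ∀ x i, HasDerivAt (fun x => w x i)
      ((l μ i - a) * w x i + (pot T.NN T.MM μ x).mulVec (w x) i) x) (k : Fin 3) (x : ℝ) :
    HasDerivAt (fun x => coord k (w x)) ((T.n k x - a) * coord k (w x)
      + μ / 2 * coord (k - 1) (w x)
      + (Real.exp (T.α (k + 1) x) : ℂ) * (μ : ℂ)⁻¹ / 2 * coord (k + 1) (w x)) x := by
  have h1 := (HasDerivAt.fun_sum (u := Finset.univ) fun i _ =>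
    (hw x i).const_mul (eigvec (-k) i)).const_mul (1 / 3 : ℂ)
  refine h1.congr_deriv ?_
  have h2 : ∑ i, eigvec (-k) i * (pot T.NN T.MM μ x).mulVec (w x) i
      = ∑ i, (pot T.NN T.MM μ x).transpose.mulVec (eigvec (-k)) i * w x i := by
    change dotProduct _ _ = dotProduct _ _
    rw [Matrix.dotProduct_mulVec, Matrix.mulVec_transpose]
  have h3 : ∀ i, eigvec (-k) i * ((l μ i - a) * w x i + (pot T.NN T.MM μ x).mulVec (w x) i)
      = (l μ i * eigvec (-k) i) * w x i - a * (eigvec (-k) i * w x i)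
        + eigvec (-k) i * (pot T.NN T.MM μ x).mulVec (w x) i := fun i => by ring
  simp only [h3, Finset.sum_add_distrib, Finset.sum_sub_distrib, h2]
  have h4 : ∀ i, l μ i * eigvec (-k) i * w x i = (T.n k x * eigvec (-k) i
      + μ / 2 * eigvec (-(k - 1)) i
      + (Real.exp (T.α (k + 1) x) : ℂ) * (μ : ℂ)⁻¹ / 2 * eigvec (-(k + 1)) i) * w x i
      - (pot T.NN T.MM μ x).transpose.mulVec (eigvec (-k)) i * w x i := fun i => by
    have h := T.act_transpose_eigvec μ x (-k) i
    have e1 : -(k - 1) = -k + 1 := by abel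
    have e2 : -(k + 1) = -k - 1 := by abel
    have e3 : -(-k - 1) = k + 1 := by abel
    rw [neg_neg, e3] at h
    rw [e1, e2]
    linear_combination w x i * h
  simp only [h4, coord, Finset.sum_sub_distrib, add_mul, Finset.sum_add_distrib, mul_assoc,
    ← Finset.mul_sum]
  ring

lemma norm_omega : ‖omega‖ = 1 := by
  have h : ‖omega‖ ^ 3 = 1 := by rw [← norm_pow, omega_pow_three, norm_one]
  exact (pow_eq_one_iff_of_nonneg (norm_nonneg _) (by norm_num)).1 h

lemma norm_eigvec (k i : Fin 3) : ‖eigvec k i‖ = 1 := by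
  fin_cases k <;> fin_cases i <;> simp [eigvec, norm_omega]

lemma norm_coord_le (k : Fin 3) (w : Fin 3 → ℂ) : ‖coord k w‖ ≤ ‖w‖ := by
  have h : ‖∑ i, eigvec (-k) i * w i‖ ≤ ∑ _i : Fin 3, ‖w‖ :=
    norm_sum_le_of_le _ fun i _ => by
      rw [norm_mul, norm_eigvec, one_mul]; exact norm_le_pi_norm w i
  rw [coord, norm_mul]
  simp only [Finset.sum_const, Finset.card_univ, Fintype.card_fin, nsmul_eq_mul] at h
  norm_num at h ⊢
  linarith

/-- This recursion around the cycle of length three is consistent only because the `α k` sum to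
zero. -/
lemma gauge_succ (k : Fin 3) (x : ℝ) : T.gauge (k + 1) x = T.gauge k x + T.α (k + 1) x := by
  have h := T.sum_α x
  have e1 : (2 + 1 : Fin 3) = 0 := rfl
  have e2 : (1 + 1 : Fin 3) = 2 := rfl
  fin_cases k <;> simp [gauge, e1, e2] <;> linarith

/-- The gauge transformation relating the spectral problems at `μ` and `μ⁻¹`. -/
def gaugeMap (w : ℝ → Fin 3 → ℂ) (x : ℝ) (i : Fin 3) : ℂ :=
  ∑ k, ((Real.exp (T.gauge k x) : ℝ) : ℂ) * coord k (w x) * eigvec (-k) i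

/-- Scaling the `k`-th coordinate by `exp (gauge k)` moves the factors `exp α` from the couplings
with `μ⁻¹` to those with `μ`. Reversing the Fourier index restores the standard form with `μ` and
`μ⁻¹` exchanged; the derivatives of the gauges enter the new diagonal. -/
lemma hasDerivAt_gaugeMap {μ : ℝ} {a : ℂ} {w : ℝ → Fin 3 → ℂ}
    (hw : ∀ x i, HasDerivAt (fun x => w x i)
      ((l μ i - a) * w x i + (pot T.NN T.MM μ x).mulVec (w x) i) x) (x : ℝ) (i : Fin 3) :
    HasDerivAt (fun x => T.gaugeMap w x i) ((l ((μ⁻¹ : ℝ) : ℂ) i - a) * T.gaugeMap w x i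
      + (pot T.flip.NN T.flip.MM μ⁻¹ x).mulVec (T.gaugeMap w x) i) x := by
  have h1 := HasDerivAt.fun_sum (u := Finset.univ) fun k _ =>
    (((((T.schwartz_gauge k).hasDerivAt_real x).exp.ofReal_comp).mul
      (T.hasDerivAt_coord hw k x)).mul_const (eigvec (-k) i))
  refine h1.congr_deriv ?_
  have h2 : (pot T.flip.NN T.flip.MM μ⁻¹ x).mulVec (T.gaugeMap w x) i
      = ∑ k, ((Real.exp (T.gauge k x) : ℝ) : ℂ) * coord k (w x) *
        (pot T.flip.NN T.flip.MM μ⁻¹ x).mulVec (eigvec (-k)) i := by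
    simp only [Matrix.mulVec, dotProduct, gaugeMap, Finset.mul_sum]
    rw [Finset.sum_comm]
    exact Finset.sum_congr rfl fun _ _ => Finset.sum_congr rfl fun _ _ => by ring
  have h3 : ∀ k, (pot T.flip.NN T.flip.MM μ⁻¹ x).mulVec (eigvec (-k)) i
      = (T.n k x + deriv (T.gauge k) x) * eigvec (-k) i + (μ : ℂ)⁻¹ / 2 * eigvec (-(k - 1)) i
        + (Real.exp (T.α (k + 1) x) : ℂ) * μ / 2 * eigvec (-(k + 1)) i
        - l ((μ⁻¹ : ℝ) : ℂ) i * eigvec (-k) i := fun k => by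
    have h := T.flip.act_eigvec μ⁻¹ x (-k) i
    have e1 : -(k - 1) = -k + 1 := by abel
    have e2 : -(k + 1) = -k - 1 := by abel
    have e3 : 1 - -k = k + 1 := by abel
    simp only [flip, neg_neg, e3] at h
    rw [e1, e2]
    simp only [flip]
    push_cast at h ⊢
    rw [inv_inv] at h
    linear_combination h
  have h4 : ∀ k, ((Real.exp (T.gauge (k + 1) x) : ℝ) : ℂ)
      = (Real.exp (T.gauge k x) : ℝ) * (Real.exp (T.α (k + 1) x) : ℝ) := fun k => by
    rw [gauge_succ, Real.exp_add]; push_cast; rfl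
  have g1 := h4 0
  have g2 := h4 1
  have g3 := h4 2
  have e1 : (2 + 1 : Fin 3) = 0 := rfl
  have e2 : (1 + 1 : Fin 3) = 2 := rfl
  have e3 : (0 - 1 : Fin 3) = 2 := rfl
  have e4 : (1 - 1 : Fin 3) = 0 := rfl
  have e5 : (2 - 1 : Fin 3) = 1 := rfl
  rw [h2]
  simp only [h3, gaugeMap]
  simp only [Fin.sum_univ_three, e1, e2, e3, e4, e5, zero_add] at g1 g2 g3 ⊢
  simp only [Complex.ofReal_mul]
  generalize ((Real.exp (T.gauge 0 x) : ℝ) : ℂ) = G0 at *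
  generalize ((Real.exp (T.gauge 1 x) : ℝ) : ℂ) = G1 at *
  generalize ((Real.exp (T.gauge 2 x) : ℝ) : ℂ) = G2 at *
  generalize ((Real.exp (T.α 0 x) : ℝ) : ℂ) = A0 at *
  generalize ((Real.exp (T.α 1 x) : ℝ) : ℂ) = A1 at *
  generalize ((Real.exp (T.α 2 x) : ℝ) : ℂ) = A2 at *
  generalize eigvec (-0) i = v0
  generalize eigvec (-1) i = v1
  generalize eigvec (-2) i = v2
  generalize coord 0 (w x) = c0
  generalize coord 1 (w x) = c1
  generalize coord 2 (w x) = c2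
  linear_combination (-(μ : ℂ)⁻¹ / 2 * c1 * v0 + μ / 2 * c0 * v1) * g1
    + (-(μ : ℂ)⁻¹ / 2 * c2 * v1 + μ / 2 * c1 * v2) * g2
    + (-(μ : ℂ)⁻¹ / 2 * c0 * v2 + μ / 2 * c2 * v0) * g3

/-- Up to factors that vanish at both ends of the line, the gauge only exchanges the first two
components; so it preserves the normalisation at `+∞` and the scattering limits at `-∞`. -/
lemma gaugeMap_sub (w : ℝ → Fin 3 → ℂ) (x : ℝ) (i : Fin 3) :
    T.gaugeMap w x i - w x (Equiv.swap 0 1 i) =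
      ∑ k, ((Real.exp (T.gauge k x) - 1 : ℝ) : ℂ) * coord k (w x) * eigvec (-k) i := by
  rw [← sum_coord_mul_eigvec (w x) (Equiv.swap 0 1 i), gaugeMap, ← Finset.sum_sub_distrib]
  refine Finset.sum_congr rfl fun k _ => ?_
  rw [← eigvec_neg]; push_cast; ring

lemma norm_gaugeMap_sub_le {w : ℝ → Fin 3 → ℂ} {C : ℝ} (hC : ∀ x, ‖w x‖ ≤ C) (x : ℝ) (i : Fin 3) :
    ‖T.gaugeMap w x i - w x (Equiv.swap 0 1 i)‖ ≤
      ∑ k, ‖((Real.exp (T.gauge k x) - 1 : ℝ) : ℂ)‖ * C := by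
  rw [gaugeMap_sub]
  refine norm_sum_le_of_le _ fun k _ => ?_
  rw [norm_mul, norm_mul, norm_eigvec, mul_one]
  gcongr
  exact (norm_coord_le _ _).trans (hC x)

lemma tendsto_gaugeMap_sub {w : ℝ → Fin 3 → ℂ} {C : ℝ} (hC : ∀ x, ‖w x‖ ≤ C) (i : Fin 3)
    {F : Filter ℝ}
    (hF : ∀ k, Tendsto (fun x => ((Real.exp (T.gauge k x) - 1 : ℝ) : ℂ)) F (𝓝 0)) :
    Tendsto (fun x => T.gaugeMap w x i - w x (Equiv.swap 0 1 i)) F (𝓝 0) := by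
  refine squeeze_zero_norm (T.norm_gaugeMap_sub_le hC · i) ?_
  have := tendsto_finsetSum (Finset.univ : Finset (Fin 3)) fun k _ => ((hF k).norm.mul_const C)
  simpa using this

/-- The scattering matrix at `μ` is the scattering matrix of the flipped data at `μ⁻¹`. -/
theorem scat_eq_flip {μ : ℝ} (hμ : 0 < μ) {i j : Fin 3} (hi : i = 0 ∨ i = 1)
    (hj : j = 0 ∨ j = 1) :
    scat T.NN T.MM i j μ
      = scat T.flip.NN T.flip.MM (Equiv.swap 0 1 i) (Equiv.swap 0 1 j) μ⁻¹ := by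
  have hττ : ∀ i : Fin 3, Equiv.swap 0 1 (Equiv.swap 0 1 i) = i := fun i =>
    Equiv.swap_apply_self 0 1 i
  have hd := fun i => l_sub_re_nonneg hμ i hj
  have hd' := fun i => l_sub_re_nonneg (inv_pos.2 hμ) i (swap_zero_or_one hj)
  have hw := jostColumn_spec T.schwartz_NN T.schwartz_MM hμ hd
  obtain ⟨C, hC⟩ := hw.2.1
  have hsch := fun k => (T.schwartz_gauge k).exp_sub_one
  set w := jostColumn (l μ) (pot T.NN T.MM μ) j with hwdef
  have hwJ : IsJostColumn (l ((μ⁻¹ : ℝ) : ℂ)) (pot T.flip.NN T.flip.MM μ⁻¹) (Equiv.swap 0 1 j)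
      (T.gaugeMap w) := by
    choose B hB using fun k => (hsch k).bounded
    have hC0 : 0 ≤ C := (norm_nonneg _).trans (hC 0)
    have hB0 : ∀ k, 0 ≤ B k := fun k => (norm_nonneg _).trans (hB k 0)
    refine isJostColumn_of_hasDerivAt T.flip.schwartz_NN T.flip.schwartz_MM hd'
      ⟨∑ k, B k * C + C, fun x => ?_⟩ (fun x i => ?_) (fun i => ?_)
    · refine (pi_norm_le_iff_of_nonneg (add_nonneg
        (Finset.sum_nonneg fun k _ => mul_nonneg (hB0 k) hC0) hC0)).2 fun i => ?_
      have h1 := T.norm_gaugeMap_sub_le hC x i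
      have h2 : ∑ k, ‖((Real.exp (T.gauge k x) - 1 : ℝ) : ℂ)‖ * C ≤ ∑ k, B k * C :=
        Finset.sum_le_sum fun k _ => mul_le_mul_of_nonneg_right (hB k x) hC0
      have h3 := (norm_le_pi_norm (w x) (Equiv.swap 0 1 i)).trans (hC x)
      have h4 := norm_add_le (T.gaugeMap w x i - w x (Equiv.swap 0 1 i)) (w x (Equiv.swap 0 1 i))
      rw [sub_add_cancel] at h4
      linarith
    · rw [l_inv_swap]
      exact T.hasDerivAt_gaugeMap (hw.hasDerivAt T.schwartz_NN T.schwartz_MM hd) x i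
    · have h1 := (T.tendsto_gaugeMap_sub hC i fun k => (hsch k).tendsto_atTop).add
        (hw.tendsto_atTop T.schwartz_NN T.schwartz_MM hd (Equiv.swap 0 1 i))
      have h2 : (1 : Matrix (Fin 3) (Fin 3) ℂ) (Equiv.swap 0 1 i) j
          = (1 : Matrix (Fin 3) (Fin 3) ℂ) i (Equiv.swap 0 1 j) := by
        have : Equiv.swap 0 1 i = j ↔ i = Equiv.swap 0 1 j := by
          constructor
          · rintro rfl; rw [hττ]
          · rintro rfl; rw [hττ]
        simp only [Matrix.one_apply, this]
      rw [zero_add, h2] at h1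
      simpa using h1
  symm
  refine scat_eq_of_tendsto T.flip.schwartz_NN T.flip.schwartz_MM (inv_pos.2 hμ)
    (swap_zero_or_one hi) (swap_zero_or_one hj) hwJ ?_
  have h1 := tendsto_scat T.schwartz_NN T.schwartz_MM hμ hi hj
  rw [← hwdef] at h1
  have h2 := T.tendsto_gaugeMap_sub hC (Equiv.swap 0 1 i) fun k => (hsch k).tendsto_atBot
  have h3 : Tendsto (fun x : ℝ => Complex.exp (-(x : ℂ) * (l μ i - l μ j)) *
      (T.gaugeMap w x (Equiv.swap 0 1 i) - w x i)) atBot (𝓝 0) := by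
    rw [tendsto_zero_iff_norm_tendsto_zero] at h2 ⊢
    refine h2.congr fun x => ?_
    rw [norm_mul, norm_exp_neg_mul_eq_one (l_sub_re_eq_zero μ hi hj), one_mul, hττ]
  have h4 := h3.add h1
  rw [zero_add] at h4
  refine h4.congr fun x => ?_
  rw [l_inv_swap, l_inv_swap]
  ring

end TodaData

/-! ### Comparison principles and the vector product. -/

/-- A backward quasi-monotone system started from positive values at `+∞` stays positive. -/
lemma pos_of_hasDerivAt_le {ι : Type*} [Finite ι] {ρ ρ' : ι → ℝ → ℝ} {K : ℝ}
    (hρ : ∀ k x, HasDerivAt (ρ k) (ρ' k x) x)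
    (hle : ∀ x, (∀ m, 0 ≤ ρ m x) → ∀ k, ρ' k x ≤ K * ρ k x)
    (hlim : ∀ k, ∀ᶠ x in atTop, 0 < ρ k x) (k : ι) (x : ℝ) : 0 < ρ k x := by
  have hc : ∀ k, Continuous (ρ k) := fun k =>
    continuous_iff_continuousAt.2 fun x => (hρ k x).continuousAt
  by_contra! hneg
  -- Consider the last point `x₀` at which some component `m` is not positive. To its right all
  -- components are positive, so `ρ m y * exp (-K y)` is nonincreasing there, and its positive value
  -- at `x₀ + 1` contradicts `ρ m x₀ ≤ 0`.
  set S : Set ℝ := ⋃ k, {x | ρ k x ≤ 0} with hS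
  have hSc : IsClosed S := isClosed_iUnion_of_finite fun k => isClosed_le (hc k) continuous_const
  obtain ⟨b, hb⟩ := eventually_atTop.1 (eventually_all.2 hlim)
  have hSb : BddAbove S := ⟨b, fun y hy => by
    obtain ⟨m, hm⟩ := Set.mem_iUnion.1 hy
    by_contra! h
    exact absurd (hb y h.le m) (not_lt.2 hm)⟩
  have hSn : S.Nonempty := ⟨x, Set.mem_iUnion.2 ⟨k, hneg⟩⟩
  obtain ⟨m, hm⟩ := Set.mem_iUnion.1 (hSc.csSup_mem hSn hSb)
  set x₀ := sSup S
  have hpos : ∀ y, x₀ < y → ∀ k, 0 < ρ k y := fun y hy k => by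
    by_contra! h
    exact absurd (le_csSup hSb (Set.mem_iUnion.2 ⟨k, h⟩)) (not_le.2 hy)
  have hder : ∀ y, HasDerivAt (fun y => ρ m y * Real.exp (-K * y))
      ((ρ' m y - K * ρ m y) * Real.exp (-K * y)) y := fun y => by
    have h1 := (hρ m y).mul (((hasDerivAt_id y).const_mul (-K)).exp)
    refine h1.congr_deriv ?_
    simp only [id, mul_one]; ring
  have hanti : AntitoneOn (fun y => ρ m y * Real.exp (-K * y)) (Set.Ici x₀) := by
    refine antitoneOn_of_deriv_nonpos (convex_Ici x₀)
      (fun y _ => (hder y).continuousAt.continuousWithinAt)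
      (fun y _ => (hder y).differentiableAt.differentiableWithinAt) fun y hy => ?_
    rw [interior_Ici] at hy
    rw [(hder y).deriv]
    exact mul_nonpos_of_nonpos_of_nonneg
      (sub_nonpos.2 (hle y (fun k => (hpos y hy k).le) m)) (Real.exp_pos _).le
  have h1 := hanti (Set.mem_Ici.2 le_rfl) (Set.mem_Ici.2 (by linarith : x₀ ≤ x₀ + 1))
    (by linarith)
  have h2 := mul_pos (hpos (x₀ + 1) (by linarith) m) (Real.exp_pos (-K * (x₀ + 1)))
  have h3 := mul_nonpos_of_nonpos_of_nonneg hm (Real.exp_pos (-K * x₀)).le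
  simp only at h1
  linarith

/-- Backward Grönwall inequality from `+∞`. -/
lemma mul_exp_le_of_hasDerivAt_le {S S' g : ℝ → ℝ} {a : ℝ} (ha : 0 ≤ a)
    (hS : ∀ x, HasDerivAt S (S' x) x)
    (hg : Continuous g) (hgi : Integrable g) (hg0 : ∀ x, 0 ≤ g x)
    (hle : ∀ x, S' x ≤ g x * S x) (hlim : Tendsto S atTop (𝓝 a)) (x : ℝ) :
    a * Real.exp (-∫ y, g y) ≤ S x := by
  have hG := fun x => hasDerivAt_integral_Ioi hg (fun a => hgi.integrableOn) x
  have hder : ∀ x, HasDerivAt (fun x => S x * Real.exp (∫ y in Set.Ioi x, g y))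
      ((S' x - g x * S x) * Real.exp (∫ y in Set.Ioi x, g y)) x := fun x => by
    refine ((hS x).mul (hG x).exp).congr_deriv ?_
    ring
  have hanti : Antitone fun x => S x * Real.exp (∫ y in Set.Ioi x, g y) :=
    antitone_of_deriv_nonpos (fun x => (hder x).differentiableAt) fun x => by
      rw [(hder x).deriv]
      exact mul_nonpos_of_nonpos_of_nonneg (sub_nonpos.2 (hle x)) (Real.exp_pos _).le
  have h0 : ∀ x, 0 ≤ ∫ y in Set.Ioi x, g y := fun x => integral_nonneg hg0
  have hF : Tendsto (fun x => S x * Real.exp (∫ y in Set.Ioi x, g y)) atTop (𝓝 a) := by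
    have h1 := hlim.mul ((Real.continuous_exp.tendsto _).comp
      (tendsto_integral_Ioi_zero (f := g) (μ := volume) tendsto_id))
    simpa using h1
  have h1 : a ≤ S x * Real.exp (∫ y in Set.Ioi x, g y) := hanti.le_of_tendsto hF x
  have h2 : (∫ y in Set.Ioi x, g y) ≤ ∫ y, g y :=
    setIntegral_le_integral hgi (Eventually.of_forall hg0)
  calc a * Real.exp (-∫ y, g y) ≤ a * Real.exp (-∫ y in Set.Ioi x, g y) := by gcongr
    _ ≤ S x * Real.exp (∫ y in Set.Ioi x, g y) * Real.exp (-∫ y in Set.Ioi x, g y) := by gcongr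
    _ = S x := by rw [mul_assoc, ← Real.exp_add, add_neg_cancel, Real.exp_zero, mul_one]

/-- The vector product in `ℂ³`. -/
def cross (v w : Fin 3 → ℂ) : Fin 3 → ℂ :=
  ![v 1 * w 2 - v 2 * w 1, v 2 * w 0 - v 0 * w 2, v 0 * w 1 - v 1 * w 0]

/-- On the exterior square of a three-dimensional space a matrix acts as its trace minus its
transpose; here the traces vanish, and the shifts `a`, `b` only add a scalar. -/
lemma hasDerivAt_cross {c : Fin 3 → ℂ} {A : Matrix (Fin 3) (Fin 3) ℂ} {a b : ℂ}
    {v w : ℝ → Fin 3 → ℂ} {x : ℝ} (hc : c 0 + c 1 + c 2 = 0) (hA : A 0 0 + A 1 1 + A 2 2 = 0)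
    (hv : ∀ i, HasDerivAt (fun x => v x i) ((c i - a) * v x i + A.mulVec (v x) i) x)
    (hw : ∀ i, HasDerivAt (fun x => w x i) ((c i - b) * w x i + A.mulVec (w x) i) x)
    (i : Fin 3) :
    HasDerivAt (fun x => cross (v x) (w x) i)
      (-(a + b) * cross (v x) (w x) i - (c i * cross (v x) (w x) i
        + A.transpose.mulVec (cross (v x) (w x)) i)) x := by
  have hA' : A 0 0 = -A 1 1 - A 2 2 := by linear_combination hA
  have hc' : c 0 = -c 1 - c 2 := by linear_combination hc
  fin_cases i
  · refine (((hv 1).mul (hw 2)).sub ((hv 2).mul (hw 1))).congr_deriv ?_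
    simp [cross, Matrix.mulVec, dotProduct, Fin.sum_univ_three, hA', hc']; ring
  · refine (((hv 2).mul (hw 0)).sub ((hv 0).mul (hw 2))).congr_deriv ?_
    simp [cross, Matrix.mulVec, dotProduct, Fin.sum_univ_three, hA', hc']; ring
  · refine (((hv 0).mul (hw 1)).sub ((hv 1).mul (hw 0))).congr_deriv ?_
    simp [cross, Matrix.mulVec, dotProduct, Fin.sum_univ_three, hA', hc']; ring

/-! ### Lower bound for the diagonal scattering entries. -/

namespace TodaData

variable (T : TodaData)

lemma trace_pot (μ x : ℝ) :
    pot T.NN T.MM μ x 0 0 + pot T.NN T.MM μ x 1 1 + pot T.NN T.MM μ x 2 2 = 0 := by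
  simp only [pot, Matrix.add_apply, Matrix.smul_apply, NN_diag]
  simp [MM, expCirc, circ, diagJ, omega_sq]
  ring

/-- Because `-(l 0 + l 1) = l 2` is real, all coefficients are real, and both couplings are
negative. The real parts therefore form a backward quasi-monotone system. -/
lemma hasDerivAt_sum_eigvec_mul_cross {μ : ℝ} {v w : ℝ → Fin 3 → ℂ}
    (hv : ∀ x i, HasDerivAt (fun x => v x i)
      ((l μ i - l μ 0) * v x i + (pot T.NN T.MM μ x).mulVec (v x) i) x)
    (hw : ∀ x i, HasDerivAt (fun x => w x i)
      ((l μ i - l μ 1) * w x i + (pot T.NN T.MM μ x).mulVec (w x) i) x)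
    (k : Fin 3) (x : ℝ) :
    HasDerivAt (fun x => ∑ i, eigvec k i * cross (v x) (w x) i)
      ((l μ 2 - T.n k x) * ∑ i, eigvec k i * cross (v x) (w x) i
        - μ / 2 * ∑ i, eigvec (k + 1) i * cross (v x) (w x) i
        - (Real.exp (T.α k x) : ℂ) * (μ : ℂ)⁻¹ / 2
          * ∑ i, eigvec (k - 1) i * cross (v x) (w x) i) x := by
  have h1 := HasDerivAt.fun_sum (u := Finset.univ) fun i _ =>
    (hasDerivAt_cross (l_sum μ) (T.trace_pot μ x) (hv x) (hw x) i).const_mul (eigvec k i)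
  refine h1.congr_deriv ?_
  set p := cross (v x) (w x)
  have h2 : ∑ i, eigvec k i * (pot T.NN T.MM μ x).transpose.mulVec p i
      = ∑ i, (pot T.NN T.MM μ x).mulVec (eigvec k) i * p i := by
    change dotProduct _ _ = dotProduct _ _
    rw [Matrix.mulVec_transpose, dotProduct_comm, ← Matrix.dotProduct_mulVec, dotProduct_comm]
  have h3 : ∀ i, eigvec k i * (-(l μ 0 + l μ 1) * p i
      - (l μ i * p i + (pot T.NN T.MM μ x).transpose.mulVec p i))
      = l μ 2 * (eigvec k i * p i) - (l μ i * eigvec k i) * p i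
        - eigvec k i * (pot T.NN T.MM μ x).transpose.mulVec p i := fun i => by
    linear_combination -(eigvec k i * p i) * l_sum μ
  simp only [h3, Finset.sum_sub_distrib, h2]
  have h4 : ∀ i, l μ i * eigvec k i * p i = (T.n k x * eigvec k i + μ / 2 * eigvec (k + 1) i
        + (Real.exp (T.α k x) : ℂ) * (μ : ℂ)⁻¹ / 2 * eigvec (k - 1) i) * p i
      - (pot T.NN T.MM μ x).mulVec (eigvec k) i * p i := fun i => by
    linear_combination p i * T.act_eigvec μ x k i
  simp only [h4, Finset.sum_sub_distrib, add_mul, Finset.sum_add_distrib, mul_assoc,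
    ← Finset.mul_sum]
  ring

/-- A bound for the growth of the components of the vector product of the Jost columns. -/
def growth (ε x : ℝ) : ℝ := ∑ k, (‖(T.n k x : ℂ)‖ +
  ‖((Real.exp (T.α k x) - 1 : ℝ) : ℂ)‖ * ε⁻¹)

lemma growth_nonneg {ε : ℝ} (hε : 0 < ε) (x : ℝ) : 0 ≤ T.growth ε x :=
  Finset.sum_nonneg fun _ _ => by positivity

lemma continuous_growth (ε : ℝ) : Continuous (T.growth ε) :=
  continuous_finsetSum _ fun k _ => (T.schwartz_n k).continuous.norm.add
    ((T.schwartz_α k).exp_sub_one.continuous.norm.mul continuous_const)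

lemma integrable_growth (ε : ℝ) : Integrable (T.growth ε) :=
  integrable_finsetSum _ fun k _ => (T.schwartz_n k).integrable.norm.add
    ((T.schwartz_α k).exp_sub_one.integrable.norm.mul_const _)

/-- All three pairings tend to `1` at `+∞` and stay positive to the left. In their sum the term `l 2
= (μ + μ⁻¹) / 2` cancels the free couplings, leaving a rate bounded by the integrable function
`growth ε`, uniformly in `μ > ε`. The sum is three times the third component. -/
lemma le_re_cross {ε μ : ℝ} (hε : 0 < ε) (hμ : ε < μ) {v w : ℝ → Fin 3 → ℂ}
    (hv : ∀ x i, HasDerivAt (fun x => v x i)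
      ((l μ i - l μ 0) * v x i + (pot T.NN T.MM μ x).mulVec (v x) i) x)
    (hw : ∀ x i, HasDerivAt (fun x => w x i)
      ((l μ i - l μ 1) * w x i + (pot T.NN T.MM μ x).mulVec (w x) i) x)
    (hv' : ∀ i, Tendsto (fun x => v x i) atTop (𝓝 ((1 : Matrix (Fin 3) (Fin 3) ℂ) i 0)))
    (hw' : ∀ i, Tendsto (fun x => w x i) atTop (𝓝 ((1 : Matrix (Fin 3) (Fin 3) ℂ) i 1)))
    (x : ℝ) : Real.exp (-∫ y, T.growth ε y) ≤ (cross (v x) (w x) 2).re := by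
  have hμ0 : 0 < μ := hε.trans hμ
  set ρ : Fin 3 → ℝ → ℝ := fun k x => (∑ i, eigvec k i * cross (v x) (w x) i).re with hρdef
  set ρ' : Fin 3 → ℝ → ℝ := fun k x => ((μ + μ⁻¹) / 2 - T.n k x) * ρ k x - μ / 2 * ρ (k + 1) x
    - Real.exp (T.α k x) * μ⁻¹ / 2 * ρ (k - 1) x with hρ'def
  have hρ : ∀ k x, HasDerivAt (ρ k) (ρ' k x) x := fun k x => by
    have h1 := (Complex.reCLM.hasFDerivAt.comp_hasDerivAt x
      (T.hasDerivAt_sum_eigvec_mul_cross hv hw k x))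
    refine h1.congr_deriv ?_
    have e1 : l μ 2 - (T.n k x : ℂ) = (((μ + μ⁻¹) / 2 - T.n k x : ℝ) : ℂ) := by
      rw [l_two]; push_cast; ring
    have e2 : (μ : ℂ) / 2 = ((μ / 2 : ℝ) : ℂ) := by push_cast; ring
    have e3 : (Real.exp (T.α k x) : ℂ) * (μ : ℂ)⁻¹ / 2
      = ((Real.exp (T.α k x) * μ⁻¹ / 2 : ℝ) : ℂ) := by push_cast; ring
    rw [e1, e2, e3]
    simp only [Complex.reCLM_apply, Complex.sub_re, Complex.re_ofReal_mul, hρ'def, hρdef]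
  have hcr : ∀ i, Tendsto (fun x => cross (v x) (w x) i) atTop
      (𝓝 (if i = 2 then 1 else 0)) := fun i => by
    fin_cases i
    · simpa [cross] using ((hv' 1).mul (hw' 2)).sub ((hv' 2).mul (hw' 1))
    · simpa [cross] using ((hv' 2).mul (hw' 0)).sub ((hv' 0).mul (hw' 2))
    · simpa [cross] using ((hv' 0).mul (hw' 1)).sub ((hv' 1).mul (hw' 0))
  have hlim : ∀ k, Tendsto (ρ k) atTop (𝓝 1) := fun k => by
    have h1 := (Complex.continuous_re.tendsto _).comp
      (tendsto_finsetSum (Finset.univ : Finset (Fin 3)) fun i _ => (hcr i).const_mul (eigvec k i))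
    have h2 : eigvec k 2 = 1 := by fin_cases k <;> simp [eigvec]
    simpa [h2, hρdef, Function.comp_def] using h1
  choose B hB using fun k => (T.schwartz_n k).bounded
  have hpos : ∀ k x, 0 < ρ k x := by
    refine pos_of_hasDerivAt_le (K := (μ + μ⁻¹) / 2 + ∑ k, B k) hρ (fun x h k => ?_)
      fun k => (hlim k).eventually (lt_mem_nhds one_pos)
    have h1 : -T.n k x ≤ ∑ k, B k := by
      have h2 := hB k x
      rw [Complex.norm_real, Real.norm_eq_abs] at h2
      exact (neg_le_abs _).trans (h2.trans (Finset.single_le_sum (f := B)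
        (fun k _ => (norm_nonneg _).trans (hB k 0)) (Finset.mem_univ k)))
    have h3 : 0 ≤ μ / 2 * ρ (k + 1) x := mul_nonneg (by positivity) (h _)
    have h4 : 0 ≤ Real.exp (T.α k x) * μ⁻¹ / 2 * ρ (k - 1) x := mul_nonneg (by positivity) (h _)
    have h5 := mul_le_mul_of_nonneg_right h1 (h k)
    simp only [hρ'def]
    linarith
  have hsum : ∀ x, ρ 0 x + ρ 1 x + ρ 2 x = 3 * (cross (v x) (w x) 2).re := fun x => by
    have : ∑ k : Fin 3, ∑ i, eigvec k i * cross (v x) (w x) i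
        = ((3 : ℝ) : ℂ) * cross (v x) (w x) 2 := by
      simp [Fin.sum_univ_three, eigvec, omega_sq]; ring
    rw [← Complex.re_ofReal_mul, ← this, Fin.sum_univ_three, Complex.add_re, Complex.add_re]
  have hle : ∀ x, ρ' 0 x + ρ' 1 x + ρ' 2 x ≤ T.growth ε x * (ρ 0 x + ρ 1 x + ρ 2 x) := fun x => by
    have hk : ∀ k m, (-T.n k x) * ρ k x + -(Real.exp (T.α k x) - 1) * μ⁻¹ / 2 * ρ m x
        ≤ (‖(T.n k x : ℂ)‖ + ‖((Real.exp (T.α k x) - 1 : ℝ) : ℂ)‖ * ε⁻¹)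
          * (ρ 0 x + ρ 1 x + ρ 2 x) := fun k m => by
      have hS : ∀ k, ρ k x ≤ ρ 0 x + ρ 1 x + ρ 2 x := fun k => by
        have h0 := hpos 0 x
        have h1 := hpos 1 x
        have h2 := hpos 2 x
        fin_cases k <;> simp only [Fin.zero_eta, Fin.mk_one, Fin.reduceFinMk] <;> linarith
      rw [Complex.norm_real, Complex.norm_real, Real.norm_eq_abs, Real.norm_eq_abs, add_mul]
      have hi : μ⁻¹ / 2 ≤ ε⁻¹ := by
        have := inv_anti₀ hε hμ.le
        have h2 := inv_pos.2 hμ0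
        linarith
      refine add_le_add ?_ ?_
      · exact mul_le_mul (neg_le_abs _) (hS k) (hpos k x).le (abs_nonneg _)
      · refine mul_le_mul ?_ (hS m) (hpos m x).le (by positivity)
        rw [mul_div_assoc]
        exact mul_le_mul (neg_le_abs _) hi (by positivity) (abs_nonneg _)
    have h0 := hk 0 2
    have h1 := hk 1 0
    have h2 := hk 2 1
    have e1 : (2 + 1 : Fin 3) = 0 := rfl
    have e2 : (1 + 1 : Fin 3) = 2 := rfl
    have e3 : (0 - 1 : Fin 3) = 2 := rfl
    have e4 : (1 - 1 : Fin 3) = 0 := rfl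
    have e5 : (2 - 1 : Fin 3) = 1 := rfl
    simp only [hρ'def, growth, Fin.sum_univ_three, e1, e2, e3, e4, e5, zero_add]
    linarith
  have h := mul_exp_le_of_hasDerivAt_le (S := fun x => ρ 0 x + ρ 1 x + ρ 2 x) (a := 3)
    (by norm_num) (fun x => ((hρ 0 x).add (hρ 1 x)).add (hρ 2 x)) (T.continuous_growth ε)
    (T.integrable_growth ε) (T.growth_nonneg hε) hle
    (by have := ((hlim 0).add (hlim 1)).add (hlim 2); norm_num at this; exact this) x
  simp only [hsum] at h
  linarith

/-- The diagonal entries of the scattering matrix are bounded away from zero. -/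
theorem le_norm_scat_sq {ε μ : ℝ} (hε : 0 < ε) (hμ : ε < μ) :
    Real.exp (-∫ y, T.growth ε y) ≤ ‖scat T.NN T.MM 0 0 μ‖ ^ 2 := by
  have hμ0 : 0 < μ := hε.trans hμ
  have hd := fun j hj i => l_sub_re_nonneg hμ0 i (j := j) hj
  have h0 : (0 : Fin 3) = 0 ∨ (0 : Fin 3) = 1 := Or.inl rfl
  have h1 : (1 : Fin 3) = 0 ∨ (1 : Fin 3) = 1 := Or.inr rfl
  have hv := jostColumn_spec T.schwartz_NN T.schwartz_MM hμ0 (hd 0 h0)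
  have hw := jostColumn_spec T.schwartz_NN T.schwartz_MM hμ0 (hd 1 h1)
  have hle := T.le_re_cross hε hμ (hv.hasDerivAt T.schwartz_NN T.schwartz_MM (hd 0 h0))
    (hw.hasDerivAt T.schwartz_NN T.schwartz_MM (hd 1 h1))
    (hv.tendsto_atTop T.schwartz_NN T.schwartz_MM (hd 0 h0))
    (hw.tendsto_atTop T.schwartz_NN T.schwartz_MM (hd 1 h1))
  have t := fun i hi j hj => tendsto_scat T.schwartz_NN T.schwartz_MM hμ0 (i := i) (j := j) hi hj
  -- At `-∞` the oscillating factors cancel in the third component of the vector product, whose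
  -- limit is a `2 × 2` minor of the scattering matrix. Conjugation symmetry makes it `|s₀₀|² -
  -- |s₁₀|²`.
  have hlim := ((t 0 h0 0 h0).mul (t 1 h1 1 h1)).sub ((t 1 h1 0 h0).mul (t 0 h0 1 h1))
  have hlim' := (Complex.continuous_re.tendsto _).comp (hlim.congr fun x => show _ =
      cross (jostColumn (l μ) (pot T.NN T.MM μ) 0 x) (jostColumn (l μ) (pot T.NN T.MM μ) 1 x) 2 by
    have e : Complex.exp (-(x : ℂ) * (l μ 1 - l μ 0)) * Complex.exp (-(x : ℂ) * (l μ 0 - l μ 1))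
        = 1 := by
      rw [← Complex.exp_add, ← Complex.exp_zero]; congr 1; ring
    simp only [sub_self, mul_zero, Complex.exp_zero, cross, Matrix.cons_val]
    linear_combination (-jostColumn (l μ) (pot T.NN T.MM μ) 0 x 1 *
      jostColumn (l μ) (pot T.NN T.MM μ) 1 x 0) * e)
  have h := ge_of_tendsto' hlim' hle
  have s1 := T.scat_swap hμ0 h0 h0
  have s2 := T.scat_swap hμ0 h1 h0
  rw [Equiv.swap_apply_left] at s1 s2
  rw [Equiv.swap_apply_right] at s2
  rw [s1, s2, Complex.mul_conj, Complex.mul_conj, Complex.sub_re, Complex.ofReal_re,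
    Complex.ofReal_re, Complex.normSq_eq_norm_sq, Complex.normSq_eq_norm_sq] at h
  linarith [sq_nonneg ‖scat T.NN T.MM 1 0 μ‖]

lemma exists_le_norm_scat {ε : ℝ} (hε : 0 < ε) :
    ∃ c, 0 < c ∧ ∀ μ, ε < μ → c ≤ ‖scat T.NN T.MM 0 0 μ‖ ∧ c ≤ ‖scat T.NN T.MM 1 1 μ‖ := by
  refine ⟨√(Real.exp (-∫ y, T.growth ε y)), Real.sqrt_pos.2 (Real.exp_pos _), fun μ hμ => ?_⟩
  have h := Real.sqrt_le_left (norm_nonneg (scat T.NN T.MM 0 0 μ)) |>.2 (T.le_norm_scat_sq hε hμ)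
  have s1 := T.scat_swap (hε.trans hμ) (i := 0) (j := 0) (Or.inl rfl) (Or.inl rfl)
  rw [Equiv.swap_apply_left] at s1
  exact ⟨h, by rwa [s1, RCLike.norm_conj]⟩

end TodaData

/-! ### The reflection coefficient of a Toda problem. -/

namespace TodaData

variable (T : TodaData)

/-- The reflection coefficient. -/
def refl (μ : ℝ) : ℂ := scat T.NN T.MM 0 1 μ / scat T.NN T.MM 0 0 μ

/-- The reflection coefficient with the roles of the first two indices exchanged. -/
def refl' (μ : ℝ) : ℂ := scat T.NN T.MM 1 0 μ / scat T.NN T.MM 1 1 μ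

lemma refl_eq_refl'_flip {μ : ℝ} (hμ : 0 < μ) : T.refl μ = T.flip.refl' μ⁻¹ := by
  rw [refl, refl', T.scat_eq_flip hμ (Or.inl rfl) (Or.inr rfl),
    T.scat_eq_flip hμ (Or.inl rfl) (Or.inl rfl), Equiv.swap_apply_left, Equiv.swap_apply_right]

lemma scat_ne_zero {μ : ℝ} (hμ : 0 < μ) : scat T.NN T.MM 0 0 μ ≠ 0 := by
  obtain ⟨c, hc, h⟩ := T.exists_le_norm_scat (half_pos hμ)
  exact norm_pos_iff.1 (hc.trans_le (h μ (half_lt_self hμ)).1)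

lemma polySmooth_div {ε c : ℝ} (hε : 0 < ε) (hc : 0 < c) {f g : ℝ → ℂ} {m : ℕ}
    (hf : PolySmooth (Set.Ioi ε) m f) (hg : PolySmooth (Set.Ioi ε) m g)
    (hgc : ∀ μ, ε < μ → c ≤ ‖g μ‖) : PolySmooth (Set.Ioi ε) m (fun μ => f μ / g μ) := by
  have hU : Set.Ioi ε ⊆ Set.Ioi 0 := Set.Ioi_subset_Ioi hε.le
  have hne : ∀ μ ∈ Set.Ioi ε, g μ ≠ 0 := fun μ hμ =>
    norm_pos_iff.1 (hc.trans_le (hgc μ hμ))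
  simp only [div_eq_mul_inv]
  refine hf.mul isOpen_Ioi hU (hg.inverse isOpen_Ioi hU (.of_le (C := c⁻¹) fun μ hμ => ?_)
    (fun μ hμ => mul_inv_cancel₀ (hne μ hμ)) fun μ hμ => inv_mul_cancel₀ (hne μ hμ))
  rw [norm_inv]
  exact inv_anti₀ hc (hgc μ hμ)

lemma polySmooth_refl_Ioi {ε : ℝ} (hε : 0 < ε) (m : ℕ) :
    PolySmooth (Set.Ioi ε) m T.refl ∧ PolySmooth (Set.Ioi ε) m T.refl' := by
  obtain ⟨c, hc, h⟩ := T.exists_le_norm_scat hε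
  have hs := fun i hi j hj =>
    polySmooth_scat T.schwartz_NN T.schwartz_MM hε (i := i) (j := j) hi hj m
  exact ⟨polySmooth_div hε hc (hs 0 (Or.inl rfl) 1 (Or.inr rfl)) (hs 0 (Or.inl rfl) 0 (Or.inl rfl))
    fun μ hμ => (h μ hμ).1, polySmooth_div hε hc (hs 1 (Or.inr rfl) 0 (Or.inl rfl))
      (hs 1 (Or.inr rfl) 1 (Or.inr rfl)) fun μ hμ => (h μ hμ).2⟩

/-- The estimates hold only away from `μ = 0`. The half-line is covered by `(1/2, ∞)` and `(0, 2)`,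
the latter being carried into `(1/2, ∞)` by inversion and the flipped data. -/
lemma polySmooth_refl (m : ℕ) : PolySmooth (Set.Ioi 0) m T.refl := by
  have hε : (0 : ℝ) < 1 / 2 := by norm_num
  have h1 := (T.polySmooth_refl_Ioi hε m).1
  have hU : Set.Ioi (1 / 2 : ℝ) ⊆ Set.Ioi 0 := Set.Ioi_subset_Ioi hε.le
  have hU' : Set.Ioo (0 : ℝ) 2 ⊆ Set.Ioi 0 := fun μ hμ => hμ.1
  have h2 : PolySmooth (Set.Ioo (0 : ℝ) 2) m T.refl :=
    ((T.flip.polySmooth_refl_Ioi hε m).2.comp_inv isOpen_Ioo hU' fun μ hμ => by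
      rw [Set.mem_Ioi, one_div]
      exact inv_strictAnti₀ hμ.1 hμ.2).congr isOpen_Ioo
      fun μ hμ => (T.refl_eq_refl'_flip hμ.1).symm
  have h3 : Set.Ioi (1 / 2 : ℝ) ∪ Set.Ioo 0 2 = Set.Ioi 0 := by
    ext μ
    simp only [Set.mem_union, Set.mem_Ioi, Set.mem_Ioo]
    constructor
    · rintro (h | h) <;> linarith
    · intro h
      rcases lt_or_ge (1 / 2 : ℝ) μ with h' | h'
      · exact Or.inl h'
      · exact Or.inr ⟨h, by linarith⟩
  rw [← h3]
  exact h1.union hU hU' h2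

lemma exists_norm_div_mul_rho_le {c : ℝ} (hc : 0 < c) {f g : ℝ → ℂ}
    (hf : ∀ k : ℕ, ∃ C, ∀ μ, 1 / 2 < μ → ‖f μ‖ ≤ C * (μ⁻¹) ^ k)
    (hgc : ∀ μ, 1 / 2 < μ → c ≤ ‖g μ‖) (k : ℕ) :
    ∃ C, ∀ μ, 1 / 2 < μ → ‖f μ / g μ‖ * rho μ ^ k ≤ C := by
  obtain ⟨C, hC⟩ := hf k
  refine ⟨|C| / c * 5 ^ k, fun μ hμ => ?_⟩
  have hμ0 : 0 < μ := by linarith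
  -- For `μ > 1/2` one has `μ⁻¹ ≤ 4 μ`.
  have hr : rho μ ≤ 5 * μ := by
    have : μ⁻¹ ≤ 4 * μ := by
      rw [inv_le_iff_one_le_mul₀ hμ0]; nlinarith
    unfold rho; linarith
  have hr0 := rho_pos hμ0
  have h1 : ‖f μ / g μ‖ ≤ |C| * (μ⁻¹) ^ k / c := by
    rw [norm_div]
    refine div_le_div₀ (by positivity) ((hC μ hμ).trans ?_) hc (hgc μ hμ)
    gcongr
    exact le_abs_self C
  calc ‖f μ / g μ‖ * rho μ ^ k ≤ |C| * (μ⁻¹) ^ k / c * (5 * μ) ^ k := by gcongr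
    _ = |C| / c * 5 ^ k * ((μ⁻¹) ^ k * μ ^ k) := by rw [mul_pow]; ring
    _ = _ := by rw [← mul_pow, inv_mul_cancel₀ hμ0.ne', one_pow, mul_one]

lemma exists_norm_refl_mul_rho_le (k : ℕ) :
    ∃ C, ∀ μ, 1 / 2 < μ → ‖T.refl μ‖ * rho μ ^ k ≤ C ∧ ‖T.refl' μ‖ * rho μ ^ k ≤ C := by
  have hε : (0 : ℝ) < 1 / 2 := by norm_num
  obtain ⟨c, hc, h⟩ := T.exists_le_norm_scat hε
  obtain ⟨C, hC⟩ := exists_norm_div_mul_rho_le hc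
    (exists_norm_scat_le T.schwartz_NN T.schwartz_MM T.NN_diag (Or.inl rfl) (Or.inr rfl)
      zero_ne_one hε) (fun μ hμ => (h μ hμ).1) k
  obtain ⟨C', hC'⟩ := exists_norm_div_mul_rho_le hc
    (exists_norm_scat_le T.schwartz_NN T.schwartz_MM T.NN_diag (Or.inr rfl) (Or.inl rfl)
      one_ne_zero hε) (fun μ hμ => (h μ hμ).2) k
  exact ⟨max C C', fun μ hμ => ⟨(hC μ hμ).trans (le_max_left _ _),
    (hC' μ hμ).trans (le_max_right _ _)⟩⟩

lemma rapidDecay_refl : RapidDecay T.refl := fun k => by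
  obtain ⟨C, hC⟩ := T.exists_norm_refl_mul_rho_le k
  obtain ⟨C', hC'⟩ := T.flip.exists_norm_refl_mul_rho_le k
  refine ⟨max C C', fun μ hμ => ?_⟩
  rcases lt_or_ge (1 / 2 : ℝ) μ with h | h
  · exact (hC μ h).1.trans (le_max_left _ _)
  · rw [T.refl_eq_refl'_flip hμ, ← rho_inv]
    refine (hC' μ⁻¹ ?_).2.trans (le_max_right _ _)
    rw [one_div]
    exact inv_strictAnti₀ hμ (by linarith)

lemma contDiffOn_refl : ContDiffOn ℝ ∞ T.refl (Set.Ioi 0) :=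
  contDiffOn_infty.2 fun n => (T.polySmooth_refl (n + 1)).contDiffOn isOpen_Ioi

lemma rapidDecay_iteratedDeriv_refl (n : ℕ) : RapidDecay (iteratedDeriv n T.refl) :=
  T.rapidDecay_refl.iteratedDeriv T.polySmooth_refl n

lemma tendsto_refl : Tendsto T.refl (𝓝[>] 0) (𝓝 0) := by
  refine (T.rapidDecay_refl.isBigO_nhdsGT 1).trans_tendsto ?_
  simp only [pow_one]
  exact tendsto_nhdsWithin_of_tendsto_nhds tendsto_id

lemma existsUnique_column {μ : ℝ} (hμ : 0 < μ) {j : Fin 3} (hj : j = 0 ∨ j = 1) :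
    (∃! w, IsJostColumn (l μ) (pot T.NN T.MM μ) j w) ∧
      Integrable (scatteringIntegrand (l μ) (pot T.NN T.MM μ) 0 j) :=
  ⟨existsUnique_isJostColumn T.schwartz_NN T.schwartz_MM hμ fun i => l_sub_re_nonneg hμ i hj,
    integrable_scatteringIntegrand T.schwartz_NN T.schwartz_MM hμ
      (fun i => l_sub_re_nonneg hμ i hj) (l_sub_re_eq_zero μ (Or.inl rfl) hj)⟩

end TodaData

/-! ### Reduction of the Klein–Gordon scattering data to Toda problems. -/

lemma iteratedDeriv_comp_neg_isBigO {f : ℝ → ℂ} {n : ℕ} {φ : ℝ → ℝ} {F F' : Filter ℝ}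
    (hF : Tendsto (fun x : ℝ => -x) F F') (hφ : ∀ x, ‖φ (-x)‖ = ‖φ x‖)
    (h : iteratedDeriv n f =O[F'] φ) : iteratedDeriv n (fun x => f (-x)) =O[F] φ := by
  refine Asymptotics.IsBigO.of_norm_norm
    ((h.comp_tendsto hF).norm_norm.congr (fun x => ?_) fun x => hφ x)
  rw [iteratedDeriv_comp_neg, norm_smul]
  simp

lemma tendsto_neg_nhdsLT_zero : Tendsto (fun x : ℝ => -x) (𝓝[<] 0) (𝓝[>] 0) := by
  simpa using tendsto_neg_nhdsLT (a := (0 : ℝ))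

lemma isSchwartz_coe (f : 𝓢(ℝ, ℝ)) : IsSchwartz fun x => (f x : ℂ) :=
  ⟨SchwartzMap.postcompCLM Complex.ofRealCLM f, rfl⟩

namespace InitialData

variable (D : InitialData)

/-- The combination `(u_t + u_x) / 6` of the initial data. -/
def fu (x : ℝ) : ℝ := (D.u1 x + deriv D.u0 x) / 6

/-- The combination `(v_t + v_x) / 2` of the initial data. -/
def fv (x : ℝ) : ℝ := (D.v1 x + deriv D.v0 x) / 2

lemma schwartz_comb (a b : ℝ) : IsSchwartz fun x => ((a * D.fu x + b * D.fv x : ℝ) : ℂ) := by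
  have h := ((((isSchwartz_coe D.u1).add (isSchwartz_coe D.u0).deriv_real).const_mul (a / 6)).add
    (((isSchwartz_coe D.v1).add (isSchwartz_coe D.v0).deriv_real).const_mul (b / 2)))
  convert h using 2 with x
  unfold fu fv; push_cast; ring

lemma schwartz_exponent (a b : ℝ) : IsSchwartz fun x => ((a * D.u0 x + b * D.v0 x : ℝ) : ℂ) := by
  have h := ((isSchwartz_coe D.u0).const_mul a).add ((isSchwartz_coe D.v0).const_mul b)
  convert h using 2 with x
  push_cast; ring

/-- The data of the spectral problem `X_x - [𝔏, X] = L₁ X`. -/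
def toda : TodaData where
  n := ![fun x => -3 * D.fu x + 1 * D.fv x, fun x => 0 * D.fu x + -2 * D.fv x,
    fun x => 3 * D.fu x + 1 * D.fv x]
  α := ![fun x => 2 * D.u0 x + 0 * D.v0 x, fun x => -1 * D.u0 x + 3 * D.v0 x,
    fun x => -1 * D.u0 x + -3 * D.v0 x]
  schwartz_n k := by fin_cases k <;> exact D.schwartz_comb _ _
  schwartz_α k := by fin_cases k <;> exact D.schwartz_exponent _ _
  sum_n x := by simp only [Matrix.cons_val]; ring
  sum_α x := by simp only [Matrix.cons_val]; ring

/-- The data of the cofactor problem `X^A_x + [𝔏, X^A] = -L₁ᵀ X^A` after the reflection of the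
spectral parameter. -/
def todaA : TodaData where
  n k x := -D.toda.n (-k) x
  α k x := D.toda.α (1 - k) x
  schwartz_n k := by simpa using (D.toda.schwartz_n (-k)).neg
  schwartz_α k := D.toda.schwartz_α (1 - k)
  sum_n x := by
    have e1 : (-1 : Fin 3) = 2 := rfl
    have e2 : (-2 : Fin 3) = 1 := rfl
    simp only [neg_zero, e1, e2]
    linarith [D.toda.sum_n x]
  sum_α x := by
    have e1 : (1 - 2 : Fin 3) = 2 := rfl
    simp only [sub_zero, sub_self, e1]
    linarith [D.toda.sum_α x]

lemma N_eq (x : ℝ) : N D x = D.toda.NN x := by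
  ext i k
  fin_cases i <;> fin_cases k <;>
    simp [N, TodaData.NN, circ, toda, fu, fv, omega_sq] <;> ring

/-- The circulant factor has eigenvalues `c - 1`, `b - 1`, `a - 1`; the subtracted ones produce the
`-3` in the coefficient of `J²`. -/
lemma M_eq (x : ℝ) : (1 / 6 : ℂ) • M D x = D.toda.MM x := by
  have h2 := omega_sq
  have h3 := omega_pow_three
  have h4 := omega_pow_four
  have e0 : 2 * D.u0 x + 0 * D.v0 x = 2 * D.u0 x := by ring
  have e1 : -1 * D.u0 x + 3 * D.v0 x = 3 * D.v0 x - D.u0 x := by ring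
  have e2 : -1 * D.u0 x + -3 * D.v0 x = -D.u0 x - 3 * D.v0 x := by ring
  ext i k
  simp only [TodaData.MM, TodaData.expCirc, toda, M, circ, diagJ, Matrix.of_apply,
    Matrix.smul_apply, Matrix.add_apply, smul_eq_mul, Matrix.diagonal_pow, Matrix.cons_val, e0, e1,
    e2]
  push_cast
  generalize Complex.exp (2 * (D.u0 x : ℂ)) = c
  generalize Complex.exp (3 * (D.v0 x : ℂ) - D.u0 x) = b
  generalize Complex.exp (-(D.u0 x : ℂ) - 3 * D.v0 x) = a
  fin_cases i <;> fin_cases k <;> simp [Matrix.diagonal] <;> ring_nf <;>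
    (try simp only [h2, h3, h4]) <;> ring

lemma L₁_eq (μ : ℝ) : L₁ D μ = pot D.toda.NN D.toda.MM μ := by
  ext1 x
  rw [L₁, pot, N_eq, ← M_eq, smul_smul, mul_inv, mul_comm (6 : ℂ)⁻¹, one_div]

lemma NN_todaA (x : ℝ) : D.todaA.NN x = -(D.toda.NN x).transpose := by
  have e1 : (-1 : Fin 3) = 2 := rfl
  have e2 : (-2 : Fin 3) = 1 := rfl
  ext i k
  fin_cases i <;> fin_cases k <;> simp [TodaData.NN, circ, todaA, e1, e2] <;> ring

/-- Transposition puts the circulant before `J²`. Moving `J²` back past it shifts the Fourier index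
by one, while transposition reverses it; hence `α (1 - k)` in `todaA`. -/
lemma MM_todaA (x : ℝ) : D.todaA.MM x = (D.toda.MM x).transpose := by
  have h2 := omega_sq
  have h3 := omega_pow_three
  have h4 := omega_pow_four
  have e1 : (1 - 2 : Fin 3) = 2 := rfl
  ext i k
  simp only [TodaData.MM, TodaData.expCirc, Matrix.of_apply, Matrix.transpose_apply, todaA]
  fin_cases i <;> fin_cases k <;> simp [circ, diagJ, e1, -mul_eq_mul_left_iff] <;> ring_nf <;>
    (try simp only [h2, h3, h4]) <;> ring

/-- The minus sign in `-L₁ᵀ` stays with `N` but is absorbed in the spectral parameter for the term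
with `M`, so the exponents `exp α` keep their positive sign. -/
lemma L₁A_eq (lam : ℝ) : L₁A D lam = pot D.todaA.NN D.todaA.MM (-lam) := by
  ext1 x
  rw [L₁A, L₁_eq, pot, pot, NN_todaA, MM_todaA, Matrix.transpose_add, Matrix.transpose_smul,
    neg_add]
  push_cast
  rw [inv_neg, neg_smul]

lemma lA_eq (lam : ℝ) : lA lam = l ((-lam : ℝ) : ℂ) := by
  ext i
  simp only [lA, l, Pi.neg_apply]
  push_cast
  rw [mul_neg, inv_neg]; ring

lemma s_eq (i j : Fin 3) (μ : ℝ) : s D i j μ = scat D.toda.NN D.toda.MM i j μ := by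
  rw [s, scat, L₁_eq]

lemma sA_eq (i j : Fin 3) (lam : ℝ) : sA D i j lam = scat D.todaA.NN D.todaA.MM i j (-lam) := by
  rw [sA, scat, L₁A_eq, lA_eq]

lemma r₁_eq : r₁ D = D.toda.refl := by
  ext μ; rw [r₁, TodaData.refl, s_eq, s_eq]

lemma r₂_eq : r₂ D = fun lam => D.todaA.refl (-lam) := by
  ext lam; rw [r₂, TodaData.refl, sA_eq, sA_eq]

end InitialData

end TwoComponentKG

end

theorem theorem2p1 (D : TwoComponentKG.InitialData) :
    -- `r₁` is well defined on `(0, ∞)`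
    (∀ lam : ℝ, 0 < lam →
      (∀ j : Fin 3, j = 0 ∨ j = 1 →
        (∃! w : ℝ → Fin 3 → ℂ,
          TwoComponentKG.IsJostColumn (TwoComponentKG.l lam) (TwoComponentKG.L₁ D lam) j w) ∧
        Integrable (TwoComponentKG.scatteringIntegrand
          (TwoComponentKG.l lam) (TwoComponentKG.L₁ D lam) 0 j)) ∧
      TwoComponentKG.s D 0 0 lam ≠ 0) ∧
    -- `r₂` is well defined on `(-∞, 0)`
    (∀ lam : ℝ, lam < 0 →
      (∀ j : Fin 3, j = 0 ∨ j = 1 →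
        (∃! w : ℝ → Fin 3 → ℂ,
          TwoComponentKG.IsJostColumn (TwoComponentKG.lA lam) (TwoComponentKG.L₁A D lam) j w) ∧
        Integrable (TwoComponentKG.scatteringIntegrand
          (TwoComponentKG.lA lam) (TwoComponentKG.L₁A D lam) 0 j)) ∧
      TwoComponentKG.sA D 0 0 lam ≠ 0) ∧
    -- smoothness
    ContDiffOn ℝ ∞ (TwoComponentKG.r₁ D) (Set.Ioi 0) ∧
    ContDiffOn ℝ ∞ (TwoComponentKG.r₂ D) (Set.Iio 0) ∧
    -- rapid decay at `±∞`, with all derivatives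
    (∀ n k : ℕ, iteratedDeriv n (TwoComponentKG.r₁ D) =O[atTop] fun lam : ℝ => (lam ^ k)⁻¹) ∧
    (∀ n k : ℕ, iteratedDeriv n (TwoComponentKG.r₂ D) =O[atBot] fun lam : ℝ => (lam ^ k)⁻¹) ∧
    -- rapid decay at `0`, with all derivatives
    (∀ n k : ℕ, iteratedDeriv n (TwoComponentKG.r₁ D) =O[𝓝[>] 0] fun lam : ℝ => lam ^ k) ∧
    (∀ n k : ℕ, iteratedDeriv n (TwoComponentKG.r₂ D) =O[𝓝[<] 0] fun lam : ℝ => lam ^ k) ∧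
    -- the values at `0`, by continuous extension
    Tendsto (TwoComponentKG.r₁ D) (𝓝[>] 0) (𝓝 0) ∧
    Tendsto (TwoComponentKG.r₂ D) (𝓝[<] 0) (𝓝 0) := by
  have h1 := D.r₁_eq
  have h2 := D.r₂_eq
  refine ⟨fun lam hlam => ?_, fun lam hlam => ?_, ?_, ?_, fun n k => ?_, fun n k => ?_,
    fun n k => ?_, fun n k => ?_, ?_, ?_⟩
  · rw [D.s_eq, D.L₁_eq]
    exact ⟨fun j hj => D.toda.existsUnique_column hlam hj, D.toda.scat_ne_zero hlam⟩
  · rw [D.sA_eq, D.L₁A_eq, TwoComponentKG.InitialData.lA_eq]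
    exact ⟨fun j hj => D.todaA.existsUnique_column (neg_pos.2 hlam) hj,
      D.todaA.scat_ne_zero (neg_pos.2 hlam)⟩
  · rw [h1]
    exact D.toda.contDiffOn_refl
  · rw [h2]
    exact D.todaA.contDiffOn_refl.comp contDiff_neg.contDiffOn fun x hx =>
      Set.mem_Ioi.2 (neg_pos.2 hx)
  · rw [h1]
    exact (D.toda.rapidDecay_iteratedDeriv_refl n).isBigO_atTop k
  · rw [h2]
    exact TwoComponentKG.iteratedDeriv_comp_neg_isBigO tendsto_neg_atBot_atTop (by simp)
      ((D.todaA.rapidDecay_iteratedDeriv_refl n).isBigO_atTop k)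
  · rw [h1]
    exact (D.toda.rapidDecay_iteratedDeriv_refl n).isBigO_nhdsGT k
  · rw [h2]
    exact TwoComponentKG.iteratedDeriv_comp_neg_isBigO TwoComponentKG.tendsto_neg_nhdsLT_zero
      (by simp) ((D.todaA.rapidDecay_iteratedDeriv_refl n).isBigO_nhdsGT k)
  · rw [h1]
    exact D.toda.tendsto_refl
  · rw [h2]
    exact D.todaA.tendsto_refl.comp TwoComponentKG.tendsto_neg_nhdsLT_zero
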